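/- Let $\vec v_k=e^{ik\pi/4}\in\mathbb{C}=\mathbb{R}^2$ for $1\le k\le 4$ and let $\vec e_1,\dots,\vec e_4$ be the canonical basis of $\mathbb{R}^4$. An octagonal tiling is a covering of the plane by translates of the six rhombi $\{\lambda\vec v_i+\mu\vec v_j : 0\le\lambda,\mu\le1\}$, $1\le i<j\le4$, any two of which meet, if at all, only in a common vertex or along a common complete edge. A lift of it is the surface in $\mathbb{R}^4$ obtained by mapping its rhombi to unit faces of the lattice $\mathbb{Z}^4$ so that rhombi adjacent along an edge $\vec v_k$ are mapped to faces adjacent along an edge $\vec e_k$. The tiling is planar with slope the two-dimensional plane $E\subset\mathbb{R}^4$ if, for some $t\ge1$, some translate of a lift is contained in $E+[0,t]^4$; its thickness is the infimum of these $t$. We say that it is planar of slope $E$ and thickness one if some translate of a lift is contained in $E+[0,1]^4$ and the lift does not reach two opposite sides of this slice, i.e. all differences of two points of the lift are in $E+(-1,1)^4$ (this holds for instance if a translate of a lift is contained in $E+[0,1)^4$). A plane generated by $u,w\in\mathbb{R}^4$ has Grassmann coordinates $(G_{12},G_{13},G_{14},G_{23},G_{24},G_{34})$, $G_{ij}=u_iw_j-u_jw_i$,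 which are unique up to a common nonzero factor. Let $$E_0=(0,0,0,0,1,0),\qquad E_t=(1,t,1,1,2/t,1)\ (t\in\mathbb{R}\setminus\{0\}),\qquad E_\infty=(0,1,0,0,0,0).$$ The two notched tiles are a unit square and a unit rhombus with a $45^\circ$ angle, with a notch on each edge that distinguishes the two directions of the edge and is recorded as an arrow along it: in the square, the arrows on opposite edges are translates of each other; in the rhombus, the arrow on each edge points to the acute corner. In a tiling of the plane by isometric copies of these tiles, two tiles meet, if at all, only in a common vertex or along a common complete edge on which their arrows coincide. An octagonal tiling can be formed by the notched tiles if it is such a tiling with the notches erased. **Theorem.** 1. Every tiling of the plane by the notched tiles is, after a rotation of the plane and with its notches erased, an octagonal tiling. 2. There is a constant $C$ such that every octagonal tiling that can be formed by the notched tiles is planar with slope $E_t$ for some $t\in\mathbb{R}\cup\{\infty\}$ and has thickness at most $C$. 3. The octagonal tilings by squares only are exactly the planar octagonal tilings of thickness one with slope $E_0$ or $E_\infty$. 4. Conversely, for every $t\in\mathbb{R}\cup\{\infty\}$, every planar octagonal tiling of thickness one with slope $E_t$ can be formed by the notched tiles. 5. The planar octagonal tilings of thickness one with slope $E_{\sqrt2}$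 are exactly the Ammann–Beenker tilings, i.e. the planar octagonal tilings of thickness one whose slope is generated by $(\cos\frac{k\pi}4)_{0\le k<4}$ and $(\sin\frac{k\pi}4)_{0\le k<4}$. -/

import Mathlib

namespace Octagonal

noncomputable section

/-- The four edge directions: `v 0, v 1, v 2, v 3` are the unit vectors at the angles
45, 90, 135 and 180 degrees. -/
def v (k : Fin 4) : ℂ :=
  Complex.exp (((((k : ℕ) : ℝ) + 1) * (Real.pi / 4) : ℝ) * Complex.I)

/-- A translate of one of the six rhombi spanned by `v i` and `v j`, `i < j`. -/
structure Rhombus where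
  base : ℂ
  i : Fin 4
  j : Fin 4
  lt : i < j

/-- The set of points of the plane covered by the rhombus. -/
def Rhombus.region (r : Rhombus) : Set ℂ :=
  {z | ∃ a ∈ Set.Icc (0 : ℝ) 1, ∃ b ∈ Set.Icc (0 : ℝ) 1, z = r.base + a • v r.i + b • v r.j}

/-- The four vertices of a rhombus. -/
def Rhombus.vertices (r : Rhombus) : Set ℂ :=
  {r.base, r.base + v r.i, r.base + v r.j, r.base + v r.i + v r.j}

/-- The four (complete, closed) edges of a rhombus. -/
def Rhombus.edges (r : Rhombus) : Set (Set ℂ) :=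
  {segment ℝ r.base (r.base + v r.i),
   segment ℝ r.base (r.base + v r.j),
   segment ℝ (r.base + v r.j) (r.base + v r.i + v r.j),
   segment ℝ (r.base + v r.i) (r.base + v r.i + v r.j)}

/-- The rhombus is a square: its two edge directions are orthogonal. The remaining four rhombi
have a 45 degree angle. -/
def Rhombus.IsSquare (r : Rhombus) : Prop := (r.j : ℕ) = (r.i : ℕ) + 2

/-- Octagonal tilings: coverings of the plane by rhombi, any two of which meet, if at all, in a
common vertex or along a common complete edge. -/
structure IsOctagonalTiling (T : Set Rhombus) : Prop where
  covers : ⋃ r ∈ T, r.region = Set.univ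
  meets : ∀ r ∈ T, ∀ s ∈ T, r ≠ s →
    r.region ∩ s.region = ∅ ∨
    (∃ p ∈ r.vertices ∩ s.vertices, r.region ∩ s.region = {p}) ∨
    (∃ e ∈ r.edges ∩ s.edges, r.region ∩ s.region = e)

/-- A lift of a set of rhombi, given on vertices (the values of `h` elsewhere play no role): an
edge `v k` is mapped to an edge `e k` of the lattice, so each rhombus is mapped to a unit face and
rhombi adjacent along `v k` are mapped to faces adjacent along `e k`. -/
def IsLift (T : Set Rhombus) (h : ℂ → Fin 4 → ℤ) : Prop :=
  ∀ r ∈ T,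
    h (r.base + v r.i) = h r.base + Pi.single r.i 1 ∧
    h (r.base + v r.j) = h r.base + Pi.single r.j 1 ∧
    h (r.base + v r.i + v r.j) = h r.base + Pi.single r.i 1 + Pi.single r.j 1

/-- The surface in four-dimensional space formed by the unit faces of a lift. -/
def liftSurface (T : Set Rhombus) (h : ℂ → Fin 4 → ℤ) : Set (Fin 4 → ℝ) :=
  {x | ∃ r ∈ T, ∃ a ∈ Set.Icc (0 : ℝ) 1, ∃ b ∈ Set.Icc (0 : ℝ) 1,
    x = (fun k => (h r.base k : ℝ)) + a • Pi.single r.i (1 : ℝ) + b • Pi.single r.j (1 : ℝ)}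

/-- The sum of the plane `E` and the cube with edges `I`. -/
def slice (E : Submodule ℝ (Fin 4 → ℝ)) (I : Set ℝ) : Set (Fin 4 → ℝ) :=
  {x | ∃ y ∈ E, ∀ k, x k - y k ∈ I}

/-- The tiling has a lift that some translation carries into the closed slice `E + [0, t] ^ 4`. -/
def FitsInSlice (T : Set Rhombus) (E : Submodule ℝ (Fin 4 → ℝ)) (t : ℝ) : Prop :=
  ∃ h : ℂ → Fin 4 → ℤ, IsLift T h ∧
    ∃ c : Fin 4 → ℝ, ∀ x ∈ liftSurface T h, x - c ∈ slice E (Set.Icc 0 t)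

/-- `T` is planar with slope `E`. -/
def IsPlanar (T : Set Rhombus) (E : Submodule ℝ (Fin 4 → ℝ)) : Prop :=
  Module.finrank ℝ E = 2 ∧ ∃ t : ℝ, 1 ≤ t ∧ FitsInSlice T E t

/-- The thickness of a planar tiling `T` of slope `E`. -/
def thickness (T : Set Rhombus) (E : Submodule ℝ (Fin 4 → ℝ)) : ℝ :=
  sInf {t : ℝ | 1 ≤ t ∧ FitsInSlice T E t}

/-- `T` is planar of slope `E` and thickness one: it has a lift that some translation carries into
`E + [0, 1] ^ 4`, and this lift does not reach two opposite sides of that slice. The last clause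
says that no difference of two points of the lift is on the boundary of `E + [-1, 1] ^ 4`. It holds
for example when the lift fits into `E + [0, 1) ^ 4`. -/
def IsPlanarOfThicknessOne (T : Set Rhombus) (E : Submodule ℝ (Fin 4 → ℝ)) : Prop :=
  Module.finrank ℝ E = 2 ∧
  ∃ h : ℂ → Fin 4 → ℤ, IsLift T h ∧
    (∃ c : Fin 4 → ℝ, ∀ x ∈ liftSurface T h, x - c ∈ slice E (Set.Icc 0 1)) ∧
    ∀ x ∈ liftSurface T h, ∀ y ∈ liftSurface T h, x - y ∈ slice E (Set.Ioo (-1) 1)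

/-- The Grassmann coordinates `(G₁₂, G₁₃, G₁₄, G₂₃, G₂₄, G₃₄)` of a pair of vectors. -/
def grassmann (a b : Fin 4 → ℝ) : Fin 6 → ℝ :=
  ![a 0 * b 1 - a 1 * b 0, a 0 * b 2 - a 2 * b 0, a 0 * b 3 - a 3 * b 0,
    a 1 * b 2 - a 2 * b 1, a 1 * b 3 - a 3 * b 1, a 2 * b 3 - a 3 * b 2]

/-- `E` is a two-dimensional plane with Grassmann coordinates `G`, which are only determined up to
a common nonzero factor. -/
def HasGrassmannCoords (E : Submodule ℝ (Fin 4 → ℝ)) (G : Fin 6 → ℝ) : Prop :=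
  ∃ a b : Fin 4 → ℝ, LinearIndependent ℝ ![a, b] ∧ E = Submodule.span ℝ {a, b} ∧
    ∃ c : ℝ, c ≠ 0 ∧ grassmann a b = c • G

/-- The Grassmann coordinates of the plane `E_t`, where `t` is a real number or infinity. -/
def slopeCoords : OnePoint ℝ → Fin 6 → ℝ
  | none => ![0, 1, 0, 0, 0, 0]
  | some t => if t = 0 then ![0, 0, 0, 0, 1, 0] else ![1, t, 1, 1, 2 / t, 1]

/-- A polygon with notched edges. A notch distinguishes the two directions of its edge. It is
recorded as an arrow, an ordered pair of vertices. The edges of the tile are the segments that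
carry the arrows. -/
@[ext]
structure NotchedTile where
  region : Set ℂ
  arrows : Set (ℂ × ℂ)

/-- The vertices of a notched tile. -/
def NotchedTile.vertices (τ : NotchedTile) : Set ℂ :=
  {p | ∃ a ∈ τ.arrows, p = a.1 ∨ p = a.2}

/-- A copy of a notched tile, moved by an isometry of the plane. -/
def NotchedTile.map (φ : ℂ ≃ᵢ ℂ) (τ : NotchedTile) : NotchedTile where
  region := φ '' τ.region
  arrows := (fun a => (φ a.1, φ a.2)) '' τ.arrows

/-- The parallelogram with corners `0, 1, w, 1 + w`. -/
def parallelogram (w : ℂ) : Set ℂ :=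
  {z | ∃ a ∈ Set.Icc (0 : ℝ) 1, ∃ b ∈ Set.Icc (0 : ℝ) 1, z = (a : ℂ) + b • w}

/-- The notched unit square: the notches of opposite edges are translates of each other. -/
def notchedSquare : NotchedTile where
  region := parallelogram Complex.I
  arrows := {(0, 1), (Complex.I, 1 + Complex.I), (0, Complex.I), (1, 1 + Complex.I)}

/-- The notched unit rhombus with a 45 degree angle (at `0` and `1 + v 0`): each arrow points to
the acute corner of its edge. -/
def notchedRhombus : NotchedTile where
  region := parallelogram (v 0)
  arrows := {(1, 0), (v 0, 0), (1, 1 + v 0), (v 0, 1 + v 0)}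

/-- Tilings of the plane by isometric copies of the two notched tiles: two tiles meet, if at all,
in a common vertex or along a common complete edge on which their notches match. -/
structure IsNotchedTiling (N : Set NotchedTile) : Prop where
  copies : ∀ τ ∈ N, ∃ φ : ℂ ≃ᵢ ℂ, τ = notchedSquare.map φ ∨ τ = notchedRhombus.map φ
  covers : ⋃ τ ∈ N, τ.region = Set.univ
  meets : ∀ τ ∈ N, ∀ σ ∈ N, τ ≠ σ →
    τ.region ∩ σ.region = ∅ ∨
    (∃ p ∈ τ.vertices ∩ σ.vertices, τ.region ∩ σ.region = {p}) ∨
    (∃ a ∈ τ.arrows ∩ σ.arrows, τ.region ∩ σ.region = segment ℝ a.1 a.2)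

/-- The octagonal tiling `T` can be formed by the two notched tiles: its rhombi are those of a
tiling by notched tiles, from which the notches have been erased. -/
def CanBeFormed (T : Set Rhombus) : Prop :=
  ∃ N : Set NotchedTile, IsNotchedTiling N ∧
    NotchedTile.region '' N = Rhombus.region '' T

/-- The plane generated by the vectors of the `cos (k π / 4)` and of the `sin (k π / 4)`,
for `k = 0, 1, 2, 3`. -/
def ammannBeenkerPlane : Submodule ℝ (Fin 4 → ℝ) :=
  Submodule.span ℝ
    {(fun k : Fin 4 => Real.cos (((k : ℕ) : ℝ) * (Real.pi / 4))),
     (fun k : Fin 4 => Real.sin (((k : ℕ) : ℝ) * (Real.pi / 4)))}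

/-- Ammann-Beenker tilings. -/
def IsAmmannBeenker (T : Set Rhombus) : Prop :=
  IsOctagonalTiling T ∧ IsPlanarOfThicknessOne T ammannBeenkerPlane

end

end Octagonal

namespace Octagonal

noncomputable section

open Set Filter Topology

/-! The forward direction (slope and thickness) rests on Ammann bars. Mark on each arrow the point
`barPoint`. Crossing a tile from an edge to the opposite one moves this point orthogonally to the
edge (`ArrowData.barPoint_opp`), so the points marked on a ribbon of edges `v k` lie on a straight
line. Crossing does not change coordinate `k` of the lift of the edge either (`coord_sum_opp`).
Hence coordinate `k` of the lift, extended to a Lipschitz map on the plane, is bounded along every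
line orthogonal to `v k` (`lift_bounded_on_lines`): up to a bounded error it is a function of one
real variable, the scalar product with `v k`.

The lift projects back to the plane, which gives two linear relations between these four functions.
Eliminating leaves a Pexider equation `N₁ x - N₃ y = F (x - y)` up to a bounded error, and Hyers'
stability argument (`exists_linear_of_pexider`) makes all four functions affine up to a bounded
error, with slopes `α` on the coordinates 1 and 3 and `1 - α` on 0 and 2 (`exists_affine_approx`).
The planes with these slopes are the `E_t`, and the errors do not depend on the tiling, which bounds
the thickness.

For the converse, on `E_t` either coordinate `k` vanishes or `bal k` is proportional to it
(`relations_bal`). For a lift of thickness one, this confines the integers `bal k` at the edges `v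
k` of one level to two consecutive values (`bal_le_of_level_eq`). `bal k` is constant across a
square and changes by one across a rhombus, so orienting each edge by whether its value is the upper
one gives exactly the two notched tiles (`isCopy_notch`).

A tiling by notched tiles is octagonal after a rotation because the eighth power of the edge vectors
is the same on all edges: it is constant on each tile and passes across common edges, and the plane
without countably many vertices is connected. The same argument shows that in a tiling by squares
all squares have the same pair of directions; its lift is then contained in a translate of a
coordinate plane. Both kinds of tilings are treated as instances of `ParaTiling`, which yields local
finiteness and this propagation principle. For slope `E_√2`, it only remains to see that the
Grassmann coordinates determine the plane. -/

/-! ### Parallelograms -/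

/-- The determinant of two vectors of the plane. -/
def cross (u w : ℂ) : ℝ := u.re * w.im - u.im * w.re

/-- The parallelogram spanned by `u` and `w` at the vertex `b`. -/
def para (b u w : ℂ) : Set ℂ :=
  {z | ∃ a ∈ Icc (0 : ℝ) 1, ∃ c ∈ Icc (0 : ℝ) 1, z = b + a * u + c * w}

lemma abs_cross_le (u w : ℂ) : |cross u w| ≤ ‖u‖ * ‖w‖ := by
  have h : cross u w = ((starRingEnd ℂ) u * w).im := by simp [cross]; ring
  rw [h]
  refine (Complex.abs_im_le_norm _).trans ?_
  simp

lemma cross_add_left (u u' w : ℂ) : cross (u + u') w = cross u w + cross u' w := by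
  simp [cross]; ring

lemma cross_add_right (u w w' : ℂ) : cross u (w + w') = cross u w + cross u w' := by
  simp [cross]; ring

lemma cross_smul_left (a : ℝ) (u w : ℂ) : cross (a * u) w = a * cross u w := by
  simp [cross]; ring

lemma cross_smul_right (a : ℝ) (u w : ℂ) : cross u (a * w) = a * cross u w := by
  simp [cross]; ring

lemma cross_self (u : ℂ) : cross u u = 0 := by simp [cross]; ring

lemma cross_comm (u w : ℂ) : cross u w = -cross w u := by simp [cross]; ring

lemma cross_neg_left (u w : ℂ) : cross (-u) w = -cross u w := by simp [cross]; ring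

lemma cross_neg_right (u w : ℂ) : cross u (-w) = -cross u w := by simp [cross]; ring

/-- Cramer's rule. -/
lemma eq_cross_add_cross {u w : ℂ} (h : cross u w ≠ 0) (z : ℂ) :
    z = ((cross z w / cross u w : ℝ) : ℂ) * u + ((cross u z / cross u w : ℝ) : ℂ) * w := by
  have e1 : z.re = cross z w / cross u w * u.re + cross u z / cross u w * w.re := by
    field_simp
    simp [cross]; ring
  have e2 : z.im = cross z w / cross u w * u.im + cross u z / cross u w * w.im := by
    field_simp
    simp [cross]; ring
  apply Complex.ext
  · rw [Complex.add_re, Complex.re_ofReal_mul, Complex.re_ofReal_mul]; exact e1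
  · rw [Complex.add_im, Complex.im_ofReal_mul, Complex.im_ofReal_mul]; exact e2

lemma coord_eq {u w : ℂ} (h : cross u w ≠ 0) {a c a' c' : ℝ} {b : ℂ}
    (e : b + a * u + c * w = b + a' * u + c' * w) : a = a' ∧ c = c' := by
  have e' : a * u + c * w = a' * u + c' * w := by linear_combination e
  have h1 := congrArg (fun z => cross z w) e'
  have h2 := congrArg (fun z => cross u z) e'
  simp only [cross_add_left, cross_add_right, cross_smul_left, cross_smul_right, cross_self,
    mul_zero, add_zero, zero_add] at h1 h2
  exact ⟨mul_right_cancel₀ h h1, mul_right_cancel₀ h h2⟩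

lemma mem_para_iff {b u w : ℂ} (h : cross u w ≠ 0) (z : ℂ) :
    z ∈ para b u w ↔ cross (z - b) w / cross u w ∈ Icc (0 : ℝ) 1 ∧
      cross u (z - b) / cross u w ∈ Icc (0 : ℝ) 1 := by
  constructor
  · rintro ⟨a, ha, c, hc, rfl⟩
    have e1 : cross (b + a * u + c * w - b) w / cross u w = a := by
      rw [show b + a * u + c * w - b = a * u + c * w by ring]
      simp only [cross_add_left, cross_smul_left, cross_self]
      field_simp; ring
    have e2 : cross u (b + a * u + c * w - b) / cross u w = c := by
      rw [show b + a * u + c * w - b = a * u + c * w by ring]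
      simp only [cross_add_right, cross_smul_right, cross_self]
      field_simp; ring
    rw [e1, e2]; exact ⟨ha, hc⟩
  · rintro ⟨h1, h2⟩
    refine ⟨_, h1, _, h2, ?_⟩
    linear_combination eq_cross_add_cross h (z - b)

lemma para_swap (b u w : ℂ) : para b u w = para b w u := by
  ext z
  constructor <;> rintro ⟨a, ha, c, hc, rfl⟩ <;> exact ⟨c, hc, a, ha, by ring⟩

lemma para_flip (b u w : ℂ) : para (b + u) (-u) w = para b u w := by
  ext z
  constructor
  · rintro ⟨a, ha, c, hc, rfl⟩
    exact ⟨1 - a, ⟨by linarith [ha.2], by linarith [ha.1]⟩, c, hc, by push_cast; ring⟩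
  · rintro ⟨a, ha, c, hc, rfl⟩
    exact ⟨1 - a, ⟨by linarith [ha.2], by linarith [ha.1]⟩, c, hc, by push_cast; ring⟩

lemma para_flip' (b u w : ℂ) : para (b + w) u (-w) = para b u w := by
  rw [para_swap, para_flip, para_swap]

lemma isCompact_para (b u w : ℂ) : IsCompact (para b u w) := by
  have : para b u w = (fun p : ℝ × ℝ => b + p.1 * u + p.2 * w) '' (Icc 0 1 ×ˢ Icc 0 1) := by
    ext z
    constructor
    · rintro ⟨a, ha, c, hc, rfl⟩
      exact ⟨(a, c), ⟨ha, hc⟩, rfl⟩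
    · rintro ⟨p, ⟨ha, hc⟩, rfl⟩
      exact ⟨p.1, ha, p.2, hc, rfl⟩
  rw [this]
  exact (isCompact_Icc.prod isCompact_Icc).image (by fun_prop)

lemma norm_sub_le_of_mem_para {b u w z : ℂ} (hu : ‖u‖ = 1) (hw : ‖w‖ = 1)
    (hz : z ∈ para b u w) : ‖z - b‖ ≤ 2 := by
  obtain ⟨a, ha, c, hc, rfl⟩ := hz
  rw [show b + a * u + c * w - b = a * u + c * w by ring]
  refine (norm_add_le _ _).trans ?_
  rw [norm_mul, norm_mul, hu, hw, Complex.norm_of_nonneg ha.1, Complex.norm_of_nonneg hc.1]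
  linarith [ha.2, hc.2]

/-- Both coordinates of the centre are 1/2, and by Cramer's rule a shift by less than 1/4 changes
them by at most (1/4) / (1/2) = 1/2. -/
lemma center_mem_ball_subset_para {b u w : ℂ} (hu : ‖u‖ = 1) (hw : ‖w‖ = 1)
    (h : 1 / 2 ≤ |cross u w|) : Metric.ball (b + u / 2 + w / 2) (1 / 4) ⊆ para b u w := by
  intro z hz
  have h0 : cross u w ≠ 0 := by
    intro h'; rw [h'] at h; norm_num at h
  rw [mem_para_iff h0]
  rw [Metric.mem_ball, dist_eq_norm] at hz
  set y := z - (b + u / 2 + w / 2) with hy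
  have hzy : z - b = y + ((1 / 2 : ℝ) : ℂ) * u + ((1 / 2 : ℝ) : ℂ) * w := by
    rw [hy]; push_cast; ring
  have key : ∀ r : ℝ, |r| ≤ 1 / 4 → |r / cross u w| ≤ 1 / 2 := by
    intro r hr
    rw [abs_div, div_le_iff₀ (abs_pos.mpr h0)]
    linarith
  have c1 : |cross y w| ≤ 1 / 4 := by
    have := abs_cross_le y w
    rw [hw] at this; linarith
  have c2 : |cross u y| ≤ 1 / 4 := by
    have := abs_cross_le u y
    rw [hu] at this; linarith
  have e1 : cross (z - b) w / cross u w = cross y w / cross u w + 1 / 2 := by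
    rw [hzy, cross_add_left, cross_add_left, cross_smul_left, cross_smul_left, cross_self]
    field_simp; ring
  have e2 : cross u (z - b) / cross u w = cross u y / cross u w + 1 / 2 := by
    rw [hzy, cross_add_right, cross_add_right, cross_smul_right, cross_smul_right, cross_self]
    field_simp; ring
  rw [e1, e2]
  have k1 := abs_le.mp (key _ c1)
  have k2 := abs_le.mp (key _ c2)
  exact ⟨⟨by linarith [k1.1], by linarith [k1.2]⟩, ⟨by linarith [k2.1], by linarith [k2.2]⟩⟩

/-! ### Families of parallelograms that tile the plane -/

/-- A family of parallelograms with unit sides that covers the plane and whose members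
only share parts of lines. -/
structure ParaTiling {ι : Type*} (S : ι → Set ℂ) : Prop where
  shape : ∀ i, ∃ b u w : ℂ, ‖u‖ = 1 ∧ ‖w‖ = 1 ∧ 1 / 2 ≤ |cross u w| ∧ S i = para b u w
  covers : ∀ z, ∃ i, z ∈ S i
  meets : ∀ i j, i ≠ j → ∃ q d : ℂ, ∀ z ∈ S i ∩ S j, ∃ t : ℝ, z = q + t * d

/-- A point of the open set and its translates by small multiples of 1 and `I` are not collinear. -/
lemma not_isOpen_subset_line {O : Set ℂ} (hO : IsOpen O) (hne : O.Nonempty) (q d : ℂ) :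
    ¬ ∀ z ∈ O, ∃ t : ℝ, z = q + t * d := by
  intro h
  obtain ⟨x, hx⟩ := hne
  obtain ⟨ε, hε, hb⟩ := Metric.isOpen_iff.mp hO x hx
  have h1 : x + ((ε / 2 : ℝ) : ℂ) ∈ O := hb (by
    rw [Metric.mem_ball, dist_eq_norm, add_sub_cancel_left, Complex.norm_real, Real.norm_eq_abs,
      abs_of_pos (by linarith)]; linarith)
  have h2 : x + ((ε / 2 : ℝ) : ℂ) * Complex.I ∈ O := hb (by
    rw [Metric.mem_ball, dist_eq_norm, add_sub_cancel_left, norm_mul, Complex.norm_real,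
      Real.norm_eq_abs, abs_of_pos (by linarith), Complex.norm_I]; linarith)
  obtain ⟨t0, e0⟩ := h _ hx
  obtain ⟨t1, e1⟩ := h _ h1
  obtain ⟨t2, e2⟩ := h _ h2
  have f1 : ((ε / 2 : ℝ) : ℂ) = ((t1 - t0 : ℝ) : ℂ) * d := by
    push_cast at e1 ⊢; linear_combination e1 - e0
  have f2 : ((ε / 2 : ℝ) : ℂ) * Complex.I = ((t2 - t0 : ℝ) : ℂ) * d := by
    push_cast at e2 ⊢; linear_combination e2 - e0
  have c : cross ((ε / 2 : ℝ) : ℂ) (((ε / 2 : ℝ) : ℂ) * Complex.I) = 0 := by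
    rw [f2, f1, cross_smul_left, cross_smul_right, cross_self]; ring
  simp only [cross, Complex.ofReal_re, Complex.ofReal_im, Complex.mul_im, Complex.I_im,
    Complex.mul_re, Complex.I_re] at c
  nlinarith

variable {ι : Type*} {S : ι → Set ℂ}

/-- The radius 3 adds the distance at most 2 of a point from the base vertex and the distance at
most 1 of that vertex from the centre. -/
lemma ParaTiling.exists_center (hS : ParaTiling S) :
    ∃ c : ι → ℂ, (∀ i, Metric.ball (c i) (1 / 4) ⊆ S i) ∧ ∀ i, ∀ z ∈ S i, ‖z - c i‖ ≤ 3 := by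
  choose b u w hu hw h e using hS.shape
  refine ⟨fun i => b i + u i / 2 + w i / 2, fun i => ?_, fun i z hz => ?_⟩
  · rw [e]; exact center_mem_ball_subset_para (hu i) (hw i) (h i)
  · rw [e] at hz
    have h1 := norm_sub_le_of_mem_para (hu i) (hw i) hz
    have h2 : ‖u i / 2 + w i / 2‖ ≤ 1 := by
      refine (norm_add_le _ _).trans ?_
      rw [norm_div, norm_div, hu, hw]; norm_num
    calc ‖z - (b i + u i / 2 + w i / 2)‖ = ‖(z - b i) - (u i / 2 + w i / 2)‖ := by
          congr 1; ring
      _ ≤ ‖z - b i‖ + ‖u i / 2 + w i / 2‖ := norm_sub_le _ _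
      _ ≤ 3 := by linarith

/-- Two tiles with centres closer than 1/4 would share an open set, which does not fit into a line.
So the centres are separated, and a compact disc contains only finitely many of them. -/
lemma ParaTiling.locallyFinite (hS : ParaTiling S) : LocallyFinite S := by
  obtain ⟨c, hc, hd⟩ := hS.exists_center
  have sep : ∀ i j, dist (c i) (c j) < 1 / 4 → i = j := by
    intro i j hij
    by_contra hne
    obtain ⟨q, d, hq⟩ := hS.meets i j hne
    refine not_isOpen_subset_line (O := Metric.ball (c i) (1 / 4) ∩ Metric.ball (c j) (1 / 4))
      (Metric.isOpen_ball.inter Metric.isOpen_ball)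
      ⟨c i, Metric.mem_ball_self (by norm_num), Metric.mem_ball.mpr hij⟩ q d ?_
    rintro z ⟨h1, h2⟩
    exact hq z ⟨hc i h1, hc j h2⟩
  intro x
  refine ⟨Metric.ball x 1, Metric.ball_mem_nhds _ one_pos, ?_⟩
  have tb : TotallyBounded (Metric.closedBall x 4) := (isCompact_closedBall x 4).totallyBounded
  obtain ⟨t, ht, hcov⟩ := Metric.totallyBounded_iff.mp tb (1 / 8) (by norm_num)
  have hmem : ∀ i ∈ {i | (S i ∩ Metric.ball x 1).Nonempty}, ∃ y ∈ t, dist (c i) y < 1 / 8 := by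
    rintro i ⟨z, hz, hzx⟩
    have h1 := hd i z hz
    have h2 : c i ∈ Metric.closedBall x 4 := by
      rw [Metric.mem_closedBall]
      rw [Metric.mem_ball] at hzx
      have h3 : dist (c i) z ≤ 3 := by rw [dist_comm, dist_eq_norm]; exact h1
      linarith [dist_triangle (c i) z x]
    have := hcov h2
    simpa using this
  choose! g hg hgd using hmem
  refine Set.Finite.of_finite_image (f := g) (ht.subset ?_) ?_
  · rintro _ ⟨i, hi, rfl⟩; exact hg i hi
  · intro i hi j hj hij
    apply sep
    have h1 := hgd i hi
    have h2 := hgd j hj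
    rw [← hij, dist_comm] at h2
    linarith [dist_triangle (c i) (g i) (c j)]

lemma ParaTiling.isClosed (hS : ParaTiling S) (i : ι) : IsClosed (S i) := by
  obtain ⟨b, u, w, -, -, -, e⟩ := hS.shape i
  rw [e]; exact (isCompact_para b u w).isClosed

/-- Near a point `p`, all tiles contain `p`. -/
lemma ParaTiling.eventually_mem (hS : ParaTiling S) (p : ℂ) :
    ∀ᶠ z in 𝓝 p, ∀ i, z ∈ S i → p ∈ S i := by
  filter_upwards [hS.locallyFinite.iInter_compl_mem_nhds hS.isClosed p] with z hz i hi
  by_contra hp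
  simp only [mem_iInter] at hz
  exact hz i hp hi

lemma ParaTiling.countable (hS : ParaTiling S) : (univ : Set ι).Countable := by
  obtain ⟨c, hc, -⟩ := hS.exists_center
  exact hS.locallyFinite.countable_univ
    fun i => ⟨c i, hc i (Metric.mem_ball_self (by norm_num))⟩

/-- A function on the tiles that does not change across the edges is constant. -/
lemma ParaTiling.const_of_countable (hS : ParaTiling S) {α : Type*} (f : ι → α) {W : Set ℂ}
    (hW : W.Countable) (hf : ∀ i j, ∀ z ∉ W, z ∈ S i → z ∈ S j → f i = f j) (i j : ι) :
    f i = f j := by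
  obtain ⟨c, hc, -⟩ := hS.exists_center
  -- The complement of a countable set in the plane is connected, so corners, where tiles may touch
  -- without a common edge, can be avoided.
  have conn : IsPreconnected Wᶜ :=
    (hW.isPathConnected_compl_of_one_lt_rank (by simp)).isConnected.isPreconnected
  have ex : ∀ i, ∃ z ∈ Wᶜ, z ∈ S i := by
    intro i
    have hd : Dense Wᶜ := hW.dense_compl ℝ
    obtain ⟨z, hz, hz'⟩ := hd.exists_mem_open Metric.isOpen_ball
      ⟨c i, Metric.mem_ball_self (show (0 : ℝ) < 1 / 4 by norm_num)⟩
    exact ⟨z, hz, hc i hz'⟩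
  obtain ⟨x, hx, hxi⟩ := ex i
  obtain ⟨y, hy, hyj⟩ := ex j
  -- The relation says that all tiles at `x` and at `y` have the same value. It holds for `y` close
  -- to `x` because the tiles at `y` also contain `x`.
  refine conn.induction₂ (fun x y => ∀ i j, x ∈ S i → y ∈ S j → f i = f j) ?_ ?_ ?_ hx hy i j
    hxi hyj
  · intro x hx
    filter_upwards [mem_nhdsWithin_of_mem_nhds (hS.eventually_mem x)] with y hy i j hi hj
    exact hf i j x hx hi (hy j hj)
  · intro x y z _ _ _ h1 h2 i j hi hj
    obtain ⟨k, hk⟩ := hS.covers y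
    exact (h1 i k hi hk).trans (h2 k j hk hj)
  · intro x y _ _ h i j hi hj
    exact (h j i hj hi).symm

/-- A function on the tiles that takes the same value on intersecting tiles is constant. -/
lemma ParaTiling.const (hS : ParaTiling S) {α : Type*} (f : ι → α)
    (hf : ∀ i j, ∀ z, z ∈ S i → z ∈ S j → f i = f j) (i j : ι) : f i = f j :=
  hS.const_of_countable f countable_empty (fun i j z _ => hf i j z) i j

/-- Two parametrizations of a segment by its end points agree up to order. -/
lemma segment_eq_segment {a b c d : ℂ} (hab : a ≠ b) (h : segment ℝ a b = segment ℝ c d) :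
    a = c ∧ b = d ∨ a = d ∧ b = c := by
  have key : ∀ {x p q : ℂ}, x ∈ segment ℝ p q → ∃ s ∈ Icc (0 : ℝ) 1, x = p + s * (q - p) := by
    intro x p q hx
    rw [segment_eq_image'] at hx
    obtain ⟨s, hs, e⟩ := hx
    exact ⟨s, hs, by rw [← e]; simp⟩
  obtain ⟨s, hs, es⟩ := key (h ▸ left_mem_segment ℝ a b)
  obtain ⟨t, ht, et⟩ := key (h ▸ right_mem_segment ℝ a b)
  obtain ⟨p, hp, ep⟩ := key (h.symm ▸ left_mem_segment ℝ c d)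
  obtain ⟨q, hq, eq⟩ := key (h.symm ▸ right_mem_segment ℝ c d)
  have e1 : b - a = ((t - s : ℝ) : ℂ) * (d - c) := by push_cast; linear_combination et - es
  have e2 : d - c = ((q - p : ℝ) : ℂ) * (b - a) := by push_cast; linear_combination eq - ep
  have hne : b - a ≠ 0 := sub_ne_zero.mpr hab.symm
  have e3 : (t - s) * (q - p) = 1 := by
    have : (((t - s) * (q - p) : ℝ) : ℂ) * (b - a) = (1 : ℝ) * (b - a) := by
      push_cast
      push_cast at e1 e2
      rw [e2] at e1
      linear_combination -e1
    exact_mod_cast mul_right_cancel₀ hne this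
  -- `t - s` and `q - p` are in `[-1, 1]` and have product 1, so `t - s` is 1 or -1.
  have : (t = 1 ∧ s = 0) ∨ (t = 0 ∧ s = 1) := by
    obtain ⟨hs0, hs1⟩ := hs; obtain ⟨ht0, ht1⟩ := ht
    obtain ⟨hp0, hp1⟩ := hp; obtain ⟨hq0, hq1⟩ := hq
    rcases le_total s t with hst | hst
    · left
      have : 1 ≤ t - s := by nlinarith
      constructor <;> linarith
    · right
      have : 1 ≤ s - t := by nlinarith
      constructor <;> linarith
  rcases this with ⟨rfl, rfl⟩ | ⟨rfl, rfl⟩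
  · left; constructor
    · rw [es]; push_cast; ring
    · rw [et]; push_cast; ring
  · right; constructor
    · rw [es]; push_cast; ring
    · rw [et]; push_cast; ring

/-! ### The four directions -/

lemma v_zero : v 0 = ⟨√2 / 2, √2 / 2⟩ := by
  apply Complex.ext <;>
  simp [v, Complex.exp_re, Complex.exp_im]

lemma v_one : v 1 = Complex.I := by
  have : ((1 + 1 : ℝ) * (Real.pi / 4)) = Real.pi / 2 := by ring
  simp [v, -Complex.ofReal_add, -Complex.ofReal_mul, this]

lemma v_two : v 2 = ⟨-(√2 / 2), √2 / 2⟩ := by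
  have : ((2 + 1 : ℝ) * (Real.pi / 4)) = Real.pi - Real.pi / 4 := by ring
  apply Complex.ext <;>
  simp [v, Complex.exp_re, Complex.exp_im, -Complex.ofReal_add, -Complex.ofReal_mul, this,
    -Complex.ofReal_sub, Real.cos_pi_sub]

lemma v_three : v 3 = -1 := by
  have : ((3 + 1 : ℝ) * (Real.pi / 4)) = Real.pi := by ring
  simp [v, -Complex.ofReal_add, -Complex.ofReal_mul, this]

lemma norm_v (k : Fin 4) : ‖v k‖ = 1 := by
  rw [v, Complex.norm_exp_ofReal_mul_I]

lemma v_ne_zero (k : Fin 4) : v k ≠ 0 := by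
  intro h; have := norm_v k; rw [h] at this; simp at this

lemma half_sqrt_two_sq : √2 / 2 * (√2 / 2) = 1 / 2 := by
  have := Real.mul_self_sqrt (show (0 : ℝ) ≤ 2 by norm_num); linarith

lemma one_half_le_half_sqrt_two : (1 : ℝ) / 2 ≤ √2 / 2 := by
  have : (1 : ℝ) ≤ √2 := Real.one_le_sqrt.mpr (by norm_num); linarith

lemma half_sqrt_two_le_one : √2 / 2 ≤ (1 : ℝ) := by
  have : √2 ≤ 2 := by rw [Real.sqrt_le_left (by norm_num)]; norm_num
  linarith

lemma cross_v {i j : Fin 4} (h : i < j) : 1 / 2 ≤ cross (v i) (v j) := by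
  have h1 := half_sqrt_two_sq
  have h2 := one_half_le_half_sqrt_two
  fin_cases i <;> fin_cases j <;> simp at h <;>
  simp [cross, v_zero, v_one, v_two, v_three] <;> linarith

lemma cross_v_ne_zero {i j : Fin 4} (h : i ≠ j) : cross (v i) (v j) ≠ 0 := by
  rcases lt_or_gt_of_ne h with h | h
  · have := cross_v h; intro h'; rw [h'] at this; norm_num at this
  · have := cross_v h; rw [cross_comm]; intro h'; rw [neg_eq_zero.mp h'] at this; norm_num at this

lemma v_injective {i j : Fin 4} (h : v i = v j) : i = j := by
  by_contra hne
  exact cross_v_ne_zero hne (by rw [h, cross_self])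

lemma v_ne_neg (i j : Fin 4) : v i ≠ -v j := by
  intro h
  by_cases hij : i = j
  · subst hij
    have : v i = 0 := by linear_combination (1 / 2) * h
    exact v_ne_zero i this
  · exact cross_v_ne_zero hij (by rw [h, cross_neg_left, cross_self, neg_zero])

lemma Rhombus.region_eq (r : Rhombus) : r.region = para r.base (v r.i) (v r.j) := by
  ext z; simp [Rhombus.region, para, Complex.real_smul]

/-! ### The sides of a parallelogram are determined by the parallelogram -/

/-- The vertices are the extreme points. This characterization mentions only the set, so two
descriptions of the same parallelogram have the same vertices. -/
lemma eq_vertex_of_extreme {b u w p : ℂ} (hp : p ∈ para b u w) (h0 : cross u w ≠ 0)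
    (h : ∀ x, p + x ∈ para b u w → p - x ∈ para b u w → x = 0) :
    p = b ∨ p = b + u ∨ p = b + w ∨ p = b + u + w := by
  have hu : u ≠ 0 := by rintro rfl; simp [cross] at h0
  have hw : w ≠ 0 := by rintro rfl; simp [cross] at h0
  obtain ⟨a, ha, c, hc, rfl⟩ := hp
  have key : ∀ a ∈ Icc (0 : ℝ) 1, a = 0 ∨ a = 1 ∨ ∃ e : ℝ, e ≠ 0 ∧ a + e ∈ Icc (0 : ℝ) 1 ∧
      a - e ∈ Icc (0 : ℝ) 1 := by
    rintro a ⟨ha0, ha1⟩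
    by_cases h0 : a = 0
    · exact Or.inl h0
    by_cases h1 : a = 1
    · exact Or.inr (Or.inl h1)
    refine Or.inr (Or.inr ⟨min a (1 - a), ?_, ⟨?_, ?_⟩, ⟨?_, ?_⟩⟩)
    · apply ne_of_gt
      exact lt_min (lt_of_le_of_ne ha0 (Ne.symm h0)) (sub_pos.mpr (lt_of_le_of_ne ha1 h1))
    · have : 0 ≤ min a (1 - a) := le_min ha0 (by linarith)
      linarith
    · linarith [min_le_right a (1 - a)]
    · linarith [min_le_left a (1 - a)]
    · have : 0 ≤ min a (1 - a) := le_min ha0 (by linarith)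
      linarith
  have ka : a = 0 ∨ a = 1 := by
    rcases key a ha with h1 | h1 | ⟨e, he, h1, h2⟩
    · exact Or.inl h1
    · exact Or.inr h1
    · have := h (e * u) ⟨_, h1, c, hc, by push_cast; ring⟩ ⟨_, h2, c, hc, by push_cast; ring⟩
      simp [he, hu] at this
  have kc : c = 0 ∨ c = 1 := by
    rcases key c hc with h1 | h1 | ⟨e, he, h1, h2⟩
    · exact Or.inl h1
    · exact Or.inr h1
    · have := h (e * w) ⟨a, ha, _, h1, by push_cast; ring⟩ ⟨a, ha, _, h2, by push_cast; ring⟩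
      simp [he, hw] at this
  rcases ka with rfl | rfl <;> rcases kc with rfl | rfl <;> simp

lemma extreme_of_vertex {b u w : ℂ} {α γ : ℝ} (hα : α = 0 ∨ α = 1) (hγ : γ = 0 ∨ γ = 1)
    (h0 : cross u w ≠ 0) (x : ℂ) (h1 : b + α * u + γ * w + x ∈ para b u w)
    (h2 : b + α * u + γ * w - x ∈ para b u w) : x = 0 := by
  obtain ⟨a, ha, c, hc, e1⟩ := h1
  obtain ⟨a', ha', c', hc', e2⟩ := h2
  have e : b + ((a + a') / 2 : ℝ) * u + ((c + c') / 2 : ℝ) * w = b + α * u + γ * w := by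
    push_cast; linear_combination (-1 / 2) * (e1 + e2)
  obtain ⟨k1, k2⟩ := coord_eq h0 e
  have : a = α := by
    rcases hα with rfl | rfl <;> linarith [ha.1, ha.2, ha'.1, ha'.2]
  have : c = γ := by
    rcases hγ with rfl | rfl <;> linarith [hc.1, hc.2, hc'.1, hc'.2]
  subst a c
  linear_combination e1

lemma vertices_subset_of_para_eq {b u w b' u' w' : ℂ} (h0 : cross u w ≠ 0)
    (h0' : cross u' w' ≠ 0) (h : para b u w = para b' u' w') {α γ : ℝ} (hα : α = 0 ∨ α = 1)
    (hγ : γ = 0 ∨ γ = 1) (p : ℂ) (hp : p = b' + α * u' + γ * w') :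
    p = b ∨ p = b + u ∨ p = b + w ∨ p = b + u + w := by
  subst hp
  refine eq_vertex_of_extreme ?_ h0 ?_
  · rw [h]
    refine ⟨α, ?_, γ, ?_, rfl⟩
    · rcases hα with rfl | rfl <;> simp
    · rcases hγ with rfl | rfl <;> simp
  · intro x h1 h2
    rw [h] at h1 h2
    exact extreme_of_vertex hα hγ h0' x h1 h2

lemma eq_zero_of_comb {u w : ℂ} (h0 : cross u w ≠ 0) {a c : ℝ} (e : a * u + c * w = 0) :
    a = 0 ∧ c = 0 :=
  coord_eq h0 (b := 0) (a' := 0) (c' := 0) (by push_cast; linear_combination e)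

/-- The vertices other than `b` correspond. Any matching in which the diagonals `u' + w'` and `u +
w` differ is a degenerate choice or a nontrivial linear relation between `u` and `w`. -/
lemma sides_of_para_eq_same_base {b u w u' w' : ℂ} (h0 : cross u w ≠ 0)
    (h0' : cross u' w' ≠ 0) (h : para b u w = para b u' w') :
    u' = u ∧ w' = w ∨ u' = w ∧ w' = u := by
  have hu0 : u' ≠ 0 := by rintro rfl; simp [cross] at h0'
  have hw0 : w' ≠ 0 := by rintro rfl; simp [cross] at h0'
  have huw : u' ≠ w' := by rintro rfl; exact h0' (cross_self _)
  have hu : u' = u ∨ u' = w ∨ u' = u + w := by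
    rcases vertices_subset_of_para_eq h0 h0' h (Or.inr rfl) (Or.inl rfl) (b + u') (by simp)
      with e | e | e | e
    · exact absurd (by linear_combination e) hu0
    · left; linear_combination e
    · right; left; linear_combination e
    · right; right; linear_combination e
  have hw : w' = u ∨ w' = w ∨ w' = u + w := by
    rcases vertices_subset_of_para_eq h0 h0' h (Or.inl rfl) (Or.inr rfl) (b + w') (by simp)
      with e | e | e | e
    · exact absurd (by linear_combination e) hw0
    · left; linear_combination e
    · right; left; linear_combination e
    · right; right; linear_combination e
  have hs : u' + w' = 0 ∨ u' + w' = u ∨ u' + w' = w ∨ u' + w' = u + w := by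
    rcases vertices_subset_of_para_eq h0 h0' h (Or.inr rfl) (Or.inr rfl) (b + u' + w') (by simp)
      with e | e | e | e
    · left; linear_combination e
    · right; left; linear_combination e
    · right; right; left; linear_combination e
    · right; right; right; linear_combination e
  have key : ∀ a c : ℝ, (a : ℂ) * u + c * w = 0 → a = 0 ∧ c = 0 :=
    fun a c e => eq_zero_of_comb h0 e
  have hsum : u' + w' = u + w := by
    rcases hu with rfl | rfl | rfl <;> rcases hw with rfl | rfl | rfl <;>
      rcases hs with e | e | e | e <;> first
      | exact e
      | exact absurd rfl huw
      | (exfalso; have := key 1 1 (by push_cast; linear_combination e); norm_num at this)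
      | (exfalso; have := key 2 1 (by push_cast; linear_combination e); norm_num at this)
      | (exfalso; have := key 1 2 (by push_cast; linear_combination e); norm_num at this)
      | (exfalso; have := key 0 1 (by push_cast; linear_combination e); norm_num at this)
      | (exfalso; have := key 1 0 (by push_cast; linear_combination e); norm_num at this)
      | (exfalso; have := key 2 0 (by push_cast; linear_combination e); norm_num at this)
      | (exfalso; have := key 0 2 (by push_cast; linear_combination e); norm_num at this)
  rcases hu with rfl | rfl | rfl
  · left; exact ⟨rfl, by linear_combination hsum⟩
  · right; exact ⟨rfl, by linear_combination hsum⟩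
  · exact absurd (by linear_combination hsum) hw0

/-- A parallelogram determines its sides up to order and sign. -/
lemma sides_of_para_eq {b u w b' u' w' : ℂ} (h0 : cross u w ≠ 0)
    (h0' : cross u' w' ≠ 0) (h : para b u w = para b' u' w') :
    (u' = u ∨ u' = -u) ∧ (w' = w ∨ w' = -w) ∨ (u' = w ∨ u' = -w) ∧ (w' = u ∨ w' = -u) := by
  -- `b'` is one of the four vertices. Moving the base there by flips changes only the signs of `u`
  -- and `w`.
  rcases vertices_subset_of_para_eq h0 h0' h (Or.inl rfl) (Or.inl rfl) b' (by simp)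
    with rfl | rfl | rfl | rfl
  · rcases sides_of_para_eq_same_base h0 h0' h with ⟨h1, h2⟩ | ⟨h1, h2⟩ <;> simp [h1, h2]
  · rw [← para_flip] at h
    rcases sides_of_para_eq_same_base (by rwa [cross_neg_left, neg_ne_zero]) h0' h
      with ⟨h1, h2⟩ | ⟨h1, h2⟩ <;> simp [h1, h2]
  · rw [← para_flip'] at h
    rcases sides_of_para_eq_same_base (by rwa [cross_neg_right, neg_ne_zero]) h0' h
      with ⟨h1, h2⟩ | ⟨h1, h2⟩ <;> simp [h1, h2]
  · rw [← para_flip, ← para_flip'] at h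
    rcases sides_of_para_eq_same_base
      (by rwa [cross_neg_left, cross_neg_right, neg_neg]) h0' h
      with ⟨h1, h2⟩ | ⟨h1, h2⟩ <;> simp [h1, h2]

/-! ### Normal forms of the notched tiles -/

/-- The notched square with lower left corner `b` and side `u`. -/
def sqTile (b u : ℂ) : NotchedTile where
  region := para b u (Complex.I * u)
  arrows := {(b, b + u), (b + Complex.I * u, b + u + Complex.I * u), (b, b + Complex.I * u),
    (b + u, b + u + Complex.I * u)}

/-- The notched rhombus with an acute corner at `b` and right side `u`. -/
def rhTile (b u : ℂ) : NotchedTile where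
  region := para b u (v 0 * u)
  arrows := {(b + u, b), (b + v 0 * u, b), (b + u, b + u + v 0 * u),
    (b + v 0 * u, b + u + v 0 * u)}

/-- By the Mazur–Ulam theorem an isometry is affine, and the linear isometries of the plane are
rotations, possibly after conjugation. -/
lemma isometryEquiv_complex (φ : ℂ ≃ᵢ ℂ) : ∃ b u : ℂ, ‖u‖ = 1 ∧
    ((∀ z, φ z = b + u * z) ∨ ∀ z, φ z = b + u * (starRingEnd ℂ) z) := by
  set f := φ.toRealAffineIsometryEquiv with hf
  have h1 : ∀ z, φ z = φ 0 + f.linearIsometryEquiv z := by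
    intro z
    have := f.map_vadd 0 z
    rw [hf, IsometryEquiv.coeFn_toRealAffineIsometryEquiv] at this
    simp only [vadd_eq_add, add_zero] at this
    rw [this, add_comm]
  obtain ⟨a, ha⟩ := linear_isometry_complex f.linearIsometryEquiv
  refine ⟨φ 0, a, a.norm_coe, ?_⟩
  rcases ha with ha | ha
  · left; intro z; rw [h1, ha]; simp
  · right; intro z; rw [h1, ha]; simp

lemma exists_isometryEquiv (b u : ℂ) (hu : ‖u‖ = 1) : ∃ φ : ℂ ≃ᵢ ℂ, ∀ z, φ z = b + u * z := by
  obtain ⟨a, rfl⟩ : ∃ a : Circle, (a : ℂ) = u := ⟨⟨u, mem_sphere_zero_iff_norm.mpr hu⟩, rfl⟩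
  refine ⟨(rotation a).toIsometryEquiv.trans (IsometryEquiv.addLeft b), fun z => ?_⟩
  simp

lemma v_zero_mul_conj : v 0 * (starRingEnd ℂ) (v 0) = 1 := by
  rw [Complex.mul_conj, Complex.normSq_eq_norm_sq, norm_v]; simp

lemma image_parallelogram (b u w : ℂ) (f : ℂ → ℂ) (hf : ∀ z, f z = b + u * z) :
    f '' parallelogram w = para b u (w * u) := by
  ext z
  constructor
  · rintro ⟨_, ⟨a, ha, c, hc, rfl⟩, rfl⟩
    exact ⟨a, ha, c, hc, by rw [hf, Complex.real_smul]; ring⟩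
  · rintro ⟨a, ha, c, hc, rfl⟩
    exact ⟨_, ⟨a, ha, c, hc, rfl⟩, by rw [hf, Complex.real_smul]; ring⟩

lemma image_parallelogram_conj (b u w : ℂ) (f : ℂ → ℂ)
    (hf : ∀ z, f z = b + u * (starRingEnd ℂ) z) :
    f '' parallelogram w = para b u ((starRingEnd ℂ) w * u) := by
  ext z
  constructor
  · rintro ⟨_, ⟨a, ha, c, hc, rfl⟩, rfl⟩
    exact ⟨a, ha, c, hc, by rw [hf, Complex.real_smul]; simp; ring⟩
  · rintro ⟨a, ha, c, hc, rfl⟩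
    exact ⟨_, ⟨a, ha, c, hc, rfl⟩, by rw [hf, Complex.real_smul]; simp; ring⟩

/-- A notched tile is a copy of one of the two given tiles iff it has one of the normal forms. -/
lemma isCopy_iff (τ : NotchedTile) :
    (∃ φ : ℂ ≃ᵢ ℂ, τ = notchedSquare.map φ ∨ τ = notchedRhombus.map φ) ↔
      ∃ b u : ℂ, ‖u‖ = 1 ∧ (τ = sqTile b u ∨ τ = rhTile b u) := by
  constructor
  · rintro ⟨φ, h⟩
    obtain ⟨b, u, hu, hφ | hφ⟩ := isometryEquiv_complex φ
    · refine ⟨b, u, hu, h.imp ?_ ?_⟩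
      · rintro rfl
        apply NotchedTile.ext
        · exact image_parallelogram b u _ _ hφ
        · simp only [NotchedTile.map, notchedSquare, sqTile, image_insert_eq, image_singleton, hφ]
          ring_nf
      · rintro rfl
        apply NotchedTile.ext
        · exact image_parallelogram b u _ _ hφ
        · simp only [NotchedTile.map, notchedRhombus, rhTile, image_insert_eq, image_singleton, hφ]
          ring_nf
    -- Both tiles, with their arrows, are symmetric in the diagonal through 0, so a reflected copy
    -- is also a rotated one. Its first side is the image of the second side of the tile.
    · rcases h with rfl | rfl
      · refine ⟨b, -Complex.I * u, by simp [hu], Or.inl ?_⟩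
        have hI : Complex.I * (-Complex.I * u) = u := by
          rw [← mul_assoc, mul_neg, Complex.I_mul_I]; simp
        apply NotchedTile.ext
        · have := image_parallelogram_conj b u Complex.I _ hφ
          simp only [NotchedTile.map, notchedSquare, sqTile, this, hI, Complex.conj_I]
          rw [para_swap]
        · simp only [NotchedTile.map, notchedSquare, sqTile, image_insert_eq, image_singleton, hφ,
            hI, Complex.conj_I, map_add, map_zero, map_one]
          ext x
          simp only [mem_insert_iff, mem_singleton_iff]
          ring_nf
          tauto
      · refine ⟨b, (starRingEnd ℂ) (v 0) * u, by simp [hu, norm_v], Or.inr ?_⟩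
        have hI : v 0 * ((starRingEnd ℂ) (v 0) * u) = u := by
          rw [← mul_assoc, v_zero_mul_conj, one_mul]
        apply NotchedTile.ext
        · have := image_parallelogram_conj b u (v 0) _ hφ
          simp only [NotchedTile.map, notchedRhombus, rhTile, this, hI]
          rw [para_swap]
        · simp only [NotchedTile.map, notchedRhombus, rhTile, image_insert_eq, image_singleton, hφ,
            hI, map_add, map_zero, map_one]
          ext x
          simp only [mem_insert_iff, mem_singleton_iff]
          ring_nf
          tauto
  · rintro ⟨b, u, hu, h⟩
    obtain ⟨φ, hφ⟩ := exists_isometryEquiv b u hu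
    refine ⟨φ, h.imp ?_ ?_⟩
    · rintro rfl
      apply NotchedTile.ext
      · exact (image_parallelogram b u _ _ hφ).symm
      · simp only [NotchedTile.map, notchedSquare, sqTile, image_insert_eq, image_singleton, hφ]
        ring_nf
    · rintro rfl
      apply NotchedTile.ext
      · exact (image_parallelogram b u _ _ hφ).symm
      · simp only [NotchedTile.map, notchedRhombus, rhTile, image_insert_eq, image_singleton, hφ]
        ring_nf

/-! ### Octagonal tilings -/

/-- The rhombus has the edge from `q` to `q + v k`. -/
def Rhombus.HasEdge (r : Rhombus) (q : ℂ) (k : Fin 4) : Prop :=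
  q = r.base ∧ k = r.i ∨ q = r.base ∧ k = r.j ∨ q = r.base + v r.j ∧ k = r.i ∨
    q = r.base + v r.i ∧ k = r.j

lemma Rhombus.mem_edges_iff (r : Rhombus) (e : Set ℂ) :
    e ∈ r.edges ↔ ∃ q k, r.HasEdge q k ∧ e = segment ℝ q (q + v k) := by
  have c : r.base + v r.i + v r.j = r.base + v r.j + v r.i := by ring
  simp only [Rhombus.edges, mem_insert_iff, mem_singleton_iff, Rhombus.HasEdge]
  constructor
  · rintro (h | h | h | h)
    · exact ⟨_, _, Or.inl ⟨rfl, rfl⟩, h⟩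
    · exact ⟨_, _, Or.inr (Or.inl ⟨rfl, rfl⟩), h⟩
    · exact ⟨_, _, Or.inr (Or.inr (Or.inl ⟨rfl, rfl⟩)), by rw [h, c]⟩
    · exact ⟨_, _, Or.inr (Or.inr (Or.inr ⟨rfl, rfl⟩)), h⟩
  · rintro ⟨q, k, (⟨rfl, rfl⟩ | ⟨rfl, rfl⟩ | ⟨rfl, rfl⟩ | ⟨rfl, rfl⟩), h⟩
    · exact Or.inl h
    · exact Or.inr (Or.inl h)
    · exact Or.inr (Or.inr (Or.inl (by rw [h, c])))
    · exact Or.inr (Or.inr (Or.inr h))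

lemma mem_segment_add_iff {q d z : ℂ} :
    z ∈ segment ℝ q (q + d) ↔ ∃ t ∈ Icc (0 : ℝ) 1, z = q + t * d := by
  rw [segment_eq_image']
  simp only [add_sub_cancel_left, Complex.real_smul, mem_image]
  constructor <;> rintro ⟨t, ht, h⟩ <;> exact ⟨t, ht, h.symm⟩

/-- No two of the four directions are opposite, so an edge has only one starting point and one
label. -/
lemma edge_eq_edge {q q' : ℂ} {k k' : Fin 4}
    (h : segment ℝ q (q + v k) = segment ℝ q' (q' + v k')) : q = q' ∧ k = k' := by
  rcases segment_eq_segment (by simp [v_ne_zero]) h with ⟨h1, h2⟩ | ⟨h1, h2⟩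
  · exact ⟨h1, v_injective (by linear_combination h2 - h1)⟩
  · exact absurd (by linear_combination h2 - h1) (v_ne_neg k k')

lemma Rhombus.HasEdge.mem_vertices {r : Rhombus} {q : ℂ} {k : Fin 4} (h : r.HasEdge q k) :
    q ∈ r.vertices ∧ q + v k ∈ r.vertices := by
  have c : r.base + v r.j + v r.i = r.base + v r.i + v r.j := by ring
  simp only [Rhombus.vertices, mem_insert_iff, mem_singleton_iff]
  rcases h with ⟨rfl, rfl⟩ | ⟨rfl, rfl⟩ | ⟨rfl, rfl⟩ | ⟨rfl, rfl⟩ <;> simp [c]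

lemma Rhombus.isPara (r : Rhombus) : ∃ b u w : ℂ, ‖u‖ = 1 ∧ ‖w‖ = 1 ∧ 1 / 2 ≤ |cross u w| ∧
    r.region = para b u w :=
  ⟨r.base, v r.i, v r.j, norm_v _, norm_v _, (cross_v r.lt).trans (le_abs_self _), r.region_eq⟩

lemma IsOctagonalTiling.paraTiling {T : Set Rhombus} (hT : IsOctagonalTiling T) :
    ParaTiling (fun r : T => r.1.region) where
  shape r := r.1.isPara
  covers z := by
    have : z ∈ ⋃ r ∈ T, r.region := hT.covers ▸ mem_univ z
    simpa using this
  meets r s h := by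
    rcases hT.meets r.1 r.2 s.1 s.2 (fun e => h (Subtype.ext e)) with e | ⟨p, -, e⟩ | ⟨a, ha, e⟩
    · exact ⟨0, 0, fun z hz => by simp [e] at hz⟩
    · exact ⟨p, 0, fun z hz => ⟨0, by rw [e] at hz; simpa using hz⟩⟩
    · obtain ⟨q, k, -, rfl⟩ := (r.1.mem_edges_iff a).mp ha.1
      refine ⟨q, v k, fun z hz => ?_⟩
      rw [e, mem_segment_add_iff] at hz
      obtain ⟨t, -, h⟩ := hz
      exact ⟨t, h⟩

/-- Two intersecting tiles of an octagonal tiling have a common vertex, and a common edge unless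
the intersection is only a vertex. -/
lemma IsOctagonalTiling.meets' {T : Set Rhombus} (hT : IsOctagonalTiling T) {r s : Rhombus}
    (hr : r ∈ T) (hs : s ∈ T) (hne : r ≠ s) {z : ℂ} (hzr : z ∈ r.region) (hzs : z ∈ s.region) :
    z ∈ r.vertices ∩ s.vertices ∨
      ∃ q k, r.HasEdge q k ∧ s.HasEdge q k ∧ ∃ t ∈ Icc (0 : ℝ) 1, z = q + t * v k := by
  rcases hT.meets r hr s hs hne with e | ⟨p, hp, e⟩ | ⟨a, ha, e⟩
  · exact absurd (show z ∈ r.region ∩ s.region from ⟨hzr, hzs⟩) (by simp [e])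
  · have : z ∈ r.region ∩ s.region := ⟨hzr, hzs⟩
    rw [e, mem_singleton_iff] at this
    subst this
    exact Or.inl hp
  · right
    obtain ⟨q, k, hk, rfl⟩ := (r.mem_edges_iff a).mp ha.1
    obtain ⟨q', k', hk', e'⟩ := (s.mem_edges_iff _).mp ha.2
    obtain ⟨rfl, rfl⟩ := edge_eq_edge e'
    have : z ∈ r.region ∩ s.region := ⟨hzr, hzs⟩
    rw [e, mem_segment_add_iff] at this
    exact ⟨q, k, hk, hk', this⟩

lemma IsOctagonalTiling.exists_mem {T : Set Rhombus} (hT : IsOctagonalTiling T) (z : ℂ) :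
    ∃ r ∈ T, z ∈ r.region := by
  obtain ⟨r, hr⟩ := hT.paraTiling.covers z
  exact ⟨r.1, r.2, hr⟩

/-! ### Lifts -/

/-- The integer combinations of the four directions. -/
def latticeMap : (Fin 4 → ℤ) →+ ℂ where
  toFun n := ∑ k, (n k : ℂ) * v k
  map_zero' := by simp
  map_add' m n := by simp [add_mul, Finset.sum_add_distrib]

lemma latticeMap_single (k : Fin 4) : latticeMap (Pi.single k 1) = v k := by
  simp only [latticeMap, AddMonoidHom.coe_mk, ZeroHom.coe_mk]
  rw [Finset.sum_eq_single k]
  · simp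
  · intro j _ hj; simp [hj]
  · simp

lemma int_sqrt_two {a b : ℤ} (h : a * (√2 / 2) + b = 0) : a = 0 ∧ b = 0 := by
  by_cases ha : a = 0
  · subst ha; simpa using h
  · exfalso
    have ha' : (a : ℝ) ≠ 0 := by exact_mod_cast ha
    have : √2 = ((-2 * b / a : ℚ) : ℝ) := by
      push_cast; field_simp; linarith
    exact irrational_sqrt_two ⟨_, this.symm⟩

/-- In real and imaginary parts, the independence of the four directions over the integers is the
irrationality of `√2`. -/
lemma latticeMap_injective : Function.Injective latticeMap := by
  rw [injective_iff_map_eq_zero]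
  intro n hn
  simp only [latticeMap, AddMonoidHom.coe_mk, ZeroHom.coe_mk, Fin.sum_univ_four, v_zero, v_one,
    v_two, v_three] at hn
  have h1 := congrArg Complex.re hn
  have h2 := congrArg Complex.im hn
  simp at h1 h2
  have e1 := int_sqrt_two (a := n 0 - n 2) (b := -n 3) (by push_cast; linarith)
  have e2 := int_sqrt_two (a := n 0 + n 2) (b := n 1) (by push_cast; linarith)
  funext k
  fin_cases k <;> simp <;> omega

/-- There are integer coordinates on the plane which are additive with respect to the lattice
generated by the four directions. -/
lemma exists_lattice_coords :
    ∃ h : ℂ → Fin 4 → ℤ, ∀ z n, h (z + latticeMap n) = h z + n := by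
  -- Each `z` is measured from a chosen representative of its coset modulo the lattice. Since the
  -- lattice map is injective, this gives additive coordinates on the whole plane, and one function
  -- lifts all octagonal tilings without any monodromy argument.
  have hex : ∀ z : ℂ, ∃ n, z = (QuotientAddGroup.mk (s := latticeMap.range) z).out +
      latticeMap n := by
    intro z
    have h := QuotientAddGroup.out_eq' (QuotientAddGroup.mk (s := latticeMap.range) z)
    rw [QuotientAddGroup.eq] at h
    obtain ⟨n, hn⟩ := h
    exact ⟨n, by rw [hn]; ring⟩
  choose h hh using hex
  refine ⟨h, fun z n => latticeMap_injective ?_⟩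
  have e : (QuotientAddGroup.mk (s := latticeMap.range) (z + latticeMap n)) =
      QuotientAddGroup.mk (s := latticeMap.range) z := by
    rw [eq_comm, QuotientAddGroup.eq]
    exact ⟨n, by ring⟩
  have h1 := hh (z + latticeMap n)
  have h2 := hh z
  rw [e] at h1
  rw [map_add]
  linear_combination h2 - h1

/-- A function that increases by the basis vector `e k` along `v k`. -/
def IsCoord (h : ℂ → Fin 4 → ℤ) : Prop := ∀ z n, h (z + latticeMap n) = h z + n

lemma IsCoord.add_v {h : ℂ → Fin 4 → ℤ} (hh : IsCoord h) (z : ℂ) (k : Fin 4) :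
    h (z + v k) = h z + Pi.single k 1 := by
  rw [← latticeMap_single, hh]

lemma IsCoord.isLift {h : ℂ → Fin 4 → ℤ} (hh : IsCoord h) (T : Set Rhombus) : IsLift T h :=
  fun r _ => ⟨hh.add_v _ _, hh.add_v _ _, by rw [hh.add_v, hh.add_v]⟩

lemma Rhombus.vertex_mem_lattice {r : Rhombus} {p : ℂ} (hp : p ∈ r.vertices) :
    ∃ n, p = r.base + latticeMap n := by
  rcases hp with rfl | rfl | rfl | rfl
  · exact ⟨0, by simp⟩
  · exact ⟨Pi.single r.i 1, by rw [latticeMap_single]⟩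
  · exact ⟨Pi.single r.j 1, by rw [latticeMap_single]⟩
  · exact ⟨Pi.single r.i 1 + Pi.single r.j 1, by
      rw [map_add, latticeMap_single, latticeMap_single]; ring⟩

/-- The vertices of an octagonal tiling differ by lattice points. -/
lemma IsOctagonalTiling.base_sub_mem {T : Set Rhombus} (hT : IsOctagonalTiling T) {r s : Rhombus}
    (hr : r ∈ T) (hs : s ∈ T) : ∃ n, s.base = r.base + latticeMap n := by
  have key : ∀ {r s : Rhombus} {p : ℂ}, p ∈ r.vertices → p ∈ s.vertices →
      QuotientAddGroup.mk (s := latticeMap.range) r.base =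
        QuotientAddGroup.mk (s := latticeMap.range) s.base := by
    intro r s p h1 h2
    obtain ⟨n, hn⟩ := Rhombus.vertex_mem_lattice h1
    obtain ⟨m, hm⟩ := Rhombus.vertex_mem_lattice h2
    rw [QuotientAddGroup.eq]
    exact ⟨n - m, by rw [map_sub]; linear_combination hm - hn⟩
  have := hT.paraTiling.const
    (fun r : T => QuotientAddGroup.mk (s := latticeMap.range) r.1.base) (by
      intro r s z hzr hzs
      by_cases hne : r = s
      · rw [hne]
      · rcases hT.meets' r.2 s.2 (fun e => hne (Subtype.ext e)) hzr hzs with ⟨h1, h2⟩ |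
          ⟨q, k, h1, h2, -⟩
        · exact key h1 h2
        · exact key h1.mem_vertices.1 h2.mem_vertices.1) ⟨r, hr⟩ ⟨s, hs⟩
  rw [QuotientAddGroup.eq] at this
  obtain ⟨n, hn⟩ := this
  exact ⟨n, by rw [hn]; simp⟩

/-- The affine extension of the lift on the rhombus `r`. -/
def liftAt (h : ℂ → Fin 4 → ℤ) (r : Rhombus) (z : ℂ) : Fin 4 → ℝ :=
  (fun k => (h r.base k : ℝ)) +
    (cross (z - r.base) (v r.j) / cross (v r.i) (v r.j)) • Pi.single r.i (1 : ℝ) +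
    (cross (v r.i) (z - r.base) / cross (v r.i) (v r.j)) • Pi.single r.j (1 : ℝ)

lemma liftAt_eq (h : ℂ → Fin 4 → ℤ) (r : Rhombus) (a b : ℝ) :
    liftAt h r (r.base + a * v r.i + b * v r.j) =
      (fun k => (h r.base k : ℝ)) + a • Pi.single r.i (1 : ℝ) + b • Pi.single r.j (1 : ℝ) := by
  have h0 := cross_v_ne_zero r.lt.ne
  rw [liftAt, show r.base + a * v r.i + b * v r.j - r.base = a * v r.i + b * v r.j by ring]
  simp only [cross_add_left, cross_add_right, cross_smul_left, cross_smul_right, cross_self,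
    mul_zero, add_zero, zero_add]
  rw [mul_div_cancel_right₀ _ h0, mul_div_cancel_right₀ _ h0]

/-- The right side does not involve the rhombus: this is why the affine pieces of adjacent rhombi
agree. -/
lemma liftAt_edge {h : ℂ → Fin 4 → ℤ} (hh : IsCoord h) {r : Rhombus} {q : ℂ} {k : Fin 4}
    (he : r.HasEdge q k) (t : ℝ) :
    liftAt h r (q + t * v k) = (fun l => (h q l : ℝ)) + t • Pi.single k (1 : ℝ) := by
  rcases he with ⟨rfl, rfl⟩ | ⟨rfl, rfl⟩ | ⟨rfl, rfl⟩ | ⟨rfl, rfl⟩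
  · have := liftAt_eq h r t 0
    simpa using this
  · have := liftAt_eq h r 0 t
    simpa using this
  · have := liftAt_eq h r t 1
    rw [show r.base + v r.j + t * v r.i = r.base + t * v r.i + (1 : ℝ) * v r.j by
      push_cast; ring, this, hh.add_v]
    funext l
    simp [Pi.single_apply]; ring
  · have := liftAt_eq h r 1 t
    rw [show r.base + v r.i + t * v r.j = r.base + (1 : ℝ) * v r.i + t * v r.j by
      push_cast; ring, this, hh.add_v]
    funext l
    simp [Pi.single_apply]

lemma liftAt_vertex {h : ℂ → Fin 4 → ℤ} (hh : IsCoord h) {r : Rhombus} {p : ℂ}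
    (hp : p ∈ r.vertices) : liftAt h r p = fun l => (h p l : ℝ) := by
  have key : ∀ q k, r.HasEdge q k → liftAt h r q = (fun l => (h q l : ℝ)) ∧
      liftAt h r (q + v k) = fun l => (h (q + v k) l : ℝ) := by
    intro q k he
    constructor
    · simpa using liftAt_edge hh he 0
    · have := liftAt_edge hh he 1
      rw [Complex.ofReal_one, one_mul] at this
      rw [this, hh.add_v]
      funext l
      simp [Pi.single_apply]
  rcases hp with rfl | rfl | rfl | rfl
  · exact (key _ _ (Or.inl ⟨rfl, rfl⟩)).1
  · exact (key _ _ (Or.inl ⟨rfl, rfl⟩)).2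
  · exact (key _ _ (Or.inr (Or.inl ⟨rfl, rfl⟩))).2
  · exact (key _ _ (Or.inr (Or.inr (Or.inr ⟨rfl, rfl⟩)))).2

lemma liftAt_agree {T : Set Rhombus} (hT : IsOctagonalTiling T) {h : ℂ → Fin 4 → ℤ}
    (hh : IsCoord h) {r s : Rhombus} (hr : r ∈ T) (hs : s ∈ T) {z : ℂ} (hzr : z ∈ r.region)
    (hzs : z ∈ s.region) : liftAt h r z = liftAt h s z := by
  by_cases hne : r = s
  · rw [hne]
  · rcases hT.meets' hr hs hne hzr hzs with ⟨h1, h2⟩ | ⟨q, k, h1, h2, t, -, rfl⟩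
    · rw [liftAt_vertex hh h1, liftAt_vertex hh h2]
    · rw [liftAt_edge hh h1, liftAt_edge hh h2]

/-- The constant 2 is the inverse of the lower bound 1/2 for the determinant in Cramer's rule. Each
coordinate is affected by at most one of the two sides. -/
lemma liftAt_lipschitz (h : ℂ → Fin 4 → ℤ) (r : Rhombus) (z w : ℂ) (k : Fin 4) :
    |liftAt h r z k - liftAt h r w k| ≤ 2 * ‖z - w‖ := by
  have h0 := cross_v r.lt
  have hpos : 0 < cross (v r.i) (v r.j) := by linarith
  have b1 : |cross (z - w) (v r.j) / cross (v r.i) (v r.j)| ≤ 2 * ‖z - w‖ := by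
    have := abs_cross_le (z - w) (v r.j)
    rw [norm_v] at this
    rw [abs_div, abs_of_pos hpos, div_le_iff₀ hpos]
    nlinarith [norm_nonneg (z - w)]
  have b2 : |cross (v r.i) (z - w) / cross (v r.i) (v r.j)| ≤ 2 * ‖z - w‖ := by
    have := abs_cross_le (v r.i) (z - w)
    rw [norm_v] at this
    rw [abs_div, abs_of_pos hpos, div_le_iff₀ hpos]
    nlinarith [norm_nonneg (z - w)]
  have e1 : cross (z - w) (v r.j) = cross (z - r.base) (v r.j) - cross (w - r.base) (v r.j) := by
    simp [cross]; ring
  have e2 : cross (v r.i) (z - w) = cross (v r.i) (z - r.base) - cross (v r.i) (w - r.base) := by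
    simp [cross]; ring
  rw [e1, sub_div] at b1
  rw [e2, sub_div] at b2
  have hn := r.lt.ne
  by_cases h1 : k = r.i
  · have h2 : k ≠ r.j := h1 ▸ hn
    simpa [liftAt, Pi.single_apply, h1, hn] using b1
  · by_cases h2 : k = r.j
    · simpa [liftAt, Pi.single_apply, h2, hn.symm] using b2
    · simp [liftAt, h1, h2]

/-- A function on the unit interval that is Lipschitz at each point is Lipschitz. -/
lemma abs_sub_le_of_eventually {f : ℝ → ℝ} {C : ℝ}
    (h : ∀ t ∈ Icc (0 : ℝ) 1, ∀ᶠ s in 𝓝 t, s ∈ Icc (0 : ℝ) 1 → |f s - f t| ≤ C * |s - t|) :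
    |f 1 - f 0| ≤ C := by
  have hcont : ContinuousOn f (Icc 0 1) := by
    intro t ht
    have : Tendsto (fun s => C * |s - t|) (𝓝[Icc 0 1] t) (𝓝 0) := by
      have hc : Continuous fun s => C * |s - t| := by fun_prop
      have := (hc.tendsto t).mono_left (nhdsWithin_le_nhds (s := Icc 0 1))
      simpa using this
    rw [ContinuousWithinAt, tendsto_iff_dist_tendsto_zero]
    refine squeeze_zero' (Eventually.of_forall fun _ => dist_nonneg) ?_ this
    rw [eventually_nhdsWithin_iff]
    filter_upwards [h t ht] with s hs hs'
    exact hs hs'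
  -- Continuous induction: the set of `t` at which the bound `C * t` holds is closed, contains 0 and
  -- extends to the right of each of its points below 1.
  have hsub := IsClosed.Icc_subset_of_forall_exists_gt (a := (0 : ℝ)) (b := 1)
    (s := {t | t ∈ Icc (0 : ℝ) 1 ∧ |f t - f 0| ≤ C * t}) ?_ (by simp) ?_
  · have := (hsub (right_mem_Icc.mpr zero_le_one)).2
    simpa using this
  · have hg : ContinuousOn (fun t => |f t - f 0| - C * t) (Icc 0 1) := by fun_prop
    have := hg.preimage_isClosed_of_isClosed isClosed_Icc (isClosed_Iic (a := (0 : ℝ)))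
    convert! this using 1
    ext t
    simp only [mem_inter_iff, mem_ofPred_eq, mem_preimage, mem_Iic, sub_nonpos]
    tauto
  · rintro x ⟨⟨-, hx⟩, hx01⟩ y hy
    have hx' : x ∈ Icc (0 : ℝ) 1 := ⟨hx01.1, hx01.2.le⟩
    have hm : Ioo x (min y 1) ∈ 𝓝[>] x := Ioo_mem_nhdsGT (lt_min hy hx01.2)
    obtain ⟨s, hs, hs2⟩ := (((h x hx').filter_mono nhdsWithin_le_nhds).and
      (eventually_mem_set.mpr hm)).exists
    have hs01 : s ∈ Icc (0 : ℝ) 1 :=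
      ⟨hx01.1.trans hs2.1.le, (hs2.2.trans_le (min_le_right _ _)).le⟩
    refine ⟨s, ⟨hs01, ?_⟩, hs2.1, (hs2.2.trans_le (min_le_left _ _)).le⟩
    have := hs hs01
    rw [abs_of_pos (sub_pos.mpr hs2.1)] at this
    calc |f s - f 0| = |(f s - f x) + (f x - f 0)| := by ring_nf
      _ ≤ _ := abs_add_le _ _
      _ ≤ C * s := by linarith

/-- The lift extends to the plane, with Lipschitz coordinates. -/
lemma exists_lift {T : Set Rhombus} (hT : IsOctagonalTiling T) {h : ℂ → Fin 4 → ℤ}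
    (hh : IsCoord h) : ∃ H : ℂ → Fin 4 → ℝ, (∀ r ∈ T, ∀ z ∈ r.region, H z = liftAt h r z) ∧
      ∀ z w k, |H z k - H w k| ≤ 2 * ‖z - w‖ := by
  choose r hr hzr using hT.exists_mem
  have hH : ∀ s ∈ T, ∀ z ∈ s.region, liftAt h (r z) z = liftAt h s z :=
    fun s hs z hz => liftAt_agree hT hh (hr z) hs (hzr z) hz
  refine ⟨fun z => liftAt h (r z) z, hH, fun z w k => ?_⟩
  -- Along the segment from `w` to `z`, a tile at a nearby point also contains the given point, so
  -- both values come from one affine piece.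
  have := abs_sub_le_of_eventually (f := fun t : ℝ =>
    liftAt h (r (w + t * (z - w))) (w + t * (z - w)) k) (C := 2 * ‖z - w‖) (by
      intro t ht
      have hc : Continuous fun s : ℝ => w + s * (z - w) := by fun_prop
      filter_upwards [(hc.tendsto t).eventually (hT.paraTiling.eventually_mem _)] with s hs _
      have h2 := hs ⟨_, hr (w + s * (z - w))⟩ (hzr _)
      rw [hH _ (hr (w + s * (z - w))) (w + t * (z - w)) h2]
      refine (liftAt_lipschitz _ _ _ _ _).trans ?_
      rw [show w + s * (z - w) - (w + t * (z - w)) = ((s - t : ℝ) : ℂ) * (z - w) by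
        push_cast; ring, norm_mul, Complex.norm_real, Real.norm_eq_abs]
      nlinarith)
  simpa using this

/-- The real combinations of the four directions. -/
def proj (x : Fin 4 → ℝ) : ℂ := ∑ k, (x k : ℂ) * v k

lemma proj_liftAt (h : ℂ → Fin 4 → ℤ) (r : Rhombus) (z : ℂ) :
    proj (liftAt h r z) = latticeMap (h r.base) - r.base + z := by
  have e := eq_cross_add_cross (cross_v_ne_zero r.lt.ne) (z - r.base)
  have hs : ∀ (x y : Fin 4 → ℝ), proj (x + y) = proj x + proj y := by
    intro x y; simp [proj, add_mul, Finset.sum_add_distrib]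
  have hsm : ∀ (a : ℝ) (k : Fin 4), proj (a • Pi.single k (1 : ℝ)) = a * v k := by
    intro a k
    simp only [proj]
    rw [Finset.sum_eq_single k]
    · simp
    · intro j _ hj; simp [hj]
    · simp
  rw [liftAt, hs, hs, hsm, hsm]
  have : proj (fun k => (h r.base k : ℝ)) = latticeMap (h r.base) := by
    simp [proj, latticeMap]
  rw [this]
  linear_combination -e

/-- On each rhombus, `proj` inverts the lift up to a translation. The translations agree because the
bases differ by lattice vectors, on which `h` is additive. -/
lemma exists_proj_eq {T : Set Rhombus} (hT : IsOctagonalTiling T) {h : ℂ → Fin 4 → ℤ}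
    (hh : IsCoord h) {H : ℂ → Fin 4 → ℝ} (hH : ∀ r ∈ T, ∀ z ∈ r.region, H z = liftAt h r z) :
    ∃ c, ∀ z, proj (H z) = z + c := by
  obtain ⟨r0, hr0, -⟩ := hT.exists_mem 0
  refine ⟨latticeMap (h r0.base) - r0.base, fun z => ?_⟩
  obtain ⟨r, hr, hz⟩ := hT.exists_mem z
  obtain ⟨n, hn⟩ := hT.base_sub_mem hr0 hr
  rw [hH r hr z hz, proj_liftAt, hn, hh, map_add]
  ring

/-! ### Tilings by notched tiles -/

/-- The scalar product of the plane. -/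
def dot (u w : ℂ) : ℝ := u.re * w.re + u.im * w.im

lemma dot_add_left (u u' w : ℂ) : dot (u + u') w = dot u w + dot u' w := by
  simp [dot]; ring

lemma dot_smul_left (a : ℝ) (u w : ℂ) : dot (a * u) w = a * dot u w := by
  simp [dot]; ring

lemma dot_neg_left (u w : ℂ) : dot (-u) w = -dot u w := by
  simp [dot]; ring

lemma dot_neg_right (u w : ℂ) : dot u (-w) = -dot u w := by
  simp [dot]; ring

lemma dot_self (u : ℂ) : dot u u = ‖u‖ ^ 2 := by
  rw [← Complex.normSq_eq_norm_sq, Complex.normSq_apply, dot]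

/-- `(x, y)` is an arrow of `τ`, the side of `τ` at `x` and `y` is `w`, and `o` is the opposite
arrow. -/
structure ArrowData (τ : NotchedTile) (x y w : ℂ) (o : ℂ × ℂ) : Prop where
  mem : (x, y) ∈ τ.arrows
  opp_mem : o ∈ τ.arrows
  norm_edge : ‖y - x‖ = 1
  norm_side : ‖w‖ = 1
  cross_ge : 1 / 2 ≤ |cross (y - x) w|
  region_eq : τ.region = para x (y - x) w
  -- The first case is the square, with parallel opposite arrows. The second is the rhombus: its
  -- acute corner is `y`, so `w` is at 135 degrees to the arrow, and the opposite arrow points to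
  -- the other acute corner `x + w`.
  opp : dot w (y - x) = 0 ∧ o = (x + w, y + w) ∨ dot w (y - x) = -(√2 / 2) ∧ o = (y + w, x + w)
  arrows : ∀ c ∈ τ.arrows, c = (x, y) ∨ c = o ∨ c = (x, x + w) ∨ c = (x + w, x) ∨
    c = (y, y + w) ∨ c = (y + w, y)

lemma ArrowData.cross_ne_zero {τ : NotchedTile} {x y w : ℂ} {o : ℂ × ℂ}
    (h : ArrowData τ x y w o) : cross (y - x) w ≠ 0 := by
  intro h0; have := h.cross_ge; rw [h0] at this; norm_num at this

/-- The data of the opposite arrow. -/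
lemma ArrowData.symm {τ : NotchedTile} {x y w : ℂ} {o : ℂ × ℂ} (h : ArrowData τ x y w o) :
    ArrowData τ o.1 o.2 (-w) (x, y) := by
  have hm := h.mem
  have hom := h.opp_mem
  have h1 := h.norm_edge
  have h2 := h.cross_ge
  have h3 := h.region_eq
  have h4 := h.arrows
  rcases h.opp with ⟨hd, rfl⟩ | ⟨hd, rfl⟩
  · have e : y + w - (x + w) = y - x := by ring
    refine ⟨hom, hm, by simpa [e] using h1, by simpa using h.norm_side, ?_, ?_, ?_, ?_⟩
    · simpa [e, cross_neg_right] using h2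
    · simp only [e, h3, para_flip']
    · left; simp [e, dot_neg_left, hd]
    · intro c hc
      rcases h4 c hc with h | h | h | h | h | h <;> simp [h]
  · have e : x + w - (y + w) = -(y - x) := by ring
    refine ⟨hom, hm, ?_, by simpa using h.norm_side, ?_, ?_, ?_, ?_⟩
    · simp only [e]; rwa [norm_neg]
    · simpa only [e, cross_neg_right, cross_neg_left, abs_neg] using h2
    · simp only [e, h3]
      rw [para_flip', ← para_flip]
      congr 1
      ring
    · right; simp only [e, dot_neg_left, dot_neg_right, neg_neg, hd]; simp
    · intro c hc
      rcases h4 c hc with h | h | h | h | h | h <;> simp [h]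

/-! ### Arrow data of the two notched tiles -/

lemma cross_I_mul (u : ℂ) (hu : ‖u‖ = 1) : cross u (Complex.I * u) = 1 := by
  have := dot_self u
  rw [hu] at this
  simp [cross, dot] at this ⊢; linarith

lemma dot_I_mul (u : ℂ) : dot u (Complex.I * u) = 0 := by
  simp [dot]; ring

lemma cross_v_zero_mul (u : ℂ) (hu : ‖u‖ = 1) : cross u (v 0 * u) = √2 / 2 := by
  have := dot_self u
  rw [hu] at this
  simp [cross, dot, v_zero] at this ⊢; linear_combination (√2 / 2) * this

lemma dot_v_zero_mul (u : ℂ) (hu : ‖u‖ = 1) : dot u (v 0 * u) = √2 / 2 := by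
  have := dot_self u
  rw [hu] at this
  simp [dot, v_zero] at this ⊢; linear_combination (√2 / 2) * this

lemma dot_comm (u w : ℂ) : dot u w = dot w u := by simp [dot]; ring

/-- The copies of the two notched tiles. -/
def IsCopy (τ : NotchedTile) : Prop := ∃ b u : ℂ, ‖u‖ = 1 ∧ (τ = sqTile b u ∨ τ = rhTile b u)

lemma exists_arrowData_of_mem {τ : NotchedTile} (hτ : IsCopy τ) {x y : ℂ} (h : (x, y) ∈ τ.arrows) :
    ∃ w o, ArrowData τ x y w o := by
  obtain ⟨b, u, hu, rfl | rfl⟩ := hτ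
  · have key1 : ArrowData (sqTile b u) b (b + u) (Complex.I * u)
        (b + Complex.I * u, b + u + Complex.I * u) := by
      have e : b + u - b = u := by ring
      refine ⟨by simp [sqTile], by simp [sqTile], by rw [e, hu], by simp [hu], ?_, ?_, ?_, ?_⟩
      · rw [e, cross_I_mul u hu]; norm_num
      · rw [e]; rfl
      · left; rw [e, dot_comm, dot_I_mul]; simp
      · intro c hc
        simp only [sqTile, mem_insert_iff, mem_singleton_iff] at hc
        rcases hc with rfl | rfl | rfl | rfl <;> simp
    have key2 : ArrowData (sqTile b u) b (b + Complex.I * u) u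
        (b + u, b + u + Complex.I * u) := by
      have e : b + Complex.I * u - b = Complex.I * u := by ring
      refine ⟨by simp [sqTile], by simp [sqTile], by simp [hu], hu, ?_, ?_, ?_, ?_⟩
      · rw [e, cross_comm, cross_I_mul u hu]; norm_num
      · rw [e, para_swap]; rfl
      · left; rw [e, dot_I_mul]; refine ⟨rfl, ?_⟩; ring_nf
      · intro c hc
        simp only [sqTile, mem_insert_iff, mem_singleton_iff] at hc
        have e2 : b + Complex.I * u + u = b + u + Complex.I * u := by ring
        rcases hc with rfl | rfl | rfl | rfl <;> simp [e2]
    simp only [sqTile, mem_insert_iff, mem_singleton_iff, Prod.mk.injEq] at h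
    rcases h with ⟨rfl, rfl⟩ | ⟨rfl, rfl⟩ | ⟨rfl, rfl⟩ | ⟨rfl, rfl⟩
    · exact ⟨_, _, key1⟩
    · exact ⟨_, _, key1.symm⟩
    · exact ⟨_, _, key2⟩
    · exact ⟨_, _, key2.symm⟩
  · have key1 : ArrowData (rhTile b u) (b + u) b (v 0 * u)
        (b + v 0 * u, b + u + v 0 * u) := by
      have e : b - (b + u) = -u := by ring
      refine ⟨by simp [rhTile], by simp [rhTile], by simp [e, hu], by simp [hu, norm_v],
        ?_, ?_, ?_, ?_⟩
      · rw [e, cross_neg_left, cross_v_zero_mul u hu, abs_neg]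
        exact one_half_le_half_sqrt_two.trans (le_abs_self _)
      · rw [e, para_flip]; rfl
      · right; rw [e, dot_neg_right, dot_comm, dot_v_zero_mul u hu]; simp
      · intro c hc
        simp only [rhTile, mem_insert_iff, mem_singleton_iff] at hc
        rcases hc with rfl | rfl | rfl | rfl <;> simp
    have key2 : ArrowData (rhTile b u) (b + v 0 * u) b u
        (b + u, b + u + v 0 * u) := by
      have e : b - (b + v 0 * u) = -(v 0 * u) := by ring
      have e2 : b + v 0 * u + u = b + u + v 0 * u := by ring
      refine ⟨by simp [rhTile], by simp [rhTile], by simp [e, hu, norm_v], hu,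
        ?_, ?_, ?_, ?_⟩
      · rw [e, cross_neg_left, cross_comm, cross_v_zero_mul u hu, neg_neg]
        exact one_half_le_half_sqrt_two.trans (le_abs_self _)
      · rw [e, para_flip, para_swap]; rfl
      · right; rw [e, dot_neg_right, dot_v_zero_mul u hu]; simp [e2]
      · intro c hc
        simp only [rhTile, mem_insert_iff, mem_singleton_iff] at hc
        rcases hc with rfl | rfl | rfl | rfl <;> simp [e2]
    simp only [rhTile, mem_insert_iff, mem_singleton_iff, Prod.mk.injEq] at h
    rcases h with ⟨rfl, rfl⟩ | ⟨rfl, rfl⟩ | ⟨rfl, rfl⟩ | ⟨rfl, rfl⟩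
    · exact ⟨_, _, key1⟩
    · exact ⟨_, _, key2⟩
    · exact ⟨_, _, key2.symm⟩
    · exact ⟨_, _, key1.symm⟩

lemma IsCopy.exists_arrowData {τ : NotchedTile} (hτ : IsCopy τ) :
    ∃ x y w o, ArrowData τ x y w o := by
  obtain ⟨b, u, hu, rfl | rfl⟩ := id hτ
  · obtain ⟨w, o, h⟩ := exists_arrowData_of_mem hτ (x := b) (y := b + u) (by simp [sqTile])
    exact ⟨_, _, _, _, h⟩
  · obtain ⟨w, o, h⟩ := exists_arrowData_of_mem hτ (x := b + u) (y := b) (by simp [rhTile])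
    exact ⟨_, _, _, _, h⟩

lemma IsNotchedTiling.isCopy {N : Set NotchedTile} (hN : IsNotchedTiling N) {τ : NotchedTile}
    (hτ : τ ∈ N) : IsCopy τ := (isCopy_iff τ).mp (hN.copies τ hτ)

lemma IsNotchedTiling.paraTiling {N : Set NotchedTile} (hN : IsNotchedTiling N) :
    ParaTiling (fun τ : N => τ.1.region) where
  shape τ := by
    obtain ⟨x, y, w, o, h⟩ := (hN.isCopy τ.2).exists_arrowData
    exact ⟨x, y - x, w, h.norm_edge, h.norm_side, h.cross_ge, h.region_eq⟩
  covers z := by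
    have : z ∈ ⋃ τ ∈ N, τ.region := hN.covers ▸ mem_univ z
    simpa using this
  meets τ σ h := by
    rcases hN.meets τ.1 τ.2 σ.1 σ.2 (fun e => h (Subtype.ext e)) with e | ⟨p, -, e⟩ | ⟨a, ha, e⟩
    · exact ⟨0, 0, fun z hz => by simp [e] at hz⟩
    · exact ⟨p, 0, fun z hz => ⟨0, by rw [e] at hz; simpa using hz⟩⟩
    · refine ⟨a.1, a.2 - a.1, fun z hz => ?_⟩
      rw [e, show a.2 = a.1 + (a.2 - a.1) by ring, mem_segment_add_iff] at hz
      obtain ⟨t, -, h⟩ := hz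
      exact ⟨t, by linear_combination h⟩

/-- On the other side of an edge of a tile there is a tile with the same arrow. -/
lemma IsNotchedTiling.exists_neighbor {N : Set NotchedTile} (hN : IsNotchedTiling N)
    {τ : NotchedTile} (hτ : τ ∈ N) {x y w : ℂ} {o : ℂ × ℂ} (h : ArrowData τ x y w o) {n : ℂ}
    (hn : dot (y - x) n = 0) (hw : 0 < dot w n) :
    ∃ σ ∈ N, ∃ w' o', ArrowData σ o.1 o.2 w' o' ∧ 0 < dot w' n := by
  -- `m` is the midpoint of the opposite edge. A tile that contains a point slightly beyond `m` in
  -- the direction `w` also contains `m`; since `m` is not a vertex and is on no other edge of `τ`,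
  -- the two tiles share the arrow `o`.
  set m : ℂ := x + ((1 / 2 : ℝ) : ℂ) * (y - x) + (1 : ℝ) * w with hm
  have h0 := h.cross_ne_zero
  have hmτ : m ∈ τ.region := by
    rw [h.region_eq]
    exact ⟨1 / 2, by norm_num, 1, by norm_num, hm⟩
  have hcont : Continuous fun ε : ℝ => m + ε * w := by fun_prop
  have hev : ∀ᶠ ε : ℝ in 𝓝 0, ∀ i : N, m + ε * w ∈ i.1.region → m ∈ i.1.region := by
    have ht : Tendsto (fun ε : ℝ => m + ε * w) (𝓝 0) (𝓝 m) := by simpa using hcont.tendsto 0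
    exact ht.eventually (hN.paraTiling.eventually_mem m)
  obtain ⟨ε, hε, hε0⟩ := ((hev.filter_mono nhdsWithin_le_nhds).and
    (eventually_mem_set.mpr (self_mem_nhdsWithin (a := (0 : ℝ)) (s := Ioi 0)))).exists
  have hε0' : 0 < ε := hε0
  obtain ⟨σ, hσ⟩ := hN.paraTiling.covers (m + ε * w)
  have hmσ := hε σ hσ
  have hne : τ ≠ σ.1 := by
    intro e
    have hσ' : m + ε * w ∈ τ.region := e ▸ hσ
    rw [h.region_eq] at hσ'
    obtain ⟨a, ha, c, hc, e⟩ := hσ'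
    have e' : x + ((1 / 2 : ℝ) : ℂ) * (y - x) + ((1 + ε : ℝ) : ℂ) * w =
      x + a * (y - x) + c * w := by
      rw [← e, hm]; push_cast; ring
    have := (coord_eq h0 e').2
    linarith [hc.2]
  have hcoord : ∀ a c : ℝ, m = x + a * (y - x) + c * w → a = 1 / 2 ∧ c = 1 := by
    intro a c e
    have := coord_eq h0 (hm.symm.trans e)
    exact ⟨this.1.symm, this.2.symm⟩
  have hinter : m ∈ τ.region ∩ σ.1.region := ⟨hmτ, hmσ⟩
  have ho : o ∈ σ.1.arrows := by
    rcases hN.meets τ hτ σ.1 σ.2 hne with e | ⟨p, hp, e⟩ | ⟨a, ha, e⟩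
    · rw [e] at hinter; exact absurd hinter (notMem_empty _)
    · exfalso
      rw [e, mem_singleton_iff] at hinter
      rw [← hinter] at hp
      obtain ⟨a, ha, hma⟩ := hp.1
      have hv : m = x ∨ m = y ∨ m = x + w ∨ m = y + w := by
        rcases h.arrows a ha with rfl | rfl | rfl | rfl | rfl | rfl
        · tauto
        · rcases h.opp with ⟨-, rfl⟩ | ⟨-, rfl⟩ <;> tauto
        all_goals tauto
      rcases hv with e | e | e | e
      · have := hcoord 0 0 (by rw [e]; push_cast; ring); norm_num at this
      · have := hcoord 1 0 (by rw [e]; push_cast; ring); norm_num at this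
      · have := hcoord 0 1 (by rw [e]; push_cast; ring); norm_num at this
      · have := hcoord 1 1 (by rw [e]; push_cast; ring); norm_num at this
    · rw [e] at hinter
      rw [show a.2 = a.1 + (a.2 - a.1) by ring, mem_segment_add_iff] at hinter
      obtain ⟨t, -, ht⟩ := hinter
      rcases h.arrows a ha.1 with rfl | rfl | rfl | rfl | rfl | rfl
      · have := hcoord t 0 (by rw [ht]; push_cast; ring); norm_num at this
      · exact ha.2
      · have := hcoord 0 t (by rw [ht]; push_cast; ring); norm_num at this
      · have := hcoord 0 (1 - t) (by rw [ht]; push_cast; ring); norm_num at this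
      · have := hcoord 1 t (by rw [ht]; push_cast; ring); norm_num at this
      · have := hcoord 1 (1 - t) (by rw [ht]; push_cast; ring); norm_num at this
  obtain ⟨w', o', h'⟩ := exists_arrowData_of_mem (hN.isCopy σ.2) ho
  refine ⟨σ.1, σ.2, w', o', h', ?_⟩
  change m + ε * w ∈ σ.1.region at hσ
  rw [h'.region_eq] at hσ
  obtain ⟨a, ha, c, hc, e⟩ := hσ
  -- In the scalar product with `n` the edge direction drops out, and `ε * dot w n = c * dot w' n`
  -- with `0 ≤ c` determines the side on which `σ` is.
  have key : ∀ s t : ℝ, ((s : ℝ) : ℂ) * (y - x) + ε * w = t * (y - x) + c * w' →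
      0 < dot w' n := by
    intro s t est
    have := congrArg (fun z => dot z n) est
    simp only [dot_add_left, dot_smul_left, hn, mul_zero, zero_add] at this
    by_contra hneg
    have h1 : c * dot w' n ≤ 0 := mul_nonpos_of_nonneg_of_nonpos hc.1 (not_lt.mp hneg)
    have h2 : 0 < ε * dot w n := mul_pos hε0' hw
    linarith
  rcases h.opp with ⟨-, rfl⟩ | ⟨-, rfl⟩
  · apply key (1 / 2) a
    simp only [hm] at e
    push_cast at e ⊢
    linear_combination e
  · apply key (-1 / 2) (-a)
    simp only [hm] at e
    push_cast at e ⊢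
    linear_combination e

/-- The point of an arrow that is on the Ammann bar of the arrow. -/
def barPoint (x y : ℂ) : ℂ := ((1 / 2 + √2 / 4 : ℝ) : ℂ) * x + ((1 / 2 - √2 / 4 : ℝ) : ℂ) * y

/-- In the plane the unit normal is unique up to sign, so the width `dot w n` of a tile is the
absolute value of its determinant. -/
lemma eq_I_mul_of_dot_eq_zero {e n : ℂ} (he : ‖e‖ = 1) (hn : ‖n‖ = 1) (h : dot e n = 0) :
    n = Complex.I * e ∨ n = -(Complex.I * e) := by
  have h1 := dot_self e
  have h2 := dot_self n
  rw [he] at h1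
  rw [hn] at h2
  simp only [dot] at h h1 h2
  have hc : cross e n ^ 2 = 1 := by
    simp only [cross]
    linear_combination (n.re * n.re + n.im * n.im) * h1 + h2 -
      (e.re * n.re + e.im * n.im) * h
  have hr : n.re = -cross e n * e.im := by
    simp only [cross]; linear_combination -n.re * h1 + e.re * h
  have hi : n.im = cross e n * e.re := by
    simp only [cross]; linear_combination -n.im * h1 + e.im * h
  rcases mul_self_eq_one_iff.mp ((sq _).symm.trans hc) with h | h <;> rw [h] at hr hi
  · left; apply Complex.ext <;> simp [hr, hi]
  · right; apply Complex.ext <;> simp [hr, hi]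

/-- Crossing a tile, the bar point moves orthogonally to the arrow. -/
lemma ArrowData.barPoint_opp {τ : NotchedTile} {x y w : ℂ} {o : ℂ × ℂ}
    (h : ArrowData τ x y w o) {n : ℂ} (hn : ‖n‖ = 1) (hd : dot (y - x) n = 0)
    (hw : 0 < dot w n) :
    ∃ X ∈ Icc (1 / 2 : ℝ) 1, barPoint o.1 o.2 = barPoint x y + X * n := by
  have he := dot_self (y - x)
  rw [h.norm_edge] at he
  have hne := eq_I_mul_of_dot_eq_zero h.norm_edge hn hd
  have hdec : w = (dot w n : ℝ) * n + (dot w (y - x) : ℝ) * (y - x) := by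
    simp only [dot] at he
    rcases hne with rfl | rfl <;> apply Complex.ext <;>
      simp [dot] <;> simp at he
    · linear_combination -w.re * he
    · linear_combination -w.im * he
    · linear_combination -w.re * he
    · linear_combination -w.im * he
  have habs : |cross (y - x) w| = dot w n := by
    rw [← abs_of_pos hw]
    rcases hne with rfl | rfl
    · congr 1; simp [cross, dot]; ring
    · rw [← abs_neg]; congr 1; simp [cross, dot]; ring
  refine ⟨dot w n, ⟨habs ▸ h.cross_ge, ?_⟩, ?_⟩
  · rw [← habs]
    have := abs_cross_le (y - x) w
    rwa [h.norm_edge, h.norm_side, one_mul] at this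
  · rcases h.opp with ⟨hz, rfl⟩ | ⟨hz, rfl⟩
    · rw [hz] at hdec
      simp only [barPoint]
      push_cast at hdec ⊢
      linear_combination hdec
    -- Reversing the arrow shifts the bar point by `√2 / 2` along `y - x`, the difference of the two
    -- weights. The component `-(√2 / 2)` of `w` along the arrow cancels this shift; the weights are
    -- chosen for this.
    · rw [hz] at hdec
      simp only [barPoint]
      push_cast at hdec ⊢
      linear_combination hdec

/-! ### Ammann bars -/

/-- From an arrow one can follow its Ammann bar as far as one wishes. -/
lemma IsNotchedTiling.exists_on_bar {N : Set NotchedTile} (hN : IsNotchedTiling N) {f : ℂ → ℤ}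
    {d n : ℂ}
    (hf : ∀ τ ∈ N, ∀ x y w o, ArrowData τ x y w o → (y - x = d ∨ y - x = -d) →
      f (x + w) + f (y + w) = f x + f y)
    (hn : ‖n‖ = 1) (hdn : dot d n = 0) (m : ℕ) :
    ∀ τ ∈ N, ∀ x y w o, ArrowData τ x y w o → (y - x = d ∨ y - x = -d) → 0 < dot w n →
    ∀ Y : ℝ, 0 ≤ Y → Y ≤ m / 2 → ∃ τ' ∈ N, ∃ x' y' w' o', ArrowData τ' x' y' w' o' ∧
      f x' + f y' = f x + f y ∧
      ∃ X : ℝ, |X - Y| ≤ 1 ∧ barPoint x' y' = barPoint x y + X * n := by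
  -- Each crossing advances by at least 1/2, so `m` crossings reach any `Y ≤ m / 2`. Each advances
  -- by at most 1, so the remaining distance is never negative when a tile is crossed with `1 < Y`.
  induction m with
  | zero =>
    intro τ hτ x y w o h _ _ Y h1 h2
    refine ⟨τ, hτ, x, y, w, o, h, rfl, 0, ?_, by simp⟩
    have : Y = 0 := le_antisymm (by simpa using h2) h1
    simp [this]
  | succ m ih =>
    intro τ hτ x y w o h hd hw Y h1 h2
    by_cases hY : Y ≤ 1
    · refine ⟨τ, hτ, x, y, w, o, h, rfl, 0, ?_, by simp⟩
      rw [abs_le]; constructor <;> linarith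
    · have hxn : dot (y - x) n = 0 := by
        rcases hd with e | e <;> rw [e]
        · exact hdn
        · rw [dot_neg_left, hdn, neg_zero]
      obtain ⟨σ, hσ, w', o', h', hw'⟩ := hN.exists_neighbor hτ h hxn hw
      obtain ⟨X, hX, hbar⟩ := h.barPoint_opp hn hxn hw
      have hd' : o.2 - o.1 = d ∨ o.2 - o.1 = -d := by
        rcases h.opp with ⟨-, rfl⟩ | ⟨-, rfl⟩
        · simpa using hd
        · rcases hd with e | e
          · right; rw [← e]; ring
          · left; linear_combination -e
      have hfo : f o.1 + f o.2 = f x + f y := by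
        rw [← hf τ hτ x y w o h hd]
        rcases h.opp with ⟨-, rfl⟩ | ⟨-, rfl⟩
        · rfl
        · exact add_comm _ _
      push_cast at h2
      obtain ⟨τ', hτ', x', y', w'', o'', hA, hf', X', hX', hb⟩ := ih σ hσ o.1 o.2 w' o' h' hd' hw'
        (Y - X) (by linarith [hX.2]) (by linarith [hX.1])
      refine ⟨τ', hτ', x', y', w'', o'', hA, hf'.trans hfo, X + X', ?_, ?_⟩
      · rw [show X + X' - Y = X' - (Y - X) by ring]; exact hX'
      · rw [hb, hbar]; push_cast; ring

lemma IsCopy.exists_arrowData_side {τ : NotchedTile} (hτ : IsCopy τ) {p e f : ℂ}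
    (h0 : cross e f ≠ 0) (h : τ.region = para p e f) :
    ∃ x y w o, ArrowData τ x y w o ∧ (y - x = e ∨ y - x = -e) := by
  have key : ∀ x y, (x, y) ∈ τ.arrows → (y - x = e ∨ y - x = -e) →
      ∃ x y w o, ArrowData τ x y w o ∧ (y - x = e ∨ y - x = -e) := by
    intro x y hxy hd
    obtain ⟨w, o, h⟩ := exists_arrowData_of_mem hτ hxy
    exact ⟨x, y, w, o, h, hd⟩
  have neg : ∀ {a b : ℂ}, a = b ∨ a = -b → -a = b ∨ -a = -b := by
    rintro a b (rfl | rfl) <;> simp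
  obtain ⟨b, u, hu, rfl | rfl⟩ := id hτ
  · have hc : cross u (Complex.I * u) ≠ 0 := by rw [cross_I_mul u hu]; norm_num
    rcases sides_of_para_eq h0 hc h.symm with ⟨h1, -⟩ | ⟨-, h1⟩
    · exact key b (b + u) (by simp [sqTile]) (by simpa using h1)
    · exact key b (b + Complex.I * u) (by simp [sqTile]) (by simpa using h1)
  · have hc : cross u (v 0 * u) ≠ 0 := by
      rw [cross_v_zero_mul u hu]; linarith [one_half_le_half_sqrt_two]
    rcases sides_of_para_eq h0 hc h.symm with ⟨h1, -⟩ | ⟨-, h1⟩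
    · refine key (b + u) b (by simp [rhTile]) ?_
      rw [show b - (b + u) = -u by ring]; exact neg h1
    · refine key (b + v 0 * u) b (by simp [rhTile]) ?_
      rw [show b - (b + v 0 * u) = -(v 0 * u) by ring]; exact neg h1

/-! ### The lift along Ammann bars -/

lemma IsCoord.sub_v {h : ℂ → Fin 4 → ℤ} (hh : IsCoord h) (z : ℂ) (k : Fin 4) :
    h (z + -v k) = h z - Pi.single k 1 := by
  rw [← latticeMap_single, ← map_neg, hh, sub_eq_add_neg]

lemma IsCoord.add_pm_v {h : ℂ → Fin 4 → ℤ} (hh : IsCoord h) (z : ℂ) {w : ℂ} {j k : Fin 4}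
    (hw : w = v j ∨ w = -v j) (hjk : j ≠ k) : h (z + w) k = h z k := by
  rcases hw with rfl | rfl
  · simp [hh.add_v, hjk.symm]
  · simp [hh.sub_v, hjk.symm]

lemma eq_of_pm_v {e : ℂ} {i k : Fin 4} (h1 : e = v i ∨ e = -v i) (h2 : e = v k ∨ e = -v k) :
    i = k := by
  rcases h1 with rfl | rfl <;> rcases h2 with h | h
  · exact v_injective h
  · exact absurd h (v_ne_neg _ _)
  · exact absurd h.symm (v_ne_neg _ _)
  · exact v_injective (neg_injective h)

section Formed

variable {T : Set Rhombus} {N : Set NotchedTile} {h : ℂ → Fin 4 → ℤ}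

/-- Between opposite edges `v k` one moves by `±v j` with `j ≠ k`, which leaves coordinate `k`
unchanged. The sum over both ends is used because it does not see the orientation of the arrow. -/
lemma coord_sum_opp (hreg : NotchedTile.region '' N = Rhombus.region '' T) (hh : IsCoord h)
    (k : Fin 4) : ∀ τ ∈ N, ∀ x y w o, ArrowData τ x y w o → (y - x = v k ∨ y - x = -v k) →
      h (x + w) k + h (y + w) k = h x k + h y k := by
  intro τ hτ x y w o hA hd
  obtain ⟨r, hr, e⟩ : τ.region ∈ Rhombus.region '' T := hreg ▸ mem_image_of_mem _ hτ
  rw [r.region_eq, hA.region_eq] at e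
  rcases sides_of_para_eq (cross_v_ne_zero r.lt.ne) hA.cross_ne_zero e with ⟨h1, h2⟩ | ⟨h1, h2⟩
  · have := eq_of_pm_v h1 hd
    subst this
    rw [hh.add_pm_v x h2 r.lt.ne', hh.add_pm_v y h2 r.lt.ne']
  · have := eq_of_pm_v h1 hd
    subst this
    rw [hh.add_pm_v x h2 r.lt.ne, hh.add_pm_v y h2 r.lt.ne]

lemma two_mul_lift_sub_le (hreg : NotchedTile.region '' N = Rhombus.region '' T)
    (hh : IsCoord h) {H : ℂ → Fin 4 → ℝ} (hH : ∀ r ∈ T, ∀ z ∈ r.region, H z = liftAt h r z)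
    (hL : ∀ z w k, |H z k - H w k| ≤ 2 * ‖z - w‖) {τ : NotchedTile} (hτ : τ ∈ N) {x y w : ℂ}
    {o : ℂ × ℂ} (hA : ArrowData τ x y w o) (k : Fin 4) :
    |2 * H x k - ((h x k + h y k : ℤ) : ℝ)| ≤ 2 := by
  obtain ⟨r, hr, e⟩ : τ.region ∈ Rhombus.region '' T := hreg ▸ mem_image_of_mem _ hτ
  rw [r.region_eq, hA.region_eq] at e
  have hv := fun {α γ : ℝ} (hα : α = 0 ∨ α = 1) (hγ : γ = 0 ∨ γ = 1) p hp =>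
    vertices_subset_of_para_eq (cross_v_ne_zero r.lt.ne) hA.cross_ne_zero e hα hγ p hp
  have hvx : x ∈ r.vertices := hv (Or.inl rfl) (Or.inl rfl) x (by simp)
  have hvy : y ∈ r.vertices := hv (Or.inr rfl) (Or.inl rfl) y (by simp)
  have hx : x ∈ r.region := by
    rw [r.region_eq, e]; exact ⟨0, by simp, 0, by simp, by simp⟩
  have hy : y ∈ r.region := by
    rw [r.region_eq, e]; exact ⟨1, by simp, 0, by simp, by simp⟩
  have ex : H x k = h x k := by rw [hH r hr x hx, liftAt_vertex hh hvx]
  have ey : H y k = h y k := by rw [hH r hr y hy, liftAt_vertex hh hvy]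
  have := hL x y k
  rw [norm_sub_rev, hA.norm_edge] at this
  push_cast
  rw [← ex, ← ey, show 2 * H x k - (H x k + H y k) = H x k - H y k by ring]
  linarith

lemma norm_barPoint_sub_le {τ : NotchedTile} {x y w : ℂ} {o : ℂ × ℂ}
    (hA : ArrowData τ x y w o) : ‖barPoint x y - x‖ ≤ 1 := by
  rw [show barPoint x y - x = ((1 / 2 - √2 / 4 : ℝ) : ℂ) * (y - x) by
    simp only [barPoint]; push_cast; ring, norm_mul, hA.norm_edge, Complex.norm_real, mul_one,
    Real.norm_eq_abs, abs_le]
  constructor <;> linarith [half_sqrt_two_le_one, Real.sqrt_nonneg 2]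

lemma norm_I_mul_v (k : Fin 4) : ‖Complex.I * v k‖ = 1 := by simp [norm_v]

/-- Along the lines orthogonal to `v k`, the coordinate `k` of the lift is bounded. -/
lemma lift_bounded_on_lines (hT : IsOctagonalTiling T) (hN : IsNotchedTiling N)
    (hreg : NotchedTile.region '' N = Rhombus.region '' T)
    (hh : IsCoord h) {H : ℂ → Fin 4 → ℝ} (hH : ∀ r ∈ T, ∀ z ∈ r.region, H z = liftAt h r z)
    (hL : ∀ z w k, |H z k - H w k| ≤ 2 * ‖z - w‖) (k : Fin 4) {z w : ℂ}
    (hzw : dot (v k) (z - w) = 0) : |H z k - H w k| ≤ 22 := by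
  -- If the line through `z` and `w` meets a tile with an edge `v k`, the bar of that tile is
  -- parallel to the line and stays near it. Otherwise coordinate `k` is constant on the segment.
  by_cases hk : ∃ t : ℝ, ∃ r ∈ T, w + t * (z - w) ∈ r.region ∧ (r.i = k ∨ r.j = k)
  · obtain ⟨t, r, hr, hp, hk⟩ := hk
    set p := w + t * (z - w) with hpdef
    obtain ⟨τ, hτ, e⟩ : r.region ∈ NotchedTile.region '' N := hreg ▸ mem_image_of_mem _ hr
    have hside : ∃ b f, cross (v k) f ≠ 0 ∧ τ.region = para b (v k) f := by
      rcases hk with rfl | rfl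
      · exact ⟨r.base, v r.j, cross_v_ne_zero r.lt.ne, by rw [e, r.region_eq]⟩
      · exact ⟨r.base, v r.i, cross_v_ne_zero r.lt.ne', by rw [e, r.region_eq, para_swap]⟩
    obtain ⟨b, f, h0, hf⟩ := hside
    obtain ⟨x, y, u, o, hA, hd⟩ := (hN.isCopy hτ).exists_arrowData_side h0 hf
    have hsum := coord_sum_opp hreg hh k
    -- Of the two opposite arrows of the tile, one has the tile ahead of it in the direction `n`.
    have start : ∀ n : ℂ, ‖n‖ = 1 → dot (v k) n = 0 → ∃ x' y' u' o', ArrowData τ x' y' u' o' ∧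
        (y' - x' = v k ∨ y' - x' = -v k) ∧ 0 < dot u' n ∧ h x' k + h y' k = h x k + h y k := by
      intro n hn hdn
      rcases lt_trichotomy (dot u n) 0 with hlt | heq | hgt
      · refine ⟨o.1, o.2, -u, (x, y), hA.symm, ?_, by rw [dot_neg_left]; linarith, ?_⟩
        · rcases hA.opp with ⟨-, rfl⟩ | ⟨-, rfl⟩
          · simpa using hd
          · rcases hd with e | e
            · right; rw [← e]; ring
            · left; linear_combination -e
        · rw [← hsum τ hτ x y u o hA hd]
          rcases hA.opp with ⟨-, rfl⟩ | ⟨-, rfl⟩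
          · rfl
          · exact add_comm _ _
      · exfalso
        apply hA.cross_ne_zero
        have hdn' : dot (y - x) n = 0 := by
          rcases hd with e | e <;> rw [e]
          · exact hdn
          · rw [dot_neg_left, hdn, neg_zero]
        rcases eq_I_mul_of_dot_eq_zero hA.norm_edge hn hdn' with e | e
        · rw [e] at heq; simp [dot, cross] at heq ⊢; linarith
        · rw [e] at heq; simp [dot, cross] at heq ⊢; linarith
      · exact ⟨x, y, u, o, hA, hd, hgt, rfl⟩
    -- The bar passes an arrow at `x'` within distance 5 = 2 + 1 + 1 + 1 of `q`, and 22 = 2 * (2 *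
    -- 5) + 2. The two instances at `z` and `w` give 44 for twice the difference.
    have main : ∀ q : ℂ, dot (v k) (q - p) = 0 →
        |2 * H q k - ((h x k + h y k : ℤ) : ℝ)| ≤ 22 := by
      intro q hq
      obtain ⟨n, Y, hn, hdn, hY, hqY⟩ : ∃ n : ℂ, ∃ Y : ℝ, ‖n‖ = 1 ∧ dot (v k) n = 0 ∧ 0 ≤ Y ∧
          q = p + Y * n := by
        by_cases hqp : q = p
        · exact ⟨Complex.I * v k, 0, norm_I_mul_v k, dot_I_mul _, le_rfl, by simp [hqp]⟩
        · have hne : ‖q - p‖ ≠ 0 := norm_ne_zero_iff.mpr (sub_ne_zero.mpr hqp)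
          refine ⟨((‖q - p‖⁻¹ : ℝ) : ℂ) * (q - p), ‖q - p‖, ?_, ?_, norm_nonneg _, ?_⟩
          · rw [norm_mul, Complex.norm_real, norm_inv, norm_norm, inv_mul_cancel₀ hne]
          · rw [dot_comm, dot_smul_left, dot_comm, hq, mul_zero]
          · rw [← mul_assoc, ← Complex.ofReal_mul, mul_inv_cancel₀ hne]; simp
      obtain ⟨x0, y0, u0, o0, hA0, hd0, hu0, hs0⟩ := start n hn hdn
      obtain ⟨m, hm⟩ := exists_nat_ge (2 * Y)
      obtain ⟨τ', hτ', x', y', w', o', hA', hs', X, hX, hb⟩ := hN.exists_on_bar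
        (f := fun z => h z k) hsum hn hdn m τ hτ x0 y0 u0 o0 hA0 hd0 hu0 Y hY (by linarith)
      have b1 := two_mul_lift_sub_le hreg hh hH hL hτ' hA' k
      have hx0 : ‖p - x0‖ ≤ 2 := by
        rw [← e, hA0.region_eq] at hp
        exact norm_sub_le_of_mem_para hA0.norm_edge hA0.norm_side hp
      have n1 := norm_barPoint_sub_le hA0
      have n2 := norm_barPoint_sub_le hA'
      have n3 : ‖((X - Y : ℝ) : ℂ) * n‖ ≤ 1 := by
        rw [norm_mul, hn, mul_one, Complex.norm_real]; exact hX
      have hdist : ‖q - x'‖ ≤ 5 := by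
        have : q - x' = (p - x0) - (barPoint x0 y0 - x0) + (barPoint x' y' - x') -
            ((X - Y : ℝ) : ℂ) * n := by
          rw [hqY, hb]; push_cast; ring
        rw [this]
        calc _ ≤ ‖p - x0‖ + ‖barPoint x0 y0 - x0‖ + ‖barPoint x' y' - x'‖ +
              ‖((X - Y : ℝ) : ℂ) * n‖ := by
              refine (norm_sub_le _ _).trans ?_
              gcongr
              refine (norm_add_le _ _).trans ?_
              gcongr
              exact norm_sub_le _ _
          _ ≤ 5 := by linarith
      have b2 := hL q x' k
      have hsx : h x' k + h y' k = h x k + h y k := hs'.trans hs0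
      rw [hsx] at b1
      rw [abs_le] at b1 b2 ⊢
      constructor <;> linarith [b1.1, b1.2, b2.1, b2.2]
    have m1 := main z (by
      rw [show z - p = ((1 - t : ℝ) : ℂ) * (z - w) by rw [hpdef]; push_cast; ring, dot_comm,
        dot_smul_left, dot_comm, hzw, mul_zero])
    have m2 := main w (by
      rw [show w - p = ((-t : ℝ) : ℂ) * (z - w) by rw [hpdef]; push_cast; ring, dot_comm,
        dot_smul_left, dot_comm, hzw, mul_zero])
    rw [abs_le] at m1 m2 ⊢
    constructor <;> linarith [m1.1, m1.2, m2.1, m2.2]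
  · push Not at hk
    have := abs_sub_le_of_eventually (f := fun t : ℝ => H (w + t * (z - w)) k) (C := 0) (by
      intro t ht
      have hc : Continuous fun s : ℝ => w + s * (z - w) := by fun_prop
      filter_upwards [(hc.tendsto t).eventually (hT.paraTiling.eventually_mem _)] with s hs _
      obtain ⟨r, hr, hrs⟩ := hT.exists_mem (w + s * (z - w))
      have hrt := hs ⟨r, hr⟩ hrs
      obtain ⟨k1, k2⟩ := hk s r hr hrs
      rw [hH r hr _ hrs, hH r hr _ hrt]
      simp [liftAt, k1.symm, k2.symm])
    have h2 : |H z k - H w k| ≤ 0 := by simpa using this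
    linarith

end Formed

/-! ### Stability of linear functions -/

/-- Hyers' argument: almost additivity puts every `(φ (m + 1) - K) / (m + 1)` below every `(φ (n +
1) + K) / (n + 1)`, and the supremum `α` of the former is the slope on the natural numbers. The
Lipschitz bound carries this to nonnegative reals, almost additivity to negative ones. -/
lemma exists_linear_of_almost_additive {φ : ℝ → ℝ} {K L : ℝ}
    (hadd : ∀ x y, |φ (x + y) - φ x - φ y| ≤ K) (hL : ∀ x y, |φ x - φ y| ≤ L * |x - y|) :
    ∃ α : ℝ, ∀ x, |φ x - α * x| ≤ 2 * L + 5 * K := by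
  have hK : 0 ≤ K := (abs_nonneg _).trans (hadd 0 0)
  have hL0 : 0 ≤ L := by
    have := (abs_nonneg _).trans (hL 1 0); simpa using this
  have hmul : ∀ (n : ℕ) (x : ℝ), |φ ((n + 1) * x) - (n + 1) * φ x| ≤ (n + 1) * K := by
    intro n x
    induction n with
    | zero => simpa using hK
    | succ n ih =>
      have h1 := hadd ((n + 1) * x) x
      push_cast
      rw [show (n + 1 + 1 : ℝ) * x = (n + 1) * x + x by ring]
      rw [abs_le] at ih h1 ⊢
      constructor <;> linarith [ih.1, ih.2, h1.1, h1.2]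
  have hcomp : ∀ m n : ℕ, (φ (m + 1) - K) / (m + 1) ≤ (φ (n + 1) + K) / (n + 1) := by
    intro m n
    have h1 := hmul n (m + 1)
    have h2 := hmul m (n + 1)
    rw [mul_comm ((m : ℝ) + 1)] at h2
    rw [div_le_div_iff₀ (by positivity) (by positivity)]
    rw [abs_le] at h1 h2
    linarith [h1.1, h1.2, h2.1, h2.2]
  set α := ⨆ m : ℕ, (φ (m + 1) - K) / (m + 1) with hα
  have hbdd : BddAbove (range fun m : ℕ => (φ (m + 1) - K) / ((m : ℝ) + 1)) :=
    ⟨_, by rintro _ ⟨m, rfl⟩; exact hcomp m 0⟩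
  have hnat : ∀ n : ℕ, |φ (n + 1) - α * (n + 1)| ≤ K := by
    intro n
    have h1 : (φ (n + 1) - K) / (n + 1) ≤ α := le_ciSup hbdd n
    have h2 : α ≤ (φ (n + 1) + K) / (n + 1) := ciSup_le fun m => hcomp m n
    rw [div_le_iff₀ (by positivity)] at h1
    rw [le_div_iff₀ (by positivity)] at h2
    rw [abs_le]; constructor <;> linarith
  have h0 : |φ 0| ≤ K := by
    have := hadd 0 0
    rw [add_zero, sub_self, zero_sub, abs_neg] at this; exact this
  have hα' : |α| ≤ L + 2 * K := by
    have h1 := hnat 0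
    have h2 := hL 1 0
    simp only [Nat.cast_zero, zero_add, mul_one, sub_zero, abs_one] at h1 h2
    rw [abs_le] at *
    constructor <;> linarith [h1.1, h1.2, h2.1, h2.2, h0.1, h0.2]
  have hpos : ∀ x, 0 ≤ x → |φ x - α * x| ≤ 2 * L + 3 * K := by
    intro x hx
    set n := ⌊x⌋₊
    have f1 : (n : ℝ) ≤ x := Nat.floor_le hx
    have f2 : x < n + 1 := Nat.lt_floor_add_one x
    have hd : |x - (n + 1)| ≤ 1 := by rw [abs_le]; constructor <;> linarith
    have h1 := hnat n
    have h2 := hL x (n + 1)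
    have h3 : |α * (x - (n + 1))| ≤ L + 2 * K := by
      rw [abs_mul]
      calc |α| * |x - (n + 1)| ≤ (L + 2 * K) * 1 :=
            mul_le_mul hα' hd (abs_nonneg _) (by linarith)
        _ = _ := mul_one _
    have h4 : L * |x - (n + 1)| ≤ L := by nlinarith
    rw [abs_le] at h1 h2 h3 ⊢
    constructor <;> linarith [h1.1, h1.2, h2.1, h2.2, h3.1, h3.2]
  refine ⟨α, fun x => ?_⟩
  rcases le_total 0 x with hx | hx
  · linarith [hpos x hx]
  · have h1 := hpos (-x) (by linarith)
    have h2 := hadd x (-x)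
    rw [add_neg_cancel] at h2
    rw [abs_le] at h0 h1 h2 ⊢
    constructor <;> linarith [h1.1, h1.2, h2.1, h2.2, h0.1, h0.2]

/-- Four instances of the equation eliminate `N₃` and `F` and show that `N₁ - N₁ 0` is additive up
to `4 * K`, hence the term `20 * K`. Going over to `N₃` costs `2 * K` more. -/
lemma exists_linear_of_pexider {N₁ N₃ F : ℝ → ℝ} {K L : ℝ}
    (hF : ∀ x y, |N₁ x - N₃ y - F (x - y)| ≤ K) (hL : ∀ x y, |N₁ x - N₁ y| ≤ L * |x - y|) :
    ∃ α c₁ c₃ : ℝ, ∀ x, |N₁ x - α * x - c₁| ≤ 2 * L + 22 * K ∧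
      |N₃ x - α * x - c₃| ≤ 2 * L + 22 * K := by
  have hK : 0 ≤ K := (abs_nonneg _).trans (hF 0 0)
  obtain ⟨α, hα⟩ := exists_linear_of_almost_additive (φ := fun x => N₁ x - N₁ 0) (K := 4 * K)
    (L := L) (by
      intro x y
      have h1 := hF (x + y) y
      have h2 := hF x 0
      have h3 := hF y y
      have h4 := hF 0 0
      rw [add_sub_cancel_right] at h1
      rw [sub_zero] at h2 h4
      rw [sub_self] at h3
      rw [abs_le] at *
      constructor <;> linarith [h1.1, h1.2, h2.1, h2.2, h3.1, h3.2, h4.1, h4.2]) (by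
      intro x y; simpa using hL x y)
  refine ⟨α, N₁ 0, N₃ 0, fun x => ⟨?_, ?_⟩⟩
  · have := hα x
    rw [abs_le] at this ⊢
    constructor <;> linarith [this.1, this.2]
  · have h1 := hα x
    have h3 := hF x x
    have h4 := hF 0 0
    rw [sub_self] at h3
    rw [sub_zero] at h4
    rw [abs_le] at *
    constructor <;> linarith [h1.1, h1.2, h3.1, h3.2, h4.1, h4.2]

/-! ### Planarity -/

/-- This is the quantitative core of planarity: the lift is at bounded distance from an affine image
of the plane with a single free parameter `α`, and `C` is independent of the tiling. -/
lemma exists_affine_approx : ∃ C : ℝ, 1 ≤ C ∧ ∀ (T : Set Rhombus), IsOctagonalTiling T →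
    CanBeFormed T → ∃ h : ℂ → Fin 4 → ℤ, IsLift T h ∧ ∃ (α : ℝ) (c : Fin 4 → ℝ),
      ∀ x ∈ liftSurface T h, ∃ z : ℂ, ∀ k,
        |x k - ![1 - α, α, 1 - α, α] k * dot z (v k) - c k| ≤ C := by
  refine ⟨5000, by norm_num, ?_⟩
  rintro T hT ⟨N, hN, hreg⟩
  obtain ⟨h, hh⟩ := exists_lattice_coords
  obtain ⟨H, hH, hL⟩ := exists_lift hT hh
  obtain ⟨d, hd⟩ := exists_proj_eq hT hh hH
  have hs := half_sqrt_two_sq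
  have hs1 := one_half_le_half_sqrt_two
  have hs2 := half_sqrt_two_le_one
  have hline : ∀ k z w, dot (v k) (z - w) = 0 → |H z k - H w k| ≤ 22 := fun k z w hzw =>
    lift_bounded_on_lines hT hN hreg hh hH hL k hzw
  have hre : ∀ z, √2 / 2 * (H z 0 - H z 2) - H z 3 = z.re + d.re := by
    intro z
    have := congrArg Complex.re (hd z)
    simp only [proj, Fin.sum_univ_four, v_zero, v_one, v_two, v_three] at this
    simp at this
    linarith
  have him : ∀ z, √2 / 2 * (H z 0 + H z 2) + H z 1 = z.im + d.im := by
    intro z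
    have := congrArg Complex.im (hd z)
    simp only [proj, Fin.sum_univ_four, v_zero, v_one, v_two, v_three] at this
    simp at this
    linarith
  set s := √2 / 2 with hsdef
  -- the bounds on the coordinates 1 and 3
  set F : ℝ → ℝ := fun t => t + d.re + d.im - 2 * s * H ⟨0, t⟩ 0 with hF
  -- At the point `⟨-y, x⟩`, the sum of `hre` and `him` relates coordinates 1, 3 and 0, and these
  -- depend, up to 22, on `x`, `y` and `x - y` only. Coordinate 0 has the factor `2 * s < 2`, so the
  -- error is at most 22 + 22 + 44.
  have hP : ∀ x y, |H ⟨0, x⟩ 1 - H ⟨-y, 0⟩ 3 - F (x - y)| ≤ 88 := by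
    intro x y
    have h1 := hline 1 ⟨0, x⟩ ⟨-y, x⟩ (by simp [v_one, dot])
    have h3 := hline 3 ⟨-y, 0⟩ ⟨-y, x⟩ (by simp [v_three, dot])
    have h0 := hline 0 ⟨0, x - y⟩ ⟨-y, x⟩ (by
      simp only [v_zero, dot, Complex.sub_re, Complex.sub_im]; ring)
    have e1 := hre ⟨-y, x⟩
    have e2 := him ⟨-y, x⟩
    have h0' : |2 * s * (H ⟨0, x - y⟩ 0 - H ⟨-y, x⟩ 0)| ≤ 44 * s := by
      rw [abs_mul, abs_of_pos (by linarith)]; nlinarith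
    simp only [hF]
    simp only at e1 e2
    have : 44 * s ≤ 44 := by linarith
    rw [abs_le] at h1 h3 h0' ⊢
    constructor <;> nlinarith [h1.1, h1.2, h3.1, h3.2, h0'.1, h0'.2]
  obtain ⟨α, c₁, c₃, hα⟩ := exists_linear_of_pexider (N₁ := fun x => H ⟨0, x⟩ 1)
    (N₃ := fun y => H ⟨-y, 0⟩ 3) (L := 2) hP (by
      intro x y
      have := hL ⟨0, x⟩ ⟨0, y⟩ 1
      rwa [show (⟨0, x⟩ : ℂ) - ⟨0, y⟩ = ((x - y : ℝ) : ℂ) * Complex.I by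
        apply Complex.ext <;> simp, norm_mul, Complex.norm_I, mul_one, Complex.norm_real] at this)
  -- 1962 = (2 * 2 + 22 * 88) + 22.
  have k1 : ∀ z, |H z 1 - α * z.im - c₁| ≤ 1962 := by
    intro z
    have h1 := hline 1 z ⟨0, z.im⟩ (by simp [v_one, dot])
    have h2 := (hα z.im).1
    rw [abs_le] at *
    constructor <;> linarith [h1.1, h1.2, h2.1, h2.2]
  have k3 : ∀ z, |H z 3 + α * z.re - c₃| ≤ 1962 := by
    intro z
    have h1 := hline 3 z ⟨z.re, 0⟩ (by simp [v_three, dot])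
    have h2 := (hα (-z.re)).2
    rw [neg_neg] at h2
    rw [abs_le] at *
    constructor <;> linarith [h1.1, h1.2, h2.1, h2.2]
  have hdiv : ∀ e : ℝ, |2 * s * e| ≤ 5000 → |e| ≤ 5000 := by
    intro e he
    rw [abs_mul, abs_of_pos (by linarith : 0 < 2 * s)] at he
    nlinarith [abs_nonneg e]
  have hc : ∀ a : ℝ, 2 * s * (a / (2 * s)) = a := fun a => by
    field_simp
  -- The sum and the difference of `hre` and `him` express coordinates 0 and 2 by 1 and 3, and `2 *
  -- s * s = 1` turns the slope into `1 - α`. The error 2 * 1962 is below 5000.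
  have k0 : ∀ z, |H z 0 - (1 - α) * (s * (z.re + z.im)) -
      (d.re + d.im - c₁ + c₃) / (2 * s)| ≤ 5000 := by
    intro z
    apply hdiv
    rw [mul_sub, hc]
    have e : 2 * s * (H z 0 - (1 - α) * (s * (z.re + z.im))) - (d.re + d.im - c₁ + c₃) =
        -(H z 1 - α * z.im - c₁) + (H z 3 + α * z.re - c₃) := by
      linear_combination hre z + him z - 2 * (1 - α) * (z.re + z.im) * hs
    rw [e]
    have h1 := k1 z
    have h3 := k3 z
    rw [abs_le] at *
    constructor <;> linarith [h1.1, h1.2, h3.1, h3.2]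
  have k2 : ∀ z, |H z 2 - (1 - α) * (s * (-z.re + z.im)) -
      (-d.re + d.im - c₁ - c₃) / (2 * s)| ≤ 5000 := by
    intro z
    apply hdiv
    rw [mul_sub, hc]
    have e : 2 * s * (H z 2 - (1 - α) * (s * (-z.re + z.im))) - (-d.re + d.im - c₁ - c₃) =
        -(H z 1 - α * z.im - c₁) - (H z 3 + α * z.re - c₃) := by
      linear_combination him z - hre z - 2 * (1 - α) * (-z.re + z.im) * hs
    rw [e]
    have h1 := k1 z
    have h3 := k3 z
    rw [abs_le] at *
    constructor <;> linarith [h1.1, h1.2, h3.1, h3.2]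
  refine ⟨h, IsCoord.isLift hh T, α, ![(d.re + d.im - c₁ + c₃) / (2 * s), c₁,
    (-d.re + d.im - c₁ - c₃) / (2 * s), c₃], ?_⟩
  rintro x ⟨r, hr, a, ha, b, hb, rfl⟩
  rw [← liftAt_eq, ← hH r hr _ (by rw [r.region_eq]; exact ⟨a, ha, b, hb, rfl⟩)]
  set z := r.base + a * v r.i + b * v r.j
  refine ⟨z, fun k => ?_⟩
  fin_cases k
  · have e : dot z (v 0) = s * (z.re + z.im) := by simp [dot, v_zero]; ring
    change |H z 0 - (1 - α) * dot z (v 0) - _| ≤ _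
    rw [e]; exact k0 z
  · refine le_trans (le_of_eq ?_) ((k1 z).trans (by norm_num))
    simp [dot, v_one]
  · have e : dot z (v 2) = s * (-z.re + z.im) := by simp [dot, v_two]; ring
    change |H z 2 - (1 - α) * dot z (v 2) - _| ≤ _
    rw [e]; exact k2 z
  · refine le_trans (le_of_eq ?_) ((k3 z).trans (by norm_num))
    simp [dot, v_three]

/-- The plane on which the coordinates are proportional to those of the standard plane, with
factors `1 - α` and `α`. -/
def deformedPlane (α : ℝ) : Submodule ℝ (Fin 4 → ℝ) :=
  Submodule.span ℝ {fun k => ![1 - α, α, 1 - α, α] k * (v k).re,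
    fun k => ![1 - α, α, 1 - α, α] k * (v k).im}

/-! ### Grassmann coordinates of the deformed planes -/

lemma linearIndependent_of_grassmann {a b : Fin 4 → ℝ} {i j : Fin 4}
    (h : a i * b j - a j * b i ≠ 0) : LinearIndependent ℝ ![a, b] := by
  rw [LinearIndependent.pair_iff]
  intro s t hst
  have hi := congrFun hst i
  have hj := congrFun hst j
  simp only [Pi.add_apply, Pi.smul_apply, smul_eq_mul, Pi.zero_apply] at hi hj
  constructor
  · apply (mul_eq_zero.mp (show s * (a i * b j - a j * b i) = 0 by
      linear_combination b j * hi - b i * hj)).resolve_right h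
  · apply (mul_eq_zero.mp (show t * (a i * b j - a j * b i) = 0 by
      linear_combination a i * hj - a j * hi)).resolve_right h

lemma HasGrassmannCoords.finrank_eq {E : Submodule ℝ (Fin 4 → ℝ)} {G : Fin 6 → ℝ}
    (h : HasGrassmannCoords E G) : Module.finrank ℝ E = 2 := by
  obtain ⟨a, b, hl, rfl, -⟩ := h
  have := finrank_span_eq_card hl
  rwa [Matrix.range_cons_cons_empty, Fintype.card_fin] at this

/-- The factors multiply `G₁₃` by `(1 - α) ^ 2`, `G₂₄` by `α ^ 2` and the four mixed coordinates by
`α * (1 - α)`. So `α = 1` gives `E_0`, `α = 0` gives `E_∞`, and otherwise `t` is the ratio of `G₁₃`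
to `G₁₂`. -/
lemma hasGrassmannCoords_deformedPlane (α : ℝ) : ∃ t : OnePoint ℝ,
    HasGrassmannCoords (deformedPlane α) (slopeCoords t) := by
  have hs := half_sqrt_two_sq
  have hs1 := one_half_le_half_sqrt_two
  set s := √2 / 2 with hsdef
  have hs0 : s ≠ 0 := by intro h; rw [h] at hs1; norm_num at hs1
  by_cases h1 : α = 1
  · subst h1
    refine ⟨((0 : ℝ) : OnePoint ℝ), _, _, ?_, rfl, 1, one_ne_zero, ?_⟩
    · apply linearIndependent_of_grassmann (i := 1) (j := 3)
      simp [v_one, v_three]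
    · have : slopeCoords ((0 : ℝ) : OnePoint ℝ) = ![0, 0, 0, 0, 1, 0] := if_pos rfl
      rw [this]
      funext i
      fin_cases i <;> simp [grassmann, v_zero, v_one, v_two, v_three]
  by_cases h0 : α = 0
  · subst h0
    refine ⟨OnePoint.infty, _, _, ?_, rfl, 1, one_ne_zero, ?_⟩
    · apply linearIndependent_of_grassmann (i := 0) (j := 2)
      simp [v_zero, v_two, ← hsdef]
      linarith
    · have : slopeCoords OnePoint.infty = ![0, 1, 0, 0, 0, 0] := rfl
      rw [this]
      funext i
      fin_cases i <;> simp [grassmann, v_zero, v_one, v_two, v_three, ← hsdef]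
      linarith
  have h1' : 1 - α ≠ 0 := sub_ne_zero.mpr (Ne.symm h1)
  have ht : (1 - α) / (α * s) ≠ 0 := div_ne_zero h1' (mul_ne_zero h0 hs0)
  have hc : α * (1 - α) * s ≠ 0 := mul_ne_zero (mul_ne_zero h0 h1') hs0
  refine ⟨(((1 - α) / (α * s) : ℝ) : OnePoint ℝ), _, _, ?_, rfl, α * (1 - α) * s, hc, ?_⟩
  · apply linearIndependent_of_grassmann (i := 0) (j := 1)
    simp [v_zero, v_one, ← hsdef, h0, h1', hs0]
  · have : slopeCoords (((1 - α) / (α * s) : ℝ) : OnePoint ℝ) =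
        ![1, (1 - α) / (α * s), 1, 1, 2 / ((1 - α) / (α * s)), 1] := if_neg ht
    rw [this]
    funext i
    fin_cases i <;> simp [grassmann, v_zero, v_one, v_two, v_three, ← hsdef]
    · ring
    · field_simp
      linear_combination 2 * hs
    · ring
    · ring
    · field_simp
      linear_combination -2 * hs
    · ring

lemma FitsInSlice.thickness_le {T : Set Rhombus} {E : Submodule ℝ (Fin 4 → ℝ)} {t : ℝ}
    (ht : 1 ≤ t) (h : FitsInSlice T E t) : thickness T E ≤ t :=
  csInf_le ⟨1, fun _ hx => hx.1⟩ ⟨ht, h⟩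

/-- The octagonal tilings formed by the notched tiles are planar. -/
theorem CanBeFormed.planar : ∃ C : ℝ, ∀ T : Set Rhombus, IsOctagonalTiling T → CanBeFormed T →
    ∃ t : OnePoint ℝ, ∃ E : Submodule ℝ (Fin 4 → ℝ),
      HasGrassmannCoords E (slopeCoords t) ∧ IsPlanar T E ∧ thickness T E ≤ C := by
  obtain ⟨C, hC, hmain⟩ := exists_affine_approx
  refine ⟨2 * C, fun T hT hf => ?_⟩
  obtain ⟨h, hh, α, c, hx⟩ := hmain T hT hf
  obtain ⟨t, ht⟩ := hasGrassmannCoords_deformedPlane α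
  have hfit : FitsInSlice T (deformedPlane α) (2 * C) := by
    refine ⟨h, hh, fun k => c k - C, fun x hxs => ?_⟩
    obtain ⟨z, hz⟩ := hx x hxs
    refine ⟨fun k => ![1 - α, α, 1 - α, α] k * dot z (v k), ?_, fun k => ?_⟩
    · rw [deformedPlane, Submodule.mem_span_pair]
      refine ⟨z.re, z.im, ?_⟩
      funext k
      simp only [Pi.add_apply, Pi.smul_apply, smul_eq_mul, dot]
      ring
    · have := abs_le.mp (hz k)
      simp only [Pi.sub_apply]
      constructor <;> linarith [this.1, this.2]
  exact ⟨t, _, ht, ⟨ht.finrank_eq, 2 * C, by linarith, hfit⟩, hfit.thickness_le (by linarith)⟩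

/-! ### Tilings by notched tiles are octagonal -/

lemma v_zero_sq : v 0 ^ 2 = Complex.I := by
  have := half_sqrt_two_sq
  rw [v_zero, sq]
  apply Complex.ext <;> simp
  linarith

lemma v_two_sq : v 2 ^ 2 = -Complex.I := by
  have := half_sqrt_two_sq
  rw [v_two, sq]
  apply Complex.ext <;> simp
  linarith

lemma eq_pm_v_of_pow_eight {d : ℂ} (h : d ^ 8 = 1) : ∃ k, d = v k ∨ d = -v k := by
  have h1 : (d ^ 2 - 1) * (d ^ 2 + 1) * ((d ^ 2 - Complex.I) * (d ^ 2 + Complex.I)) = 0 := by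
    linear_combination h - (d ^ 4 - 1) * Complex.I_sq
  have key : ∀ k : Fin 4, d ^ 2 = v k ^ 2 → ∃ k, d = v k ∨ d = -v k :=
    fun k hk => ⟨k, sq_eq_sq_iff_eq_or_eq_neg.mp hk⟩
  rcases mul_eq_zero.mp h1 with h2 | h2 <;> rcases mul_eq_zero.mp h2 with h3 | h3
  · exact key 3 (by rw [v_three]; linear_combination h3)
  · exact key 1 (by rw [v_one, Complex.I_sq]; linear_combination h3)
  · exact key 0 (by rw [v_zero_sq]; linear_combination h3)
  · exact key 2 (by rw [v_two_sq]; linear_combination h3)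

lemma v_zero_pow_eight : v 0 ^ 8 = 1 := by
  rw [show v 0 ^ 8 = (v 0 ^ 2) ^ 4 by ring, v_zero_sq, Complex.I_pow_four]

lemma I_pow_eight : Complex.I ^ 8 = 1 := by
  rw [show Complex.I ^ 8 = (Complex.I ^ 4) ^ 2 by ring, Complex.I_pow_four, one_pow]

/-- All edges of a tile differ by rotations through multiples of 45 degrees, which the eighth power
does not see. -/
lemma arrow_pow_eight {b u : ℂ} {τ : NotchedTile} (hτ : τ = sqTile b u ∨ τ = rhTile b u)
    {a : ℂ × ℂ} (ha : a ∈ τ.arrows) : (a.2 - a.1) ^ 8 = u ^ 8 := by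
  have h1 := v_zero_pow_eight
  have h2 := I_pow_eight
  rcases hτ with rfl | rfl
  · simp only [sqTile, mem_insert_iff, mem_singleton_iff] at ha
    rcases ha with rfl | rfl | rfl | rfl <;> simp only [] <;> ring_nf <;> simp [h2]
  · simp only [rhTile, mem_insert_iff, mem_singleton_iff] at ha
    rcases ha with rfl | rfl | rfl | rfl <;> simp only [] <;> ring_nf <;> simp [h1]

lemma IsCopy.finite_vertices {τ : NotchedTile} (h : IsCopy τ) : τ.vertices.Finite := by
  have hf : τ.arrows.Finite := by
    obtain ⟨b, u, -, rfl | rfl⟩ := h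
    · simp [sqTile]
    · simp [rhTile]
  refine ((hf.image Prod.fst).union (hf.image Prod.snd)).subset ?_
  rintro p ⟨a, ha, rfl | rfl⟩
  · exact Or.inl (mem_image_of_mem _ ha)
  · exact Or.inr (mem_image_of_mem _ ha)

lemma ArrowData.pow_eight {τ : NotchedTile} {x y w b u : ℂ} {o : ℂ × ℂ}
    (h : ArrowData τ x y w o) (hu : ‖u‖ = 1) (hτ : τ = sqTile b u ∨ τ = rhTile b u) :
    (y - x) ^ 8 = u ^ 8 ∧ w ^ 8 = u ^ 8 := by
  have h1 := arrow_pow_eight hτ h.mem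
  dsimp only at h1
  refine ⟨h1, ?_⟩
  have pm : ∀ {a b : ℂ}, b = a ∨ b = -a → b ^ 8 = a ^ 8 := by
    rintro a b (rfl | rfl)
    · rfl
    · rw [Even.neg_pow (by decide)]
  have hI : (Complex.I * u) ^ 8 = u ^ 8 := by rw [mul_pow, I_pow_eight, one_mul]
  have hv : (v 0 * u) ^ 8 = u ^ 8 := by rw [mul_pow, v_zero_pow_eight, one_mul]
  have hreg := h.region_eq
  rcases hτ with rfl | rfl
  · have hc : cross u (Complex.I * u) ≠ 0 := by rw [cross_I_mul _ hu]; norm_num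
    rcases sides_of_para_eq hc h.cross_ne_zero hreg with ⟨-, h2⟩ | ⟨-, h2⟩
    · rw [pm h2, hI]
    · exact pm h2
  · have hc : cross u (v 0 * u) ≠ 0 := by
      rw [cross_v_zero_mul _ hu]; linarith [one_half_le_half_sqrt_two]
    rcases sides_of_para_eq hc h.cross_ne_zero hreg with ⟨-, h2⟩ | ⟨-, h2⟩
    · rw [pm h2, hv]
    · exact pm h2

/-- All edges of a tiling by notched tiles have the same direction modulo 45 degrees. -/
lemma IsNotchedTiling.exists_direction {N : Set NotchedTile} (hN : IsNotchedTiling N) :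
    ∃ q : ℂ, ‖q‖ = 1 ∧ ∀ τ ∈ N, ∀ x y w o, ArrowData τ x y w o →
      (q * (y - x)) ^ 8 = 1 ∧ (q * w) ^ 8 = 1 := by
  choose b u hu hform using fun τ : N => hN.isCopy τ.2
  -- Tiles that meet only in a vertex need not have related directions, so the countable set of
  -- vertices is removed.
  have hconst := hN.paraTiling.const_of_countable (fun τ => u τ ^ 8)
    (W := ⋃ τ : N, τ.1.vertices) (by
      have := hN.paraTiling.countable
      have : Countable N := countable_univ_iff.mp this
      exact countable_iUnion fun τ => (hN.isCopy τ.2).finite_vertices.countable) (by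
      intro τ σ z hz hzτ hzσ
      by_cases hne : τ.1 = σ.1
      · rw [Subtype.ext hne]
      · rcases hN.meets τ.1 τ.2 σ.1 σ.2 hne with e | ⟨p, hp, e⟩ | ⟨a, ha, -⟩
        · exact absurd (show z ∈ τ.1.region ∩ σ.1.region from ⟨hzτ, hzσ⟩) (by simp [e])
        · exfalso
          have hzp : z ∈ τ.1.region ∩ σ.1.region := ⟨hzτ, hzσ⟩
          rw [e, mem_singleton_iff] at hzp
          exact hz (mem_iUnion.mpr ⟨τ, hzp ▸ hp.1⟩)
        · rw [← arrow_pow_eight (hform τ) ha.1, arrow_pow_eight (hform σ) ha.2])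
  obtain ⟨τ₀, -⟩ := hN.paraTiling.covers 0
  have hu0 : u τ₀ ≠ 0 := by
    intro h; have := hu τ₀; rw [h] at this; simp at this
  refine ⟨(u τ₀)⁻¹, by rw [norm_inv, hu, inv_one], fun τ hτ x y w o h => ?_⟩
  have h1 : (u ⟨τ, hτ⟩) ^ 8 = u τ₀ ^ 8 := hconst ⟨τ, hτ⟩ τ₀
  have key : ∀ d : ℂ, d ^ 8 = u ⟨τ, hτ⟩ ^ 8 → ((u τ₀)⁻¹ * d) ^ 8 = 1 := by
    intro d hd
    rw [mul_pow, hd, h1, ← mul_pow, inv_mul_cancel₀ hu0, one_pow]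
  exact ⟨key _ (h.pow_eight (hu _) (hform ⟨τ, hτ⟩)).1, key _ (h.pow_eight (hu _) (hform ⟨τ, hτ⟩)).2⟩

lemma exists_rhombus {p u w : ℂ} {i j : Fin 4} (hu : u = v i ∨ u = -v i)
    (hw : w = v j ∨ w = -v j) (hij : i ≠ j) : ∃ r : Rhombus, r.region = para p u w := by
  have h1 : ∃ p', para p u w = para p' (v i) w := by
    rcases hu with rfl | rfl
    · exact ⟨p, rfl⟩
    · exact ⟨p + -v i, by rw [← para_flip, neg_neg]⟩
  have h2 : ∀ p, ∃ p', para p (v i) w = para p' (v i) (v j) := by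
    intro p
    rcases hw with rfl | rfl
    · exact ⟨p, rfl⟩
    · exact ⟨p + -v j, by rw [← para_flip', neg_neg]⟩
  obtain ⟨p1, e1⟩ := h1
  obtain ⟨p2, e2⟩ := h2 p1
  rcases lt_or_gt_of_ne hij with h | h
  · exact ⟨⟨p2, i, j, h⟩, by rw [Rhombus.region_eq, e1, e2]⟩
  · exact ⟨⟨p2, j, i, h⟩, by rw [Rhombus.region_eq, e1, e2, para_swap]⟩

lemma Rhombus.mem_vertices_iff {r : Rhombus} {p : ℂ} : p ∈ r.vertices ↔
    ∃ α γ : ℝ, (α = 0 ∨ α = 1) ∧ (γ = 0 ∨ γ = 1) ∧ p = r.base + α * v r.i + γ * v r.j := by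
  constructor
  · rintro (rfl | rfl | rfl | rfl)
    · exact ⟨0, 0, by simp⟩
    · exact ⟨1, 0, by simp⟩
    · exact ⟨0, 1, by simp⟩
    · exact ⟨1, 1, by simp⟩
  · rintro ⟨α, γ, rfl | rfl, rfl | rfl, rfl⟩ <;> simp [Rhombus.vertices]

lemma Rhombus.hasEdge_of_vertices {r : Rhombus} {x : ℂ} {k : Fin 4} (hk : k = r.i ∨ k = r.j)
    (h1 : x ∈ r.vertices) (h2 : x + v k ∈ r.vertices) : r.HasEdge x k := by
  rw [Rhombus.mem_vertices_iff] at h1 h2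
  obtain ⟨α, γ, hα, hγ, rfl⟩ := h1
  obtain ⟨α', γ', hα', hγ', e⟩ := h2
  have h0 := cross_v_ne_zero r.lt.ne
  rcases hk with rfl | rfl
  · have : ((α + 1 - α' : ℝ) : ℂ) * v r.i + ((γ - γ' : ℝ) : ℂ) * v r.j = 0 := by
      push_cast; linear_combination e
    have := (eq_zero_of_comb h0 this).1
    have hα0 : α = 0 := by rcases hα with h | h <;> rcases hα' with h' | h' <;> linarith
    subst hα0
    rcases hγ with rfl | rfl
    · left; simp
    · right; right; left; simp
  · have : ((α - α' : ℝ) : ℂ) * v r.i + ((γ + 1 - γ' : ℝ) : ℂ) * v r.j = 0 := by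
      push_cast; linear_combination e
    have := (eq_zero_of_comb h0 this).2
    have hγ0 : γ = 0 := by rcases hγ with h | h <;> rcases hγ' with h' | h' <;> linarith
    subst hγ0
    rcases hα with rfl | rfl
    · right; left; simp
    · right; right; right; simp

lemma Rhombus.edge_of_region_eq {r : Rhombus} {x e w : ℂ} (h0 : cross e w ≠ 0)
    (h : r.region = para x e w) :
    x ∈ r.vertices ∧ x + e ∈ r.vertices ∧ segment ℝ x (x + e) ∈ r.edges := by
  rw [r.region_eq] at h
  have hc := cross_v_ne_zero r.lt.ne
  have hx : x ∈ r.vertices :=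
    vertices_subset_of_para_eq hc h0 h (Or.inl rfl) (Or.inl rfl) x (by simp)
  have hy : x + e ∈ r.vertices :=
    vertices_subset_of_para_eq hc h0 h (Or.inr rfl) (Or.inl rfl) (x + e) (by simp)
  refine ⟨hx, hy, ?_⟩
  rw [r.mem_edges_iff]
  have key : ∀ k, (k = r.i ∨ k = r.j) → (e = v k ∨ e = -v k) →
      ∃ q k, r.HasEdge q k ∧ segment ℝ x (x + e) = segment ℝ q (q + v k) := by
    rintro k hk (rfl | rfl)
    · exact ⟨x, k, Rhombus.hasEdge_of_vertices hk hx hy, rfl⟩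
    · refine ⟨x + -v k, k, Rhombus.hasEdge_of_vertices hk hy (by simpa using hx), ?_⟩
      rw [segment_symm]; simp
  rcases sides_of_para_eq hc h0 h with ⟨h1, -⟩ | ⟨h1, -⟩
  · exact key r.i (Or.inl rfl) h1
  · exact key r.j (Or.inr rfl) h1

lemma image_mul_para (q b u w : ℂ) :
    (fun z => q * z) '' para b u w = para (q * b) (q * u) (q * w) := by
  ext z
  constructor
  · rintro ⟨_, ⟨a, ha, c, hc, rfl⟩, rfl⟩
    exact ⟨a, ha, c, hc, by ring⟩
  · rintro ⟨a, ha, c, hc, rfl⟩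
    exact ⟨_, ⟨a, ha, c, hc, rfl⟩, by ring⟩

lemma cross_mul {q u w : ℂ} (hq : ‖q‖ = 1) : cross (q * u) (q * w) = cross u w := by
  have := dot_self q
  rw [hq] at this
  simp only [dot, cross, Complex.mul_re, Complex.mul_im] at this ⊢
  linear_combination (u.re * w.im - u.im * w.re) * this

lemma image_mul_segment (q a b : ℂ) :
    (fun z => q * z) '' segment ℝ a b = segment ℝ (q * a) (q * b) :=
  image_segment ℝ (LinearMap.mulLeft ℝ q).toAffineMap a b

/-- Every tiling by the notched tiles is octagonal, up to a rotation. -/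
theorem IsNotchedTiling.octagonal {N : Set NotchedTile} (hN : IsNotchedTiling N) :
    ∃ u : ℂ, ‖u‖ = 1 ∧ ∃ T : Set Rhombus, IsOctagonalTiling T ∧
      Rhombus.region '' T = (fun τ : NotchedTile => (fun z : ℂ => u * z) '' τ.region) '' N := by
  obtain ⟨q, hq, hdir⟩ := hN.exists_direction
  have hq0 : q ≠ 0 := by rintro rfl; simp at hq
  have hinj : Function.Injective fun z : ℂ => q * z := mul_right_injective₀ hq0
  have hex : ∀ τ : N, ∃ r : Rhombus, r.region = (fun z => q * z) '' τ.1.region := by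
    intro τ
    obtain ⟨x, y, w, o, h⟩ := (hN.isCopy τ.2).exists_arrowData
    obtain ⟨h1, h2⟩ := hdir _ τ.2 x y w o h
    obtain ⟨i, hi⟩ := eq_pm_v_of_pow_eight h1
    obtain ⟨j, hj⟩ := eq_pm_v_of_pow_eight h2
    rw [h.region_eq, image_mul_para]
    refine exists_rhombus hi hj ?_
    rintro rfl
    have hc : cross (q * (y - x)) (q * w) = 0 := by
      rcases hi with e | e <;> rcases hj with e' | e' <;> rw [e, e'] <;>
        simp [cross_self, cross_neg_left, cross_neg_right]
    rw [cross_mul hq] at hc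
    exact h.cross_ne_zero hc
  choose r hr using hex
  have hedge : ∀ (τ : N) a, a ∈ τ.1.arrows → q * a.1 ∈ (r τ).vertices ∧
      q * a.2 ∈ (r τ).vertices ∧ segment ℝ (q * a.1) (q * a.2) ∈ (r τ).edges := by
    intro τ a ha
    obtain ⟨w, o, h⟩ := exists_arrowData_of_mem (hN.isCopy τ.2) (x := a.1) (y := a.2) ha
    have hreg := hr τ
    rw [h.region_eq, image_mul_para] at hreg
    have := Rhombus.edge_of_region_eq (by rw [cross_mul hq]; exact h.cross_ne_zero) hreg
    rwa [show q * a.1 + q * (a.2 - a.1) = q * a.2 by ring] at this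
  have hvert : ∀ (τ : N) p, p ∈ τ.1.vertices → q * p ∈ (r τ).vertices := by
    rintro τ p ⟨a, ha, rfl | rfl⟩
    · exact (hedge τ a ha).1
    · exact (hedge τ a ha).2.1
  refine ⟨q, hq, range r, ⟨?_, ?_⟩, ?_⟩
  · rw [eq_univ_iff_forall]
    intro z
    obtain ⟨τ, hτ⟩ := hN.paraTiling.covers (q⁻¹ * z)
    refine mem_biUnion (mem_range_self τ) ?_
    rw [hr]
    exact ⟨_, hτ, by simp [mul_inv_cancel_left₀ hq0]⟩
  · rintro _ ⟨τ, rfl⟩ _ ⟨σ, rfl⟩ hne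
    have hne' : τ.1 ≠ σ.1 := fun e => hne (by rw [Subtype.ext e])
    rw [hr, hr, ← image_inter hinj]
    rcases hN.meets τ.1 τ.2 σ.1 σ.2 hne' with e | ⟨p, hp, e⟩ | ⟨a, ha, e⟩
    · left; rw [e, image_empty]
    · right; left
      exact ⟨q * p, ⟨hvert τ p hp.1, hvert σ p hp.2⟩, by rw [e, image_singleton]⟩
    · right; right
      exact ⟨segment ℝ (q * a.1) (q * a.2), ⟨(hedge τ a ha.1).2.2, (hedge σ a ha.2).2.2⟩,
        by rw [e, image_mul_segment]⟩
  · ext s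
    constructor
    · rintro ⟨_, ⟨τ, rfl⟩, rfl⟩
      exact ⟨τ.1, τ.2, (hr τ).symm⟩
    · rintro ⟨τ, hτ, rfl⟩
      exact ⟨r ⟨τ, hτ⟩, mem_range_self _, hr ⟨τ, hτ⟩⟩

/-! ### The planes `E_t` -/

/-- The combination of the coordinates other than `k` that counts the rhombi on a ribbon of edges
`v k` with signs. -/
def bal {R : Type*} [AddCommGroup R] (k : Fin 4) (x : Fin 4 → R) : R :=
  ![x 1 - x 3, x 0 + x 2, x 1 + x 3, x 2 - x 0] k

lemma bal_add {R : Type*} [AddCommGroup R] (k : Fin 4) (x y : Fin 4 → R) :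
    bal k (x + y) = bal k x + bal k y := by
  fin_cases k <;> simp [bal] <;> abel

/-- These are the vanishing 3 × 3 minors of the matrix with rows `a`, `b`, `x`. -/
lemma grassmann_relations {a b x : Fin 4 → ℝ} (hx : x ∈ Submodule.span ℝ {a, b}) :
    grassmann a b 3 * x 0 - grassmann a b 1 * x 1 + grassmann a b 0 * x 2 = 0 ∧
    grassmann a b 4 * x 0 - grassmann a b 2 * x 1 + grassmann a b 0 * x 3 = 0 ∧
    grassmann a b 5 * x 0 - grassmann a b 2 * x 2 + grassmann a b 1 * x 3 = 0 ∧
    grassmann a b 5 * x 1 - grassmann a b 4 * x 2 + grassmann a b 3 * x 3 = 0 := by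
  obtain ⟨s, t, rfl⟩ := Submodule.mem_span_pair.mp hx
  simp [grassmann]
  refine ⟨?_, ?_, ?_, ?_⟩ <;> ring

lemma HasGrassmannCoords.relations {E : Submodule ℝ (Fin 4 → ℝ)} {G : Fin 6 → ℝ}
    (h : HasGrassmannCoords E G) {x : Fin 4 → ℝ} (hx : x ∈ E) :
    G 3 * x 0 - G 1 * x 1 + G 0 * x 2 = 0 ∧ G 4 * x 0 - G 2 * x 1 + G 0 * x 3 = 0 ∧
    G 5 * x 0 - G 2 * x 2 + G 1 * x 3 = 0 ∧ G 5 * x 1 - G 4 * x 2 + G 3 * x 3 = 0 := by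
  obtain ⟨a, b, -, rfl, c, hc, e⟩ := h
  have := grassmann_relations hx
  rw [e] at this
  simp only [Pi.smul_apply, smul_eq_mul] at this
  obtain ⟨h1, h2, h3, h4⟩ := this
  refine ⟨?_, ?_, ?_, ?_⟩ <;> apply mul_left_cancel₀ hc
  · linear_combination h1
  · linear_combination h2
  · linear_combination h3
  · linear_combination h4

lemma relations_infty {E : Submodule ℝ (Fin 4 → ℝ)}
    (h : HasGrassmannCoords E (slopeCoords OnePoint.infty)) {x : Fin 4 → ℝ} (hx : x ∈ E) :
    x 1 = 0 ∧ x 3 = 0 := by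
  obtain ⟨h1, -, h3, -⟩ := h.relations hx
  rw [show slopeCoords OnePoint.infty = ![0, 1, 0, 0, 0, 0] from rfl] at h1 h3
  simpa using And.intro h1 h3

lemma relations_zero {E : Submodule ℝ (Fin 4 → ℝ)}
    (h : HasGrassmannCoords E (slopeCoords ((0 : ℝ) : OnePoint ℝ))) {x : Fin 4 → ℝ} (hx : x ∈ E) :
    x 0 = 0 ∧ x 2 = 0 := by
  obtain ⟨-, h2, -, h4⟩ := h.relations hx
  rw [show slopeCoords ((0 : ℝ) : OnePoint ℝ) = ![0, 0, 0, 0, 1, 0] from if_pos rfl] at h2 h4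
  simpa using And.intro h2 h4

lemma relations_coe {t : ℝ} (ht : t ≠ 0) {E : Submodule ℝ (Fin 4 → ℝ)}
    (h : HasGrassmannCoords E (slopeCoords (t : OnePoint ℝ))) {x : Fin 4 → ℝ} (hx : x ∈ E) :
    ∀ k, bal k x = ![2 / t, t, 2 / t, t] k * x k := by
  obtain ⟨h1, h2, h3, h4⟩ := h.relations hx
  rw [show slopeCoords (t : OnePoint ℝ) = ![1, t, 1, 1, 2 / t, 1] from if_neg ht] at h1 h2 h3 h4
  simp at h1 h2 h3 h4
  intro k
  fin_cases k <;> simp [bal] <;> linarith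

/-- The alternative is exactly what the notching needs: either no edge `v k` occurs in a thin
tiling, or `bal k` on the plane is controlled by coordinate `k` alone. -/
lemma relations_bal {t : OnePoint ℝ} {E : Submodule ℝ (Fin 4 → ℝ)}
    (h : HasGrassmannCoords E (slopeCoords t)) (k : Fin 4) :
    (∀ x ∈ E, x k = 0) ∨ ∃ f : ℝ, ∀ x ∈ E, bal k x = f * x k := by
  induction t using OnePoint.rec with
  | infty =>
    fin_cases k
    · right; exact ⟨0, fun x hx => by obtain ⟨h1, h3⟩ := relations_infty h hx; simp [bal, h1, h3]⟩
    · left; exact fun x hx => (relations_infty h hx).1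
    · right; exact ⟨0, fun x hx => by obtain ⟨h1, h3⟩ := relations_infty h hx; simp [bal, h1, h3]⟩
    · left; exact fun x hx => (relations_infty h hx).2
  | coe t =>
    by_cases ht : t = 0
    · subst ht
      fin_cases k
      · left; exact fun x hx => (relations_zero h hx).1
      · right; exact ⟨0, fun x hx => by obtain ⟨h1, h3⟩ := relations_zero h hx; simp [bal, h1, h3]⟩
      · left; exact fun x hx => (relations_zero h hx).2
      · right; exact ⟨0, fun x hx => by obtain ⟨h1, h3⟩ := relations_zero h hx; simp [bal, h1, h3]⟩
    · right; exact ⟨_, fun x hx => relations_coe ht h hx k⟩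

/-! ### Planar tilings of thickness one -/

section Thin

variable {T : Set Rhombus} {h : ℂ → Fin 4 → ℤ} {E : Submodule ℝ (Fin 4 → ℝ)}

lemma IsLift.add_v (hh : IsLift T h) {r : Rhombus} (hr : r ∈ T) {q : ℂ} {k : Fin 4}
    (he : r.HasEdge q k) : h (q + v k) = h q + Pi.single k 1 := by
  obtain ⟨h1, h2, h3⟩ := hh r hr
  rcases he with ⟨rfl, rfl⟩ | ⟨rfl, rfl⟩ | ⟨rfl, rfl⟩ | ⟨rfl, rfl⟩
  · exact h1
  · exact h2
  · rw [show r.base + v r.j + v r.i = r.base + v r.i + v r.j by ring, h3, h2]; abel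
  · rw [h3, h1]

lemma edge_mem_liftSurface (hh : IsLift T h) {r : Rhombus} (hr : r ∈ T) {q : ℂ} {k : Fin 4}
    (he : r.HasEdge q k) {a : ℝ} (ha : a ∈ Icc (0 : ℝ) 1) :
    (fun l => (h q l : ℝ)) + a • Pi.single k (1 : ℝ) ∈ liftSurface T h := by
  obtain ⟨h1, h2, -⟩ := hh r hr
  rcases he with ⟨rfl, rfl⟩ | ⟨rfl, rfl⟩ | ⟨rfl, rfl⟩ | ⟨rfl, rfl⟩
  · exact ⟨r, hr, a, ha, 0, by simp, by simp⟩
  · exact ⟨r, hr, 0, by simp, a, ha, by simp⟩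
  · refine ⟨r, hr, a, ha, 1, by simp, ?_⟩
    rw [h2]; funext l; simp [Pi.single_apply]; ring
  · refine ⟨r, hr, 1, by simp, a, ha, ?_⟩
    rw [h1]; funext l; simp [Pi.single_apply]

/-- The lifted ends of an edge `v k` differ by exactly 1 in coordinate `k`; a slice over `Ioo (-1)
1` excludes this, a closed one would not. -/
lemma not_hasEdge_of_coord_eq_zero (hh : IsLift T h)
    (hdiff : ∀ x ∈ liftSurface T h, ∀ y ∈ liftSurface T h, x - y ∈ slice E (Ioo (-1) 1))
    {k : Fin 4} (hk : ∀ x ∈ E, x k = 0) {r : Rhombus}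
    (hr : r ∈ T) (q : ℂ) : ¬ r.HasEdge q k := by
  intro he
  obtain ⟨y, hy, hy'⟩ := hdiff _ (edge_mem_liftSurface hh hr he (right_mem_Icc.mpr zero_le_one)) _
    (edge_mem_liftSurface hh hr he (left_mem_Icc.mpr zero_le_one))
  have := (hy' k).2
  simp [hk y hy] at this

/-- On a ribbon, the rhombi alternate. -/
lemma bal_le_of_level_eq (hh : IsLift T h)
    (hdiff : ∀ x ∈ liftSurface T h, ∀ y ∈ liftSurface T h, x - y ∈ slice E (Ioo (-1) 1))
    {t : OnePoint ℝ} (hE : HasGrassmannCoords E (slopeCoords t)) {k : Fin 4} {r s : Rhombus}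
    (hr : r ∈ T) (hs : s ∈ T) {q p : ℂ} (hq : r.HasEdge q k) (hp : s.HasEdge p k)
    (hqp : h q k = h p k) : bal k (h q) ≤ bal k (h p) + 1 := by
  rcases relations_bal hE k with h0 | ⟨f, hf⟩
  · exact absurd hq (not_hasEdge_of_coord_eq_zero hh hdiff h0 hr q)
  -- The points compared may be chosen anywhere on the two edges. With opposite ends chosen
  -- according to the sign of `f`, the vector `y` of the plane satisfies `f * y k ≤ 0`, so `bal k y
  -- ≤ 0`. The two coordinates in `bal k` are each off by less than 1, which leaves an integer
  -- difference below 2.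
  have key : ∀ a ∈ Icc (0 : ℝ) 1, ∀ b ∈ Icc (0 : ℝ) 1, f * (a - b) ≤ -|f| →
      bal k (h q) ≤ bal k (h p) + 1 := by
    intro a ha b hb hab
    obtain ⟨y, hy, hy'⟩ := hdiff _ (edge_mem_liftSurface hh hr hq ha) _
      (edge_mem_liftSurface hh hs hp hb)
    have hbal := hf y hy
    have hyk := hy' k
    have hqp' : (h q k : ℝ) = h p k := by exact_mod_cast hqp
    simp only [Pi.sub_apply, Pi.add_apply, Pi.smul_apply, Pi.single_eq_same, smul_eq_mul,
      mul_one, hqp'] at hyk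
    have hfy : f * y k ≤ 0 := by
      have h1 : |f * (a - b - y k)| ≤ |f| := by
        rw [abs_mul]
        have : |a - b - y k| ≤ 1 := by
          rw [abs_le]; constructor <;> linarith [hyk.1, hyk.2]
        nlinarith [abs_nonneg f]
      have := (abs_le.mp h1).1
      linarith
    rw [← hbal] at hfy
    have hlt : ((bal k (h q) : ℤ) : ℝ) < ((bal k (h p) : ℤ) : ℝ) + 2 := by
      have y0 := hy' 0
      have y1 := hy' 1
      have y2 := hy' 2
      have y3 := hy' 3
      fin_cases k <;> simp [bal] at y0 y1 y2 y3 hfy ⊢ <;>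
        linarith [y0.1, y0.2, y1.1, y1.2, y2.1, y2.2, y3.1, y3.2]
    have : bal k (h q) < bal k (h p) + 2 := by exact_mod_cast hlt
    omega
  rcases le_total 0 f with hf0 | hf0
  · exact key 0 (by simp) 1 (by simp) (by rw [abs_of_nonneg hf0]; linarith)
  · exact key 1 (by simp) 0 (by simp) (by rw [abs_of_nonpos hf0]; linarith)

/-- The edge from `q` to `q + v k` is not the lowest one of its ribbon. -/
def Up (T : Set Rhombus) (h : ℂ → Fin 4 → ℤ) (q : ℂ) (k : Fin 4) : Prop :=
  ∃ p, (∃ r ∈ T, r.HasEdge p k) ∧ h p k = h q k ∧ bal k (h p) < bal k (h q)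

open Classical in
/-- The arrow on the edge from `q` to `q + v k`. -/
def edgeArrow (T : Set Rhombus) (h : ℂ → Fin 4 → ℤ) (q : ℂ) (k : Fin 4) : ℂ × ℂ :=
  if Up T h q k then (q, q + v k) else (q + v k, q)

/-- The rhombus with the arrows on its edges. -/
def notch (T : Set Rhombus) (h : ℂ → Fin 4 → ℤ) (r : Rhombus) : NotchedTile where
  region := r.region
  arrows := {c | ∃ q k, r.HasEdge q k ∧ c = edgeArrow T h q k}

lemma notch_arrows (r : Rhombus) : (notch T h r).arrows =
    {edgeArrow T h r.base r.i, edgeArrow T h r.base r.j, edgeArrow T h (r.base + v r.j) r.i,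
      edgeArrow T h (r.base + v r.i) r.j} := by
  ext c
  simp only [notch, mem_ofPred_eq, mem_insert_iff, mem_singleton_iff, Rhombus.HasEdge]
  constructor
  · rintro ⟨q, k, ⟨rfl, rfl⟩ | ⟨rfl, rfl⟩ | ⟨rfl, rfl⟩ | ⟨rfl, rfl⟩, rfl⟩ <;> tauto
  · rintro (rfl | rfl | rfl | rfl)
    · exact ⟨_, _, Or.inl ⟨rfl, rfl⟩, rfl⟩
    · exact ⟨_, _, Or.inr (Or.inl ⟨rfl, rfl⟩), rfl⟩
    · exact ⟨_, _, Or.inr (Or.inr (Or.inl ⟨rfl, rfl⟩)), rfl⟩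
    · exact ⟨_, _, Or.inr (Or.inr (Or.inr ⟨rfl, rfl⟩)), rfl⟩

lemma edgeArrow_of_up {q : ℂ} {k : Fin 4} (hu : Up T h q k) :
    edgeArrow T h q k = (q, q + v k) := if_pos hu

lemma edgeArrow_of_not_up {q : ℂ} {k : Fin 4} (hu : ¬ Up T h q k) :
    edgeArrow T h q k = (q + v k, q) := if_neg hu

lemma up_congr {q p : ℂ} {k : Fin 4} (h1 : h p k = h q k) (h2 : bal k (h p) = bal k (h q)) :
    Up T h q k ↔ Up T h p k := by
  simp only [Up, h1, h2]

/-- The notched rhombi are the given notched tiles. -/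
lemma isCopy_notch (hh : IsLift T h)
    (hdiff : ∀ x ∈ liftSurface T h, ∀ y ∈ liftSurface T h, x - y ∈ slice E (Ioo (-1) 1))
    {t : OnePoint ℝ} (hE : HasGrassmannCoords E (slopeCoords t)) {r : Rhombus} (hr : r ∈ T) :
    IsCopy (notch T h r) := by
  obtain ⟨h1, h2, -⟩ := hh r hr
  have hij := r.lt
  have e1 : r.HasEdge r.base r.i := Or.inl ⟨rfl, rfl⟩
  have e2 : r.HasEdge r.base r.j := Or.inr (Or.inl ⟨rfl, rfl⟩)
  have e3 : r.HasEdge (r.base + v r.j) r.i := Or.inr (Or.inr (Or.inl ⟨rfl, rfl⟩))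
  have e4 : r.HasEdge (r.base + v r.i) r.j := Or.inr (Or.inr (Or.inr ⟨rfl, rfl⟩))
  have l1 : h (r.base + v r.j) r.i = h r.base r.i := by simp [h2, hij.ne]
  have l2 : h (r.base + v r.i) r.j = h r.base r.j := by simp [h1, hij.ne']
  have b1 : bal r.i (h (r.base + v r.j)) = bal r.i (h r.base) + bal r.i (Pi.single r.j 1) := by
    rw [h2, bal_add]
  have b2 : bal r.j (h (r.base + v r.i)) = bal r.j (h r.base) + bal r.j (Pi.single r.i 1) := by
    rw [h1, bal_add]
  -- The lower edge witnesses that the upper one is `Up`. An edge still below the lower one would be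
  -- at least two steps below the upper one.
  have up_of : ∀ {q p k}, r.HasEdge q k → r.HasEdge p k → h q k = h p k →
      bal k (h p) = bal k (h q) + 1 → Up T h p k ∧ ¬ Up T h q k := by
    intro q p k hq hp hl hb
    refine ⟨⟨q, ⟨r, hr, hq⟩, hl, by omega⟩, ?_⟩
    rintro ⟨p', ⟨s, hs, hp'⟩, hl', hb'⟩
    have := bal_le_of_level_eq hh hdiff hE hr hs hp hp' (hl.symm.trans hl'.symm)
    omega
  have hreg : (notch T h r).region = para r.base (v r.i) (v r.j) := r.region_eq
  -- The cases are the squares, the rhombi with an acute corner at the base (`j = i + 1`), and the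
  -- rhombus with `i = 0`, `j = 3`, whose base corner is obtuse.
  have hval : (v r.j = Complex.I * v r.i ∧ bal r.i (Pi.single r.j (1 : ℤ)) = 0 ∧
      bal r.j (Pi.single r.i (1 : ℤ)) = 0) ∨ (v r.j = v 0 * v r.i ∧
      bal r.i (Pi.single r.j (1 : ℤ)) = 1 ∧ bal r.j (Pi.single r.i (1 : ℤ)) = 1) ∨
      (v r.i = -(v 0 * v r.j) ∧
      bal r.i (Pi.single r.j (1 : ℤ)) = -1 ∧ bal r.j (Pi.single r.i (1 : ℤ)) = -1) := by
    have hs := half_sqrt_two_sq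
    generalize r.i = i at hij ⊢
    generalize r.j = j at hij ⊢
    fin_cases i <;> fin_cases j <;> simp at hij <;>
      simp [bal, Complex.ext_iff, v_zero, v_one, v_two, v_three, hs] <;> norm_num
  rcases hval with ⟨hv, c1, c2⟩ | ⟨hv, c1, c2⟩ | ⟨hv, c1, c2⟩
  · rw [c1, add_zero] at b1
    rw [c2, add_zero] at b2
    have u1 : Up T h (r.base + v r.j) r.i ↔ Up T h r.base r.i := up_congr l1.symm b1.symm
    have u2 : Up T h (r.base + v r.i) r.j ↔ Up T h r.base r.j := up_congr l2.symm b2.symm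
    have hI : Complex.I * v r.j = -v r.i := by
      rw [hv, ← mul_assoc, Complex.I_mul_I]; ring
    -- In a square the two arrow directions are independent; the corner that two arrows leave is the
    -- base of `sqTile`.
    by_cases hi : Up T h r.base r.i <;> by_cases hj : Up T h r.base r.j
    · refine ⟨r.base, v r.i, norm_v _, Or.inl (NotchedTile.ext ?_ ?_)⟩
      · rw [hreg, hv]; rfl
      · rw [notch_arrows, edgeArrow_of_up hi, edgeArrow_of_up hj, edgeArrow_of_up (u1.mpr hi),
          edgeArrow_of_up (u2.mpr hj)]
        simp only [sqTile, ← hv]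
        ext c
        simp only [mem_insert_iff, mem_singleton_iff]
        ring_nf
        tauto
    · refine ⟨r.base + v r.j, -v r.j, by simp [norm_v], Or.inl (NotchedTile.ext ?_ ?_)⟩
      · rw [hreg]; simp only [sqTile, mul_neg, hI, neg_neg]
        rw [para_flip, para_swap]
      · rw [notch_arrows, edgeArrow_of_up hi, edgeArrow_of_not_up hj, edgeArrow_of_up (u1.mpr hi),
          edgeArrow_of_not_up (u2.not.mpr hj)]
        simp only [sqTile, mul_neg, hI, neg_neg]
        ext c
        simp only [mem_insert_iff, mem_singleton_iff]
        ring_nf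
        tauto
    · refine ⟨r.base + v r.i, v r.j, norm_v _, Or.inl (NotchedTile.ext ?_ ?_)⟩
      · rw [hreg]; simp only [sqTile, hI]
        rw [para_flip', para_swap]
      · rw [notch_arrows, edgeArrow_of_not_up hi, edgeArrow_of_up hj,
          edgeArrow_of_not_up (u1.not.mpr hi), edgeArrow_of_up (u2.mpr hj)]
        simp only [sqTile, hI]
        ext c
        simp only [mem_insert_iff, mem_singleton_iff]
        ring_nf
        tauto
    · refine ⟨r.base + v r.i + v r.j, -v r.i, by simp [norm_v], Or.inl (NotchedTile.ext ?_ ?_)⟩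
      · rw [hreg]; simp only [sqTile, mul_neg, ← hv]
        rw [para_flip', para_flip]
      · rw [notch_arrows, edgeArrow_of_not_up hi, edgeArrow_of_not_up hj,
          edgeArrow_of_not_up (u1.not.mpr hi), edgeArrow_of_not_up (u2.not.mpr hj)]
        simp only [sqTile, mul_neg, ← hv]
        ext c
        simp only [mem_insert_iff, mem_singleton_iff]
        ring_nf
        tauto
  · rw [c1] at b1
    rw [c2] at b2
    obtain ⟨u1, u2⟩ := up_of e1 e3 l1.symm b1
    obtain ⟨u3, u4⟩ := up_of e2 e4 l2.symm b2
    refine ⟨r.base, v r.i, norm_v _, Or.inr (NotchedTile.ext ?_ ?_)⟩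
    · rw [hreg, hv]; rfl
    · rw [notch_arrows, edgeArrow_of_up u1, edgeArrow_of_up u3, edgeArrow_of_not_up u2,
        edgeArrow_of_not_up u4]
      simp only [rhTile, ← hv]
      ext c
      simp only [mem_insert_iff, mem_singleton_iff]
      ring_nf
      tauto
  · rw [c1] at b1
    rw [c2] at b2
    obtain ⟨u1, u2⟩ := up_of e3 e1 l1 (by omega)
    obtain ⟨u3, u4⟩ := up_of e4 e2 l2 (by omega)
    have hv' : v 0 * v r.j = -v r.i := by rw [hv, neg_neg]
    refine ⟨r.base + v r.i, v r.j, norm_v _, Or.inr (NotchedTile.ext ?_ ?_)⟩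
    · rw [hreg]; simp only [rhTile, hv']
      rw [para_flip', para_swap]
    · rw [notch_arrows, edgeArrow_of_up u1, edgeArrow_of_up u3, edgeArrow_of_not_up u2,
        edgeArrow_of_not_up u4]
      simp only [rhTile, hv']
      ext c
      simp only [mem_insert_iff, mem_singleton_iff]
      ring_nf
      tauto

lemma edgeArrow_ends (q : ℂ) (k : Fin 4) :
    (edgeArrow T h q k = (q, q + v k) ∨ edgeArrow T h q k = (q + v k, q)) := by
  by_cases hu : Up T h q k
  · exact Or.inl (edgeArrow_of_up hu)
  · exact Or.inr (edgeArrow_of_not_up hu)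

lemma vertices_subset_notch (r : Rhombus) : r.vertices ⊆ (notch T h r).vertices := by
  have key : ∀ q k, r.HasEdge q k → q ∈ (notch T h r).vertices ∧
      q + v k ∈ (notch T h r).vertices := by
    intro q k he
    have hm : edgeArrow T h q k ∈ (notch T h r).arrows := ⟨q, k, he, rfl⟩
    rcases edgeArrow_ends (T := T) (h := h) q k with e | e
    · exact ⟨⟨_, hm, by rw [e]; exact Or.inl rfl⟩, ⟨_, hm, by rw [e]; exact Or.inr rfl⟩⟩
    · exact ⟨⟨_, hm, by rw [e]; exact Or.inr rfl⟩, ⟨_, hm, by rw [e]; exact Or.inl rfl⟩⟩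
  rintro p (rfl | rfl | rfl | rfl)
  · exact (key _ _ (Or.inl ⟨rfl, rfl⟩)).1
  · exact (key _ _ (Or.inl ⟨rfl, rfl⟩)).2
  · exact (key _ _ (Or.inr (Or.inl ⟨rfl, rfl⟩))).2
  · exact (key _ _ (Or.inr (Or.inr (Or.inr ⟨rfl, rfl⟩)))).2

end Thin

/-- Planar octagonal tilings of thickness one with slope `E_t` can be formed by the notched
tiles. -/
theorem IsPlanarOfThicknessOne.canBeFormed {T : Set Rhombus} (hT : IsOctagonalTiling T)
    {E : Submodule ℝ (Fin 4 → ℝ)} {t : OnePoint ℝ} (hE : HasGrassmannCoords E (slopeCoords t))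
    (hpl : IsPlanarOfThicknessOne T E) : CanBeFormed T := by
  obtain ⟨-, h, hh, -, hdiff⟩ := hpl
  refine ⟨notch T h '' T, ⟨?_, ?_, ?_⟩, ?_⟩
  · rintro _ ⟨r, hr, rfl⟩
    exact (isCopy_iff _).mpr (isCopy_notch hh hdiff hE hr)
  · rw [biUnion_image]; exact hT.covers
  · rintro _ ⟨r, hr, rfl⟩ _ ⟨s, hs, rfl⟩ hne
    rcases hT.meets r hr s hs (fun e => hne (by rw [e])) with e | ⟨p, hp, e⟩ | ⟨a, ha, e⟩
    · exact Or.inl e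
    · exact Or.inr (Or.inl ⟨p, ⟨vertices_subset_notch r hp.1, vertices_subset_notch s hp.2⟩, e⟩)
    · right; right
      obtain ⟨q, k, hk, rfl⟩ := (r.mem_edges_iff a).mp ha.1
      obtain ⟨q', k', hk', e'⟩ := (s.mem_edges_iff _).mp ha.2
      obtain ⟨rfl, rfl⟩ := edge_eq_edge e'
      -- The arrow depends on the edge and not on the rhombus, so both tiles carry the same one.
      refine ⟨edgeArrow T h q k, ⟨⟨q, k, hk, rfl⟩, ⟨q, k, hk', rfl⟩⟩, ?_⟩
      rcases edgeArrow_ends (T := T) (h := h) q k with e'' | e'' <;> rw [e'']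
      · exact e
      · rw [segment_symm]; exact e
  · rw [image_image]; rfl

/-! ### Tilings by squares -/

/-- On each of the two planes two coordinates vanish, which forbids two orthogonal edge directions;
the other two span only squares. -/
lemma isSquare_of_slope {T : Set Rhombus} {E : Submodule ℝ (Fin 4 → ℝ)} {t : OnePoint ℝ}
    (ht : t = ((0 : ℝ) : OnePoint ℝ) ∨ t = OnePoint.infty)
    (hE : HasGrassmannCoords E (slopeCoords t)) (hpl : IsPlanarOfThicknessOne T E) {r : Rhombus}
    (hr : r ∈ T) : r.IsSquare := by
  obtain ⟨-, h, hh, -, hdiff⟩ := hpl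
  have hij := r.lt
  have n1 : ∀ k, (∀ x ∈ E, x k = 0) → r.i ≠ k ∧ r.j ≠ k := by
    intro k hk
    constructor <;> rintro rfl
    · exact not_hasEdge_of_coord_eq_zero hh hdiff hk hr _ (Or.inl ⟨rfl, rfl⟩)
    · exact not_hasEdge_of_coord_eq_zero hh hdiff hk hr _ (Or.inr (Or.inl ⟨rfl, rfl⟩))
  unfold Rhombus.IsSquare
  rcases ht with rfl | rfl
  · have h0 := n1 0 fun x hx => (relations_zero hE hx).1
    have h2 := n1 2 fun x hx => (relations_zero hE hx).2
    generalize r.i = i at *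
    generalize r.j = j at *
    fin_cases i <;> fin_cases j <;> simp at *
  · have h0 := n1 1 fun x hx => (relations_infty hE hx).1
    have h2 := n1 3 fun x hx => (relations_infty hE hx).2
    generalize r.i = i at *
    generalize r.j = j at *
    fin_cases i <;> fin_cases j <;> simp at *

lemma Rhombus.finite_vertices (r : Rhombus) : r.vertices.Finite := by
  simp [Rhombus.vertices]

/-- The pairs of directions 0, 2 and 1, 3 are disjoint, so squares with a common edge have the same
pair. -/
lemma exists_sides_of_squares {T : Set Rhombus} (hT : IsOctagonalTiling T)
    (hsq : ∀ r ∈ T, r.IsSquare) :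
    (∀ r ∈ T, r.i = 0 ∧ r.j = 2) ∨ ∀ r ∈ T, r.i = 1 ∧ r.j = 3 := by
  have hcases : ∀ r ∈ T, (r.i = 0 ∧ r.j = 2) ∨ (r.i = 1 ∧ r.j = 3) := by
    intro r hr
    have := hsq r hr
    unfold Rhombus.IsSquare at this
    generalize r.i = i at *
    generalize r.j = j at *
    fin_cases i <;> fin_cases j <;> simp at *
  have hc := hT.paraTiling.const_of_countable (fun r => r.1.i)
    (W := ⋃ r : T, r.1.vertices) (by
      have : Countable T := countable_univ_iff.mp hT.paraTiling.countable
      exact countable_iUnion fun r => r.1.finite_vertices.countable) (by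
      intro r s z hz hzr hzs
      by_cases hne : r.1 = s.1
      · rw [hne]
      · rcases hT.meets' r.2 s.2 hne hzr hzs with hv | ⟨q, k, h1, h2, -⟩
        · exact absurd (mem_iUnion.mpr ⟨r, hv.1⟩) hz
        · have k1 : k = r.1.i ∨ k = r.1.j := by
            rcases h1 with h | h | h | h <;> simp [h.2]
          have k2 : k = s.1.i ∨ k = s.1.j := by
            rcases h2 with h | h | h | h <;> simp [h.2]
          rcases hcases r.1 r.2 with ⟨a, b⟩ | ⟨a, b⟩ <;>
            rcases hcases s.1 s.2 with ⟨c, d⟩ | ⟨c, d⟩ <;> rw [a, b] at k1 <;>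
            rw [c, d] at k2 <;> rw [a, c] <;> rcases k1 with rfl | rfl <;> simp at k2)
  obtain ⟨r0, hr0, -⟩ := hT.exists_mem 0
  rcases hcases r0 hr0 with ⟨a, b⟩ | ⟨a, b⟩
  · left
    intro r hr
    have : r.i = 0 := (hc ⟨r, hr⟩ ⟨r0, hr0⟩).trans a
    rcases hcases r hr with h | h
    · exact h
    · rw [h.1] at this; simp at this
  · right
    intro r hr
    have : r.i = 1 := (hc ⟨r, hr⟩ ⟨r0, hr0⟩).trans a
    rcases hcases r hr with h | h
    · rw [h.1] at this; simp at this
    · exact h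

/-- The coordinates other than `i` and `j` never change along edges, so the lift is in a translate
of `E` itself and the cube contributes nothing. -/
lemma planar_of_same_sides {T : Set Rhombus} (hT : IsOctagonalTiling T) {i j : Fin 4}
    (hij : ∀ r ∈ T, r.i = i ∧ r.j = j) {E : Submodule ℝ (Fin 4 → ℝ)}
    (hE : E = Submodule.span ℝ {Pi.single i 1, Pi.single j 1}) (hfin : Module.finrank ℝ E = 2) :
    IsPlanarOfThicknessOne T E := by
  obtain ⟨h, hh⟩ := exists_lattice_coords
  have hne : i ≠ j := by
    obtain ⟨r, hr, -⟩ := hT.exists_mem 0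
    obtain ⟨rfl, rfl⟩ := hij r hr
    exact r.lt.ne
  have hmem : ∀ x : Fin 4 → ℝ, ∃ y ∈ E, y i = x i ∧ y j = x j ∧ ∀ k, k ≠ i → k ≠ j → y k = 0 := by
    intro x
    refine ⟨x i • Pi.single i 1 + x j • Pi.single j 1, ?_, ?_, ?_, ?_⟩
    · rw [hE, Submodule.mem_span_pair]; exact ⟨_, _, rfl⟩
    · simp [hne]
    · simp [hne.symm]
    · intro k hi hj; simp [hi, hj]
  have hslice : ∀ (x : Fin 4 → ℝ) (I : Set ℝ), 0 ∈ I → (∀ k, k ≠ i → k ≠ j → x k = 0) →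
      x ∈ slice E I := by
    intro x I hI hx
    obtain ⟨y, hy, h1, h2, h3⟩ := hmem x
    refine ⟨y, hy, fun k => ?_⟩
    have : x k - y k = 0 := by
      by_cases hi : k = i
      · subst hi; rw [h1, sub_self]
      · by_cases hj : k = j
        · subst hj; rw [h2, sub_self]
        · rw [hx k hi hj, h3 k hi hj, sub_self]
    rw [this]; exact hI
  have hvert : ∀ r ∈ T, ∀ p ∈ r.vertices, ∀ k, k ≠ i → k ≠ j → h p k = h r.base k := by
    intro r hr p hp k hki hkj
    obtain ⟨h1, h2, h3⟩ := IsCoord.isLift hh T r hr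
    obtain ⟨rfl, rfl⟩ := hij r hr
    rcases hp with rfl | rfl | rfl | rfl
    · rfl
    · simp [h1, hki]
    · simp [h2, hkj]
    · simp [h3, hki, hkj]
  obtain ⟨r0, hr0, -⟩ := hT.exists_mem 0
  have hconst : ∀ k, k ≠ i → k ≠ j → ∀ r ∈ T, h r.base k = h r0.base k := by
    intro k hki hkj r hr
    refine hT.paraTiling.const (fun r => h r.1.base k) ?_ ⟨r, hr⟩ ⟨r0, hr0⟩
    intro r s z hzr hzs
    by_cases hrs : r.1 = s.1
    · rw [hrs]
    · have hp : ∃ p, p ∈ r.1.vertices ∧ p ∈ s.1.vertices := by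
        rcases hT.meets' r.2 s.2 hrs hzr hzs with hv | ⟨q, k, h1, h2, -⟩
        · exact ⟨z, hv⟩
        · exact ⟨q, h1.mem_vertices.1, h2.mem_vertices.1⟩
      obtain ⟨p, h1, h2⟩ := hp
      exact (hvert r.1 r.2 p h1 k hki hkj).symm.trans (hvert s.1 s.2 p h2 k hki hkj)
  have hsurf : ∀ x ∈ liftSurface T h, ∀ k, k ≠ i → k ≠ j → x k = h r0.base k := by
    rintro x ⟨r, hr, a, -, b, -, rfl⟩ k hki hkj
    rw [← hconst k hki hkj r hr]
    obtain ⟨h1, h2⟩ := hij r hr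
    simp [h1, h2, hki, hkj]
  refine ⟨hfin, h, IsCoord.isLift hh T, ⟨fun k => h r0.base k, fun x hx => ?_⟩,
    fun x hx y hy => ?_⟩
  · refine hslice _ _ (by simp) fun k hki hkj => ?_
    simp [hsurf x hx k hki hkj]
  · refine hslice _ _ (by simp) fun k hki hkj => ?_
    simp [hsurf x hx k hki hkj, hsurf y hy k hki hkj]

lemma exists_slope_of_squares {T : Set Rhombus} (hT : IsOctagonalTiling T)
    (hsq : ∀ r ∈ T, r.IsSquare) :
    ∃ t : OnePoint ℝ, (t = ((0 : ℝ) : OnePoint ℝ) ∨ t = OnePoint.infty) ∧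
      ∃ E : Submodule ℝ (Fin 4 → ℝ), HasGrassmannCoords E (slopeCoords t) ∧
        IsPlanarOfThicknessOne T E := by
  rcases exists_sides_of_squares hT hsq with hs | hs
  · have hG : HasGrassmannCoords (Submodule.span ℝ {Pi.single 0 1, Pi.single 2 1})
        (slopeCoords OnePoint.infty) := by
      refine ⟨_, _, linearIndependent_of_grassmann (i := 0) (j := 2) (by simp), rfl, 1,
        one_ne_zero, ?_⟩
      rw [show slopeCoords OnePoint.infty = ![0, 1, 0, 0, 0, 0] from rfl]
      funext k
      fin_cases k <;> simp [grassmann]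
    exact ⟨_, Or.inr rfl, _, hG, planar_of_same_sides hT hs rfl hG.finrank_eq⟩
  · have hG : HasGrassmannCoords (Submodule.span ℝ {Pi.single 1 1, Pi.single 3 1})
        (slopeCoords ((0 : ℝ) : OnePoint ℝ)) := by
      refine ⟨_, _, linearIndependent_of_grassmann (i := 1) (j := 3) (by simp), rfl, 1,
        one_ne_zero, ?_⟩
      rw [show slopeCoords ((0 : ℝ) : OnePoint ℝ) = ![0, 0, 0, 0, 1, 0] from if_pos rfl]
      funext k
      fin_cases k <;> simp [grassmann]
    exact ⟨_, Or.inl rfl, _, hG, planar_of_same_sides hT hs rfl hG.finrank_eq⟩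

/-! ### Ammann–Beenker tilings -/

lemma ammannBeenkerPlane_eq : ammannBeenkerPlane =
    Submodule.span ℝ {![1, √2 / 2, 0, -(√2 / 2)], ![0, √2 / 2, 1, √2 / 2]} := by
  have h2 : (2 : ℝ) * (Real.pi / 4) = Real.pi / 2 := by ring
  have h3 : (3 : ℝ) * (Real.pi / 4) = Real.pi - Real.pi / 4 := by ring
  rw [ammannBeenkerPlane]
  congr 2
  · funext k
    fin_cases k <;> simp [h2, h3, Real.cos_pi_sub]
  · congr 1
    funext k
    fin_cases k <;> simp [h2, h3, Real.sin_pi_sub]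

lemma hasGrassmannCoords_ammannBeenkerPlane :
    HasGrassmannCoords ammannBeenkerPlane (slopeCoords ((√2 : ℝ) : OnePoint ℝ)) := by
  have hs := half_sqrt_two_sq
  have h2 : √2 ≠ 0 := by simp
  have hs2 : √2 * √2 = 2 := Real.mul_self_sqrt (by norm_num)
  refine ⟨_, _, linearIndependent_of_grassmann (i := 0) (j := 2) (by simp),
    ammannBeenkerPlane_eq, √2 / 2, by simp, ?_⟩
  rw [show slopeCoords ((√2 : ℝ) : OnePoint ℝ) = ![1, √2, 1, 1, 2 / √2, 1] from if_neg h2]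
  funext k
  fin_cases k <;> simp [grassmann] <;> field_simp <;> linarith

/-- The relations for `t = √2` recover coordinates 1 and 3 from 0 and 2, which gives one inclusion;
equal dimensions give equality. -/
lemma eq_ammannBeenkerPlane {E : Submodule ℝ (Fin 4 → ℝ)}
    (hE : HasGrassmannCoords E (slopeCoords ((√2 : ℝ) : OnePoint ℝ))) :
    E = ammannBeenkerPlane := by
  have h2 : √2 ≠ 0 := by simp
  have hs2 : √2 * √2 = 2 := Real.mul_self_sqrt (by norm_num)
  apply Submodule.eq_of_le_of_finrank_eq
  · intro x hx
    have hrel := relations_coe h2 hE hx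
    have r1 : x 0 + x 2 = √2 * x 1 := hrel 1
    have r3 : x 2 - x 0 = √2 * x 3 := hrel 3
    rw [ammannBeenkerPlane_eq, Submodule.mem_span_pair]
    refine ⟨x 0, x 2, ?_⟩
    funext k
    fin_cases k <;> simp
    · linear_combination (√2 / 2) * r1 + (x 1 / 2) * hs2
    · linear_combination (√2 / 2) * r3 + (x 3 / 2) * hs2
  · rw [hE.finrank_eq, hasGrassmannCoords_ammannBeenkerPlane.finrank_eq]

end

end Octagonal

theorem theorem1 :
    -- every tiling by the notched tiles is octagonal, up to a rotation of the plane
    (∀ N : Set Octagonal.NotchedTile, Octagonal.IsNotchedTiling N →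
      ∃ u : ℂ, ‖u‖ = 1 ∧ ∃ T : Set Octagonal.Rhombus, Octagonal.IsOctagonalTiling T ∧
        Octagonal.Rhombus.region '' T =
          (fun τ : Octagonal.NotchedTile => (fun z : ℂ => u * z) '' τ.region) '' N) ∧
    -- these octagonal tilings are planar, with slope some `E_t`, and of bounded thickness
    (∃ C : ℝ, ∀ T : Set Octagonal.Rhombus,
      Octagonal.IsOctagonalTiling T → Octagonal.CanBeFormed T →
        ∃ t : OnePoint ℝ, ∃ E : Submodule ℝ (Fin 4 → ℝ),
          Octagonal.HasGrassmannCoords E (Octagonal.slopeCoords t) ∧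
          Octagonal.IsPlanar T E ∧ Octagonal.thickness T E ≤ C) ∧
    -- the tilings by squares only are those of thickness one with slope `E_0` or `E_∞`
    (∀ T : Set Octagonal.Rhombus, Octagonal.IsOctagonalTiling T →
      ((∀ r ∈ T, r.IsSquare) ↔
        ∃ t : OnePoint ℝ, (t = ((0 : ℝ) : OnePoint ℝ) ∨ t = OnePoint.infty) ∧
          ∃ E : Submodule ℝ (Fin 4 → ℝ),
            Octagonal.HasGrassmannCoords E (Octagonal.slopeCoords t) ∧
            Octagonal.IsPlanarOfThicknessOne T E)) ∧
    -- all planar tilings of thickness one and slope `E_t` can be formed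
    (∀ (t : OnePoint ℝ) (E : Submodule ℝ (Fin 4 → ℝ)),
      Octagonal.HasGrassmannCoords E (Octagonal.slopeCoords t) →
        ∀ T : Set Octagonal.Rhombus, Octagonal.IsOctagonalTiling T →
          Octagonal.IsPlanarOfThicknessOne T E → Octagonal.CanBeFormed T) ∧
    -- those of slope `E_√2` are the Ammann-Beenker tilings
    (∀ T : Set Octagonal.Rhombus, Octagonal.IsAmmannBeenker T ↔
      Octagonal.IsOctagonalTiling T ∧ ∃ E : Submodule ℝ (Fin 4 → ℝ),
        Octagonal.HasGrassmannCoords E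
          (Octagonal.slopeCoords ((Real.sqrt 2 : ℝ) : OnePoint ℝ)) ∧
        Octagonal.IsPlanarOfThicknessOne T E) := by
  refine ⟨fun N hN => hN.octagonal, Octagonal.CanBeFormed.planar, fun T hT => ⟨fun hsq =>
    Octagonal.exists_slope_of_squares hT hsq, ?_⟩, fun t E hE T hT hpl => hpl.canBeFormed hT hE,
    fun T => ⟨fun h => ⟨h.1, _, Octagonal.hasGrassmannCoords_ammannBeenkerPlane, h.2⟩, ?_⟩⟩
  · rintro ⟨t, ht, E, hE, hpl⟩ r hr
    exact Octagonal.isSquare_of_slope ht hE hpl hr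
  · rintro ⟨hT, E, hE, hpl⟩
    exact ⟨hT, Octagonal.eq_ammannBeenkerPlane hE ▸ hpl⟩
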